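/- Let $G$ be a finitely generated virtually abelian group, let $\Sigma$ be a finite set generating $G$ as a monoid (for instance a finite generating set closed under inverses), and let $\omega\colon\Sigma\to\mathbb{N}\setminus\{0\}$ be a weight function. For $g\in G$ let $|g|$ be the weighted word length, i.e. the minimum of $\omega(\sigma_1)+\dots+\omega(\sigma_r)$ over all words $\sigma_1\cdots\sigma_r$ over $\Sigma$ representing $g$ (if all weights are $1$, this is the word length). For $k\ge 1$, a length constraint on $G^k$ is a subset of the form $$\Big\{(g_1,\dots,g_k)\in G^k : \sum_{i=1}^k\alpha_i|g_i|=\beta\Big\}\quad\text{or}\quad\Big\{(g_1,\dots,g_k)\in G^k : \sum_{i=1}^k\alpha_i|g_i|\le\beta\Big\}\qquad(\alpha_i,\beta\in\mathbb{Z}).$$ **Theorem.** 1. Every length constraint $L\subseteq G^k$ is a rational subset of $G^k$: for every finite set $X$ generating $G^k$ as a monoid, $L$ is the image of a regular language over $X$ under the natural map $X^*\to G^k$. 2. A rational, in fact semilinear, expression for $L$ can be computed. Describe $G$ by a basis $B=\{b_1<\dots<b_n\}$ of a finite-index free abelian normal subgroup $A$, a finite right transversal $T=\{t_1,\dots,t_m\}$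 of $A$, and the finite table $f$ sending each pair $(x,y)$ of letters in $(B\cup T)^{\pm1}$ to the normal form $b_1^{e_1}\cdots b_n^{e_n}t_j$ of the product $xy$. Elements of $\Sigma$ are given in this normal form. There is a single algorithm (a partial recursive function) which, given $(n,m,f)$, the list $\Sigma$ with the weights $\omega$, and the data $(\alpha_1,\dots,\alpha_k;\beta;\,=\text{ or }\le)$ of a length constraint $L\subseteq G^k$ as input, halts and outputs finitely many words $a_1,\dots,a_d$ and finite sets of words $B_1,\dots,B_d$, over the alphabet consisting of the letters in $(B\cup T)^{\pm1}$ placed in one of the $k$ coordinates of $G^k$, such that $L$ is the image in $G^k$ of the language of the regular expression $\bigcup_{i=1}^d a_iB_i^*$; equivalently, $L$ is the union of the linear sets $a_iB_i^*\subseteq G^k$. -/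

import Mathlib

/-! ### Weighted word length and length constraints -/

/-- The weighted word length of `g` with respect to the family `σ` of generators with weights `w`:
the least total weight of a word over the generators that represents `g`.
(With all weights equal to `1` it is the word length.) -/
noncomputable def weightedLength {G ι : Type*} [Group G] (σ : ι → G) (w : ι → ℕ) (g : G) : ℕ :=
  sInf {n | ∃ u : List ι, (u.map σ).prod = g ∧ (u.map w).sum = n}

/-- The set of all `(g₁, …, g_k) ∈ G^k` with `∑ αᵢ |gᵢ| = β`, for a length function `len`. -/
def lengthEqSet {G : Type*} (len : G → ℕ) {k : ℕ} (α : Fin k → ℤ) (β : ℤ) : Set (Fin k → G) :=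
  {g | ∑ i, α i * (len (g i) : ℤ) = β}

/-- The set of all `(g₁, …, g_k) ∈ G^k` with `∑ αᵢ |gᵢ| ≤ β`, for a length function `len`. -/
def lengthLeSet {G : Type*} (len : G → ℕ) {k : ℕ} (α : Fin k → ℤ) (β : ℤ) : Set (Fin k → G) :=
  {g | ∑ i, α i * (len (g i) : ℤ) ≤ β}

/-- A group is virtually abelian if it has an abelian subgroup of finite index. -/
def IsVirtuallyAbelian (G : Type*) [Group G] : Prop :=
  ∃ A : Subgroup G, A.FiniteIndex ∧ ∀ x ∈ A, ∀ y ∈ A, x * y = y * x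

/-- `L ⊆ M` is rational with respect to the family `X` of generators of `M` if it is the image of
a regular language over these generators. -/
def IsRationalSubset {M κ : Type*} [Monoid M] (X : κ → M) (L : Set M) : Prop :=
  ∃ R : Language κ, R.IsRegular ∧ L = {x | ∃ u ∈ R, (u.map X).prod = x}

/-! ### Descriptions of virtually abelian groups, as finite data -/

namespace VirtAb

/-- Letters `b_i^{±1}` (`Sum.inl i`) and `t_j^{±1}` (`Sum.inr j`);
the sign is `true` for exponent `+1` and `false` for exponent `-1`. -/
abbrev Letter : Type := (ℕ ⊕ ℕ) × Bool

/-- `([e₁, …, e_n], j)` stands for the subgroup-transversal normal form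
`b₁^{e₁} ⋯ b_n^{e_n} t_j`. -/
abbrev NormalForm : Type := List ℤ × ℕ

/-- The finite data describing a virtually abelian group: the size `rank` of the basis
`B = {b₁ < … < b_n}`, the size `index` of the transversal `T`, and (the graph of) the
collecting function, which sends a pair `(x, y)` of letters in `(B ∪ T)^{±1}` to the normal form
of the product `xy`. -/
structure Description where
  rank : ℕ
  index : ℕ
  collect : List ((Letter × Letter) × NormalForm)

/-- A length constraint as finite data: the coefficients `α₁, …, α_k`, the bound `β`, and whether
it is the equation (`true`) or the inequality `≤` (`false`). -/
structure LengthConstraint where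
  coeffs : List ℤ
  bound : ℤ
  isEquation : Bool

/-- A weighted generating set: a list of generators in normal form, each with its weight. -/
abbrev WeightedGens : Type := List (NormalForm × ℕ)

/-- Descriptions are triples. -/
def descriptionEquiv : Description ≃ ℕ × ℕ × List ((Letter × Letter) × NormalForm) where
  toFun D := (D.rank, D.index, D.collect)
  invFun p := ⟨p.1, p.2.1, p.2.2⟩
  left_inv _ := rfl
  right_inv _ := rfl

/-- Length constraints are triples. -/
def lengthConstraintEquiv : LengthConstraint ≃ List ℤ × ℤ × Bool where
  toFun c := (c.coeffs, c.bound, c.isEquation)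
  invFun p := ⟨p.1, p.2.1, p.2.2⟩
  left_inv _ := rfl
  right_inv _ := rfl

instance : Primcodable Description := Primcodable.ofEquiv _ descriptionEquiv

instance : Primcodable LengthConstraint := Primcodable.ofEquiv _ lengthConstraintEquiv

/-- The letter is one of the `b_i^{±1}` with `i < n` or `t_j^{±1}` with `j < m`. -/
def Letter.InRange (n m : ℕ) (x : Letter) : Prop :=
  Sum.elim (fun i => i < n) (fun j => j < m) x.1

/-- The exponent vector has length `n`, and the index of the transversal element is below `m`. -/
def NormalForm.InRange (n m : ℕ) (u : NormalForm) : Prop :=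
  u.1.length = n ∧ u.2 < m

section Evaluation

variable {G : Type*} [Group G] {n m : ℕ}

/-- `s i` if `i` is in range, and `1` otherwise. -/
def entry (s : Fin n → G) (i : ℕ) : G :=
  if h : i < n then s ⟨i, h⟩ else 1

/-- The element of `G` represented by a letter. -/
def letterValue (b : Fin n → G) (t : Fin m → G) (x : Letter) : G :=
  if x.2 then Sum.elim (entry b) (entry t) x.1 else (Sum.elim (entry b) (entry t) x.1)⁻¹

/-- The product `b₁^{e₁} ⋯ b_n^{e_n}`, in this order. -/
def basisProd (b : Fin n → G) (e : Fin n → ℤ) : G :=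
  (List.ofFn fun i => b i ^ e i).prod

/-- The element `b₁^{e₁} ⋯ b_n^{e_n} t_j` of `G` represented by a normal form. -/
def normalFormValue (b : Fin n → G) (t : Fin m → G) (u : NormalForm) : G :=
  basisProd b (fun i => u.1.getD i 0) * entry t u.2

/-- A letter of the alphabet of `G^k`: a coordinate together with a letter of `G`. -/
abbrev TupleLetter : Type := ℕ × Letter

/-- The letter `(i, x)` represents the tuple with `x` in coordinate `i`, and `1` elsewhere. -/
def tupleLetterValue (b : Fin n → G) (t : Fin m → G) (k : ℕ) (x : TupleLetter) : Fin k → G :=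
  fun i => if (i : ℕ) = x.1 then letterValue b t x.2 else 1

/-- The tuple in `G^k` represented by a word. -/
def tupleWordValue (b : Fin n → G) (t : Fin m → G) (k : ℕ) (u : List TupleLetter) : Fin k → G :=
  (u.map (tupleLetterValue b t k)).prod

end Evaluation

/-- `D` describes the group `G` through the elements `b₁, …, b_n` and `t₁, …, t_m`: the `b_i` form
a basis of a free abelian normal subgroup `A` of `G`, the `t_j` form a right transversal of `A`
(so that `A` has finite index `m`), and `D.collect` is the graph of the function that sends a pair
of letters to the normal form of its product. -/
structure Description.Describes (D : Description) {G : Type*} [Group G]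
    (b : Fin D.rank → G) (t : Fin D.index → G) : Prop where
  commute : ∀ i j, b i * b j = b j * b i
  independent : ∀ e : Fin D.rank → ℤ, basisProd b e = 1 → e = 0
  normal : (Subgroup.closure (Set.range b)).Normal
  injective : Function.Injective t
  transversal : Subgroup.IsComplement (Subgroup.closure (Set.range b) : Set G) (Set.range t)
  collect_sound : ∀ x y u, ((x, y), u) ∈ D.collect →
    Letter.InRange D.rank D.index x ∧ Letter.InRange D.rank D.index y ∧
      NormalForm.InRange D.rank D.index u ∧
      normalFormValue b t u = letterValue b t x * letterValue b t y
  collect_total : ∀ x y, Letter.InRange D.rank D.index x → Letter.InRange D.rank D.index y →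
    ∃ u, ((x, y), u) ∈ D.collect

/-- The elements of `G` in the list of generators. -/
def WeightedGens.value {G : Type*} [Group G] {n m : ℕ} (b : Fin n → G) (t : Fin m → G)
    (S : WeightedGens) (i : Fin S.length) : G :=
  normalFormValue b t (S.get i).1

/-- The weights of the generators. -/
def WeightedGens.weight (S : WeightedGens) (i : Fin S.length) : ℕ :=
  (S.get i).2

/-- `S` lists elements in normal form, with positive weights, such that every element of `G` is a
product of elements of `S`. -/
structure WeightedGens.Generates {G : Type*} [Group G] {n m : ℕ} (b : Fin n → G) (t : Fin m → G)
    (S : WeightedGens) : Prop where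
  inRange : ∀ s ∈ S, NormalForm.InRange n m s.1
  weight_pos : ∀ s ∈ S, 0 < s.2
  closure_eq_top : Submonoid.closure (Set.range (WeightedGens.value b t S)) = ⊤

/-- The subset of `G^k` defined by a length constraint, where `k` is its number of coefficients. -/
def LengthConstraint.solutions (c : LengthConstraint) {G : Type*} (len : G → ℕ) :
    Set (Fin c.coeffs.length → G) :=
  if c.isEquation then lengthEqSet len c.coeffs.get c.bound
  else lengthLeSet len c.coeffs.get c.bound

/-! ### Semilinear expressions -/

/-- A semilinear expression `⋃ᵢ aᵢ Bᵢ^*`: a list of pairs `(aᵢ, Bᵢ)`, where `aᵢ` is a word and `Bᵢ`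
is a finite list of words over the alphabet of `G^k`. -/
abbrev SemilinearExpr : Type := List (List TupleLetter × List (List TupleLetter))

/-- All letters of `E` are `b_j^{±1}` or `t_j^{±1}` in one of the `k` coordinates. -/
def SemilinearExpr.InRange (n m k : ℕ) (E : SemilinearExpr) : Prop :=
  ∀ p ∈ E, ∀ u ∈ p.1 :: p.2, ∀ x ∈ u, x.1 < k ∧ Letter.InRange n m x.2

/-- The regular expression whose language consists of the single word `u`. -/
def wordRegex {κ : Type*} (u : List κ) : RegularExpression κ :=
  (u.map RegularExpression.char).prod

/-- The rational (regular) expression `∑ᵢ aᵢ (∑_{b ∈ Bᵢ} b)^*`. -/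
def SemilinearExpr.toRegex (E : SemilinearExpr) : RegularExpression TupleLetter :=
  (E.map fun p => wordRegex p.1 * RegularExpression.star (p.2.map wordRegex).sum).sum

/-- The union of the linear sets `aᵢ Bᵢ^*` in `G^k`. -/
def SemilinearExpr.value {G : Type*} [Group G] {n m : ℕ} (b : Fin n → G) (t : Fin m → G) (k : ℕ)
    (E : SemilinearExpr) : Set (Fin k → G) :=
  {g | ∃ p ∈ E, ∃ h ∈ Submonoid.closure (tupleWordValue b t k '' {v | v ∈ p.2}),
    g = tupleWordValue b t k p.1 * h}

end VirtAb

/-! ### Predicates on `ℤ^d` with finite kernel -/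

namespace VirtAb

/-! Write the elements of G as b^a t_j. Right multiplication by a generator s adds to a a vector
that depends only on (j, s), and replaces t_j by another transversal element. So words over Σ are
paths in a finite graph whose vertices are the t_j and whose edges carry labels (weight, change of
exponents) in ℤ^{n+1}. By Kleene's argument in a commutative monoid, the sets {(N, a) : |b^a t_j| ≤
N} are semilinear (`PathSum.isSemilinearSet`, `exists_isLengthFamily`). The length is N when this
holds at N but not at N - 1, and a length constraint is then a linear condition. As semilinear sets
are closed under Boolean operations and preimages, the coordinate vectors of the solutions form
semilinear sets (`isSemilinearSet_solutionVectors`). Finally b^{p+y} t = b^p t · (t⁻¹ b^y t), and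
the second factor is multiplicative in y. Hence linear sets of coordinates become sets a B^* in G^k
(`value_toSemilinearExpr`).

This gives existence but no algorithm. The algorithm guesses: it runs through all pairs (R, E) of
lists of linear sets, R meant for the sublevel sets of the length and E for the solutions, until a
pair passes a primitive recursive test (`Valid`). The test is possible for three reasons.

Uniqueness: since weights are positive, |g| ≤ N is the only relation, confined to N ≥ 0, that
satisfies the recursion over the last letter (`iff_weightedLength_le`). So R is correct once it
satisfies this recursion at every vector, and E is correct once it agrees everywhere with a Boolean
combination of linear conditions and memberships in R.

Finite checking: read integer vectors in binary, lowest digit first. A finite automaton recognises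
membership in a linear set (`HasKernel.inLinear`), products of automata handle connectives
(`HasKernel.binary`), and a nonempty predicate with s states has a witness with entries bounded by
2^s (`HasKernel.exists_bounded`). An identity between such predicates thus holds everywhere if it
holds on an explicit box.

Bounded membership: the generators can be chosen with positive weight, because only finitely many
elements lie below each weight (`exists_list_of_isSemilinearSet`). Their coefficients are then
bounded by the weight of the vector.

The semilinearity results show that the search ends (`exists_valid`), and any pair that it finds is
correct (`Valid.solutions_eq`). For rationality, a finitely generated virtually abelian group is
first given a description (`exists_describes`), and each a B^* is the image of a regular language
over any generating family. -/

/-- The digit vectors, with entries `0` and `1`. -/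
def IsDigit {d : ℕ} (ε : Fin d → ℤ) : Prop := ∀ i, ε i = 0 ∨ ε i = 1

/-- The iterated sections `x ↦ f (2 x + ε)` of the predicate `f` are among `s` predicates. -/
def HasKernel {d : ℕ} (s : ℕ) (f : (Fin d → ℤ) → Prop) : Prop :=
  ∃ (Q : Type) (_ : Fintype Q) (sem : Q → (Fin d → ℤ) → Prop), Fintype.card Q ≤ s ∧
    (∀ q ε, IsDigit ε → ∃ q', ∀ x, sem q (2 • x + ε) ↔ sem q' x) ∧ ∃ q, ∀ x, sem q x ↔ f x

/-- `x` lies in the linear set `p + ⟨u⟩`. -/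
def InLinear {d r : ℕ} (p : Fin d → ℤ) (u : Fin r → Fin d → ℤ) (x : Fin d → ℤ) : Prop :=
  ∃ c : Fin r → ℕ, x = p + ∑ i, c i • u i

namespace HasKernel

variable {d : ℕ} {s t : ℕ} {f g : (Fin d → ℤ) → Prop}

theorem mono (hf : HasKernel s f) (h : s ≤ t) : HasKernel t f := by
  obtain ⟨Q, i, sem, hc, hs, hq⟩ := hf
  exact ⟨Q, i, sem, hc.trans h, hs, hq⟩

theorem congr (hf : HasKernel s f) (h : ∀ x, f x ↔ g x) : HasKernel s g := by
  obtain ⟨Q, i, sem, hc, hs, q, hq⟩ := hf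
  exact ⟨Q, i, sem, hc, hs, q, fun x => (hq x).trans (h x)⟩

theorem const (a : Prop) (h : 1 ≤ s) : HasKernel s (fun _ : Fin d → ℤ => a) :=
  ⟨Unit, inferInstance, fun _ _ => a, by simpa using h, fun _ _ _ => ⟨(), fun _ => Iff.rfl⟩,
    (), fun _ => Iff.rfl⟩

/-- Product automaton: a section of the combination is the combination of a pair of sections,
whatever the connective. -/
theorem binary (op : Prop → Prop → Prop) (hf : HasKernel s f) (hg : HasKernel t g) :
    HasKernel (s * t) (fun x => op (f x) (g x)) := by
  obtain ⟨Q, _, sem, hc, hs, q, hq⟩ := hf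
  obtain ⟨Q', _, sem', hc', hs', q', hq'⟩ := hg
  refine ⟨Q × Q', inferInstance, fun p x => op (sem p.1 x) (sem' p.2 x), ?_, ?_, (q, q'), ?_⟩
  · rw [Fintype.card_prod]
    exact Nat.mul_le_mul hc hc'
  · rintro ⟨a, a'⟩ ε hε
    obtain ⟨c, h⟩ := hs a ε hε
    obtain ⟨c', h'⟩ := hs' a' ε hε
    exact ⟨(c, c'), fun x => by simp only [h, h']⟩
  · intro x
    simp only [hq, hq']

theorem const_and (a : Prop) (h : 1 ≤ s) (hf : HasKernel s f) :
    HasKernel s (fun x => a ∧ f x) := by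
  by_cases ha : a
  · exact hf.congr fun x => by simp [ha]
  · exact (HasKernel.const False h).congr fun x => by simp [ha]

theorem not (hf : HasKernel s f) : HasKernel s (fun x => ¬ f x) := by
  obtain ⟨Q, i, sem, hc, hs, q, hq⟩ := hf
  refine ⟨Q, i, fun q x => ¬ sem q x, hc, fun q ε hε => ?_, q, fun x => not_congr (hq x)⟩
  obtain ⟨q', h⟩ := hs q ε hε
  exact ⟨q', fun x => not_congr (h x)⟩

theorem exists_mem {α : Type*} (l : List α) {f : α → (Fin d → ℤ) → Prop}
    (hf : ∀ a ∈ l, HasKernel s (f a)) : HasKernel (s ^ l.length) (fun x => ∃ a ∈ l, f a x) := by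
  induction l with
  | nil => exact (const False (by simp)).congr (by simp)
  | cons a l ih =>
    have := (hf a (by simp)).binary Or (ih fun b hb => hf b (by simp [hb]))
    rw [List.length_cons, pow_succ']
    exact this.congr (by simp)

theorem forall_mem {α : Type*} (l : List α) {f : α → (Fin d → ℤ) → Prop}
    (hf : ∀ a ∈ l, HasKernel s (f a)) : HasKernel (s ^ l.length) (fun x => ∀ a ∈ l, f a x) :=
  ((exists_mem l fun a ha => (hf a ha).not).not).congr fun x => by simp

/-- Suppose A(2x + ε) = p + ∑ c_j u_j, and split c_j = 2c'_j + δ_j with digits δ_j. Then A x = p' +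
∑ c'_j u_j, where 2p' = p + ∑ δ_j u_j - A ε. Reading a digit thus replaces the offset p by some p',
and `hC` keeps the offsets in the box [-C, C]^e. As δ is not determined by x, the states are sets of
offsets (subset construction). -/
theorem inLinear {e r C : ℕ} (A : (Fin d → ℤ) →+ (Fin e → ℤ)) (p : Fin e → ℤ)
    (u : Fin r → Fin e → ℤ) (hp : ∀ i, |p i| ≤ C)
    (hC : ∀ ε, IsDigit ε → ∀ i, |A ε i| + ∑ j, |u j i| ≤ C) :
    HasKernel (2 ^ (2 * C + 1) ^ e) (fun x => InLinear p u (A x)) := by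
  classical
  refine ⟨Set (Fin e → Set.Icc (-C : ℤ) C), inferInstance,
    fun σ x => ∃ p ∈ σ, InLinear (fun i => (p i : ℤ)) u (A x), ?_, ?_,
    {fun i => ⟨p i, abs_le.1 (hp i)⟩}, fun x => by simp⟩
  · rw [Fintype.card_set, Fintype.card_fun, Fintype.card_fin, Fintype.card_ofFinset,
      Int.card_Icc]
    refine le_of_eq ?_
    congr 2
    omega
  intro σ ε hε
  -- Here δ need not consist of digits: any natural δ recombines to coefficients 2c + δ.
  refine ⟨{p' | ∃ p ∈ σ, ∃ δ : Fin r → ℕ,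
    (fun i => 2 * (p' i : ℤ)) = (fun i => (p i : ℤ)) + ∑ j, δ j • u j - A ε}, fun x => ?_⟩
  constructor
  · rintro ⟨p, hpσ, c, hc⟩
    rw [map_add, map_nsmul] at hc
    have hc' : ∑ i, c i • u i = 2 • ∑ i, (c i / 2) • u i + ∑ i, (c i % 2) • u i := by
      rw [Finset.smul_sum, ← Finset.sum_add_distrib]
      refine Finset.sum_congr rfl fun i _ => ?_
      rw [smul_smul, ← add_smul, Nat.div_add_mod]
    set y : Fin e → ℤ := A x - ∑ i, (c i / 2) • u i with hy
    have h2 : (2 : ℕ) • y = (fun i => (p i : ℤ)) + ∑ j, (c j % 2) • u j - A ε := by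
      rw [hy, smul_sub, eq_sub_of_add_eq hc, hc']
      abel
    -- The invariant of the box: 2|y i| ≤ |p i| + (|A ε i| + ∑ |u j i|) ≤ C + C.
    have hb : ∀ i, y i ∈ Set.Icc (-C : ℤ) C := by
      intro i
      have h := congrFun h2 i
      simp only [Pi.smul_apply, Pi.add_apply, Pi.sub_apply, Finset.sum_apply] at h
      simp only [nsmul_eq_mul, Nat.cast_ofNat] at h
      have h3 : |∑ j, ((c j % 2 : ℕ) : ℤ) * u j i| ≤ ∑ j, |u j i| := by
        refine (Finset.abs_sum_le_sum_abs _ _).trans (Finset.sum_le_sum fun j _ => ?_)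
        rcases Nat.mod_two_eq_zero_or_one (c j) with h | h <;> simp [h]
      have h4 := hC ε hε i
      have h5 := abs_le.2 (p i).2
      rw [abs_le] at h3 h5
      have h6 := abs_le.1 (le_refl |A ε i|)
      constructor <;> linarith [h3.1, h3.2, h5.1, h5.2, h6.1, h6.2]
    refine ⟨fun i => ⟨y i, hb i⟩, ⟨p, hpσ, fun j => c j % 2, ?_⟩, fun j => c j / 2, ?_⟩
    · rw [← h2]
      ext i
      simp
    · ext i
      simp [hy]
  · rintro ⟨p', ⟨p, hpσ, δ, hδ⟩, c, hc⟩
    refine ⟨p, hpσ, fun j => 2 * c j + δ j, ?_⟩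
    rw [map_add, map_nsmul, hc]
    have : (fun i => 2 * (p' i : ℤ)) = (2 : ℕ) • (fun i => (p' i : ℤ)) := by ext i; simp
    rw [this] at hδ
    rw [smul_add, hδ]
    simp only [add_smul, mul_smul, Finset.sum_add_distrib, Finset.smul_sum]
    abel

/-- The states that hold somewhere on [-2^L, 2^L)^d form an increasing sequence of sets, and each
set determines the next one. It therefore grows strictly until it becomes constant, so a state that
ever appears does so for some L ≤ s. -/
theorem exists_bounded (hf : HasKernel s f) {x : Fin d → ℤ} (hx : f x) :
    ∃ y, f y ∧ ∀ i, |y i| ≤ 2 ^ s := by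
  classical
  obtain ⟨Q, _, sem, hc, hs, q₀, hq⟩ := hf
  choose! nxt hnxt using hs
  -- The half-open range is that of two's complement: halving with rounding down takes the range for
  -- L + 1 to the range for L, also for negative entries.
  let R : ℕ → Finset Q := fun L =>
    {q | ∃ y, (∀ i, -2 ^ L ≤ y i ∧ y i < 2 ^ L) ∧ sem q y}
  have memR : ∀ L q, q ∈ R L ↔ ∃ y, (∀ i, -2 ^ L ≤ y i ∧ y i < 2 ^ L) ∧ sem q y := by
    intro L q; simp [R]
  have hstep : ∀ L q, q ∈ R (L + 1) ↔ ∃ ε, IsDigit ε ∧ nxt q ε ∈ R L := by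
    intro L q
    simp only [memR]
    constructor
    · rintro ⟨y, hy, hqy⟩
      have hε : IsDigit fun i => y i % 2 := fun i => Int.emod_two_eq_zero_or_one _
      refine ⟨fun i => y i % 2, hε, fun i => y i / 2, fun i => ?_, ?_⟩
      · have := hy i
        rw [pow_succ] at this
        change _ ≤ y i / 2 ∧ y i / 2 < _
        constructor <;> omega
      · rw [← hnxt _ _ hε]
        convert hqy using 1
        ext i
        simp [Int.mul_ediv_add_emod]
    · rintro ⟨ε, hε, y, hy, hqy⟩
      refine ⟨2 • y + ε, fun i => ?_, (hnxt q ε hε y).2 hqy⟩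
      have := hy i
      have h2 : (2 • y + ε) i = 2 * y i + ε i := by simp
      rw [pow_succ, h2]
      rcases hε i with h | h <;> constructor <;> omega
  have hmono : ∀ L, R L ⊆ R (L + 1) := by
    intro L q
    rw [memR, memR]
    rintro ⟨y, hy, h⟩
    refine ⟨y, fun i => ?_, h⟩
    have := hy i
    rw [pow_succ]
    have h1 : (0 : ℤ) < 2 ^ L := by positivity
    constructor <;> omega
  have hex : ∃ L, q₀ ∈ R L := by
    obtain ⟨L, hL⟩ : ∃ L : ℕ, ∀ i, |x i| < 2 ^ L := by
      refine ⟨∑ i, (x i).natAbs, fun i => ?_⟩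
      have h1 : (x i).natAbs ≤ ∑ i, (x i).natAbs :=
        Finset.single_le_sum (f := fun i => (x i).natAbs) (fun _ _ => Nat.zero_le _)
          (Finset.mem_univ i)
      have h2 := h1.trans_lt (Nat.lt_two_pow_self (n := ∑ i, (x i).natAbs))
      rw [Int.abs_eq_natAbs]
      exact_mod_cast h2
    refine ⟨L, (memR _ _).2 ⟨x, fun i => ?_, (hq x).2 hx⟩⟩
    have := abs_lt.1 (hL i)
    exact ⟨this.1.le, this.2⟩
  have hstable : ∀ L, R L = R (L + 1) → ∀ k, R (L + k) = R L := by
    intro L h k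
    induction k with
    | zero => rfl
    | succ k ih =>
      ext q
      rw [← add_assoc, hstep, ih, ← hstep, ← h]
  -- A repetition before `q₀` appears would freeze the sequence without `q₀`, so each earlier step
  -- adds a state.
  have hcard : ∀ L, L ≤ Nat.find hex → L ≤ (R L).card := by
    intro L
    induction L with
    | zero => simp
    | succ L ih =>
      intro hL
      have h1 := ih (by omega)
      have hne : R L ≠ R (L + 1) := by
        intro h
        obtain ⟨k, hk⟩ := Nat.exists_eq_add_of_le (show L ≤ Nat.find hex by omega)
        have := Nat.find_spec hex
        rw [hk, hstable L h k] at this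
        have := Nat.find_min' hex this
        omega
      have := Finset.card_lt_card (Finset.ssubset_iff_subset_ne.2 ⟨hmono L, hne⟩)
      omega
  have hle : Nat.find hex ≤ s :=
    (hcard _ le_rfl).trans ((Finset.card_le_univ _).trans hc)
  obtain ⟨y, hy, hqy⟩ := (memR _ _).1 (Nat.find_spec hex)
  refine ⟨y, (hq y).1 hqy, fun i => abs_le.2 ?_⟩
  have h2 : (2 : ℤ) ^ Nat.find hex ≤ 2 ^ s := pow_le_pow_right₀ (by norm_num) hle
  have := hy i
  constructor <;> linarith [this.1, this.2]

/-- The negation has a kernel of the same size, so a counterexample anywhere yields one in the box.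
-/
theorem forall_of_bounded {B : ℕ} (hf : HasKernel s f) (hs : 2 ^ s ≤ B)
    (h : ∀ y : Fin d → ℤ, (∀ i, |y i| ≤ (B : ℤ)) → f y) (x : Fin d → ℤ) : f x := by
  by_contra hx
  obtain ⟨y, hy, hb⟩ := hf.not.exists_bounded hx
  exact hy (h y fun i => (hb i).trans (by exact_mod_cast hs))

end HasKernel

end VirtAb

/-! ### Semilinear sets of path sums -/

section PathSum

variable {V E M : Type*} [AddCommMonoid M]

/-- `PathSum src tgt lab Q i j x`: the labels along some path of positive length from `i` to `j`,
with all intermediate vertices in `Q`, add up to `x`. -/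
inductive PathSum (src tgt : E → V) (lab : E → M) (Q : Set V) : V → V → M → Prop
  | edge (e : E) : PathSum src tgt lab Q (src e) (tgt e) (lab e)
  | snoc {i : V} {x : M} (e : E) (h : PathSum src tgt lab Q i (src e) x) (hQ : src e ∈ Q) :
      PathSum src tgt lab Q i (tgt e) (x + lab e)

namespace PathSum

variable {src tgt : E → V} {lab : E → M} {Q Q' : Set V} {i j k : V} {x y : M}

theorem mono (hQ : Q ⊆ Q') (h : PathSum src tgt lab Q i j x) : PathSum src tgt lab Q' i j x := by
  induction h with
  | edge e => exact .edge e
  | snoc e _ h' ih => exact .snoc e ih (hQ h')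

theorem trans (h : PathSum src tgt lab Q i j x) (hj : j ∈ Q) (h' : PathSum src tgt lab Q j k y) :
    PathSum src tgt lab Q i k (x + y) := by
  induction h' with
  | edge e => exact .snoc e h hj
  | snoc e _ hQ ih => rw [← add_assoc]; exact .snoc e (ih h hj) hQ

/-- Cut the path at its visits to q: an arrival at q, some returns to q, and a departure. Only the
sum of labels is recorded, so the returns contribute an element of the submonoid generated by the
loops at q. -/
theorem insert_iff {q : V} : PathSum src tgt lab (insert q Q) i j x ↔
    PathSum src tgt lab Q i j x ∨ ∃ a b c, PathSum src tgt lab Q i q a ∧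
      b ∈ AddSubmonoid.closure {y | PathSum src tgt lab Q q q y} ∧
      PathSum src tgt lab Q q j c ∧ x = a + b + c := by
  constructor
  · intro h
    induction h with
    | edge e => exact .inl (.edge e)
    | @snoc _ x e _ hQ ih =>
      rcases Set.mem_insert_iff.1 hQ with hq | hQ
      · rcases ih with h | ⟨a, b, c, ha, hb, hc, rfl⟩
        · exact .inr ⟨x, 0, lab e, hq ▸ h, zero_mem _, hq ▸ .edge e, by simp⟩
        · exact .inr ⟨a, b + c, lab e, ha,
            add_mem hb (AddSubmonoid.subset_closure (by rw [hq] at hc; exact hc)),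
            hq ▸ .edge e, by abel⟩
      · rcases ih with h | ⟨a, b, c, ha, hb, hc, rfl⟩
        · exact .inl (.snoc e h hQ)
        · exact .inr ⟨a, b, c + lab e, ha, hb, .snoc e hc hQ, by abel⟩
  · rintro (h | ⟨a, b, c, ha, hb, hc, rfl⟩)
    · exact h.mono (Set.subset_insert _ _)
    · have hq : q ∈ insert q Q := Set.mem_insert _ _
      have hab : PathSum src tgt lab (insert q Q) i q (a + b) := by
        induction hb using AddSubmonoid.closure_induction_right with
        | zero => rw [add_zero]; exact ha.mono (Set.subset_insert _ _)
        | add_right x _ y hy ih =>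
          rw [← add_assoc]
          exact ih.trans hq (mono (Set.subset_insert _ _) hy)
      exact hab.trans hq (hc.mono (Set.subset_insert _ _))

theorem isSemilinearSet [Finite V] [Finite E] (src tgt : E → V) (lab : E → M) (Q : Set V)
    (i j : V) : IsSemilinearSet {x | PathSum src tgt lab Q i j x} := by
  induction Q, Q.toFinite using Set.Finite.induction_on generalizing i j with
  | empty =>
    refine IsSemilinearSet.of_finite ((Set.finite_range lab).subset ?_)
    rintro x (_ | ⟨_, _, h⟩)
    · exact ⟨_, rfl⟩
    · exact h.elim
  | @insert q Q _ _ ih =>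
    open scoped Pointwise in
    have : {x | PathSum src tgt lab (insert q Q) i j x} = {x | PathSum src tgt lab Q i j x} ∪
        ({x | PathSum src tgt lab Q i q x} +
          (AddSubmonoid.closure {x | PathSum src tgt lab Q q q x} : Set M) +
          {x | PathSum src tgt lab Q q j x}) := by
      ext x
      simp only [Set.mem_union, Set.mem_add]
      refine insert_iff.trans (or_congr Iff.rfl ?_)
      constructor
      · rintro ⟨a, b, c, ha, hb, hc, rfl⟩
        exact ⟨a + b, ⟨a, ha, b, hb, rfl⟩, c, hc, rfl⟩
      · rintro ⟨_, ⟨a, ha, b, hb, rfl⟩, c, hc, rfl⟩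
        exact ⟨a, b, c, ha, hb, hc, rfl⟩
    rw [this]
    exact (ih i j).union (((ih i q).add (ih q q).closure).add (ih q j))

end PathSum

end PathSum

/-! ### The weighted length as the solution of a recursion -/

section WeightedLength

variable {G ι : Type*} [Group G] {σ : ι → G} {w : ι → ℕ}

theorem weightedLength_le_iff (hσ : Submonoid.closure (Set.range σ) = ⊤) (g : G) (N : ℕ) :
    weightedLength σ w g ≤ N ↔ ∃ u : List ι, (u.map σ).prod = g ∧ (u.map w).sum ≤ N := by
  have hne : {n | ∃ u : List ι, (u.map σ).prod = g ∧ (u.map w).sum = n}.Nonempty := by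
    have hg : g ∈ Submonoid.closure (Set.range σ) := hσ ▸ Submonoid.mem_top g
    obtain ⟨l, hl, rfl⟩ := Submonoid.exists_list_of_mem_closure hg
    obtain ⟨u, rfl⟩ : l ∈ Set.range (List.map σ) := by
      rw [Set.range_list_map]
      exact hl
    exact ⟨_, u, rfl, rfl⟩
  constructor
  · intro h
    obtain ⟨u, hu, hn⟩ := Nat.sInf_mem hne
    exact ⟨u, hu, hn.trans_le h⟩
  · rintro ⟨u, hu, hn⟩
    exact le_trans (Nat.sInf_le ⟨u, hu, rfl⟩) hn

/-- Positive weights bound the number of letters by the weight, and there are finitely many words of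
bounded length. -/
theorem finite_weightedLength_le [Finite ι] (hσ : Submonoid.closure (Set.range σ) = ⊤)
    (hw : ∀ i, 0 < w i) (N : ℕ) : {g | weightedLength σ w g ≤ N}.Finite := by
  refine ((List.finite_length_le ι N).image fun u => (u.map σ).prod).subset fun g hg => ?_
  obtain ⟨u, hu, hn⟩ := (weightedLength_le_iff hσ g N).1 hg
  refine ⟨u, ?_, hu⟩
  refine le_trans ?_ hn
  clear hu hn
  induction u with
  | nil => simp
  | cons i u ih =>
    have := hw i
    simp only [List.length_cons, List.map_cons, List.sum_cons] at ih ⊢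
    omega

theorem weightedLength_eq_of_equiv {κ : Type*} (e : κ ≃ ι) (g : G) :
    weightedLength (σ ∘ e) (w ∘ e) g = weightedLength σ w g := by
  unfold weightedLength
  congr 1
  ext n
  constructor
  · rintro ⟨u, h⟩
    exact ⟨u.map e, by simpa using h⟩
  · rintro ⟨u, h⟩
    exact ⟨u.map e.symm, by simpa [Function.comp_def] using h⟩

/-- The relation `|g| ≤ N` is the only one that satisfies a recursion over the last letter. -/
theorem iff_weightedLength_le (hσ : Submonoid.closure (Set.range σ) = ⊤) (hw : ∀ i, 0 < w i)
    {R : G → ℤ → Prop} (hpos : ∀ g N, R g N → 0 ≤ N)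
    (hR : ∀ g N, R g N ↔ (0 ≤ N ∧ g = 1) ∨ ∃ i, R (g * (σ i)⁻¹) (N - w i)) (g : G) (N : ℤ) :
    R g N ↔ 0 ≤ N ∧ (weightedLength σ w g : ℤ) ≤ N := by
  constructor
  · intro h
    obtain ⟨n, rfl⟩ := Int.eq_ofNat_of_zero_le (hpos g N h)
    refine ⟨by simp, ?_⟩
    rw [Nat.cast_le, weightedLength_le_iff hσ]
    -- Unfolding the recursion stops because each letter lowers N by a positive weight, while `hpos`
    -- forbids negative N.
    induction n using Nat.strong_induction_on generalizing g with
    | _ n ih =>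
      rcases (hR _ _).1 h with ⟨_, rfl⟩ | ⟨i, hi⟩
      · exact ⟨[], by simp⟩
      · have h0 := hpos _ _ hi
        have hwi := hw i
        obtain ⟨u, hu, hn⟩ := ih (n - w i) (by omega) (g * (σ i)⁻¹) (by
          rwa [Nat.cast_sub (by omega)])
        refine ⟨u ++ [i], by simp [hu], ?_⟩
        simp only [List.map_append, List.map_cons, List.map_nil, List.sum_append,
          List.sum_cons, List.sum_nil]
        omega
  · rintro ⟨h0, h⟩
    obtain ⟨n, rfl⟩ := Int.eq_ofNat_of_zero_le h0
    rw [Nat.cast_le, weightedLength_le_iff hσ] at h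
    obtain ⟨u, rfl, hn⟩ := h
    clear h0
    induction u using List.reverseRecOn generalizing n with
    | nil => exact (hR _ _).2 (.inl ⟨by simp, by simp⟩)
    | append_singleton u i ih =>
      simp only [List.map_append, List.map_cons, List.map_nil, List.sum_append,
        List.sum_cons, List.sum_nil] at hn
      refine (hR _ _).2 (.inr ⟨i, ?_⟩)
      have := ih (n - w i) (by omega)
      rw [Nat.cast_sub (by omega)] at this
      simpa using this

end WeightedLength

/-! ### Linear sets with generators of positive weight -/

namespace VirtAb

theorem inLinear_iff {d r : ℕ} (p : Fin d → ℤ) (u : Fin r → Fin d → ℤ) (x : Fin d → ℤ) :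
    InLinear p u x ↔ ∃ y ∈ AddSubmonoid.closure (Set.range u), x = p + y := by
  have h : ∀ y, y ∈ AddSubmonoid.closure (Set.range u) ↔
      ∃ c : Fin r → ℕ, y = ∑ i, c i • u i := by
    intro y
    constructor
    · intro hy
      induction hy using AddSubmonoid.closure_induction with
      | mem u hu =>
        obtain ⟨i, rfl⟩ := hu
        exact ⟨Pi.single i 1, by simp [Pi.single_apply, ite_smul]⟩
      | zero => exact ⟨0, by simp⟩
      | add _ _ _ _ hx hy =>
        obtain ⟨c, rfl⟩ := hx
        obtain ⟨c', rfl⟩ := hy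
        exact ⟨c + c', by simp [add_smul, Finset.sum_add_distrib]⟩
    · rintro ⟨c, rfl⟩
      exact sum_mem fun i _ =>
        nsmul_mem (AddSubmonoid.subset_closure (Set.mem_range_self i)) _
  simp only [h, InLinear]
  constructor
  · rintro ⟨c, rfl⟩
    exact ⟨_, ⟨c, rfl⟩, rfl⟩
  · rintro ⟨_, ⟨c, rfl⟩, rfl⟩
    exact ⟨c, rfl⟩

open scoped Pointwise in
/-- A semilinear set whose elements have nonnegative weights (coordinate `0`), with finitely many
elements below each weight, is a finite union of linear sets whose generators have positive
weights. -/
theorem exists_list_of_isSemilinearSet {d : ℕ} {s : Set (Fin (d + 1) → ℤ)}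
    (hs : IsSemilinearSet s) (h0 : ∀ x ∈ s, 0 ≤ x 0)
    (hfin : ∀ N : ℕ, {x ∈ s | x 0 ≤ N}.Finite) :
    ∃ L : List ((Fin (d + 1) → ℤ) × List (Fin (d + 1) → ℤ)),
      (∀ e ∈ L, 0 ≤ e.1 0 ∧ ∀ u ∈ e.2, 1 ≤ u 0) ∧
      ∀ x, x ∈ s ↔ ∃ e ∈ L, InLinear e.1 e.2.get x := by
  obtain ⟨S, hlin, rfl⟩ := isSemilinearSet_iff.1 hs
  have key : ∀ t ∈ S, ∃ e : (Fin (d + 1) → ℤ) × List (Fin (d + 1) → ℤ),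
      (0 ≤ e.1 0 ∧ ∀ u ∈ e.2, 1 ≤ u 0) ∧ ∀ x, x ∈ t ↔ InLinear e.1 e.2.get x := by
    intro t ht
    obtain ⟨a, T, rfl⟩ := isLinearSet_iff.1 (hlin t ht)
    have hmem : ∀ x, x ∈ a +ᵥ (AddSubmonoid.closure (T : Set (Fin (d + 1) → ℤ)) :
        Set (Fin (d + 1) → ℤ)) ↔
        ∃ y ∈ AddSubmonoid.closure (T : Set (Fin (d + 1) → ℤ)), x = a + y := by
      intro x
      simp only [Set.mem_vadd_set, vadd_eq_add, SetLike.mem_coe, eq_comm]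
    have hsub : ∀ y ∈ AddSubmonoid.closure (T : Set (Fin (d + 1) → ℤ)), a + y ∈ ⋃₀ (S : Set (Set _)) :=
      fun y hy => ⟨_, ht, (hmem _).2 ⟨y, hy, rfl⟩⟩
    have ha : 0 ≤ a 0 := by simpa using h0 _ (hsub 0 (zero_mem _))
    have hmul : ∀ u ∈ T, ∀ c : ℕ, a + c • u ∈ ⋃₀ (S : Set (Set _)) := fun u hu c =>
      hsub _ (nsmul_mem (AddSubmonoid.subset_closure hu) c)
    -- A nonzero generator of weight at most 0 could be added to a arbitrarily often without
    -- exceeding the weight of a, contrary to `hfin`.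
    have hpos : ∀ u ∈ T, u ≠ 0 → 1 ≤ u 0 := by
      intro u hu hne
      by_contra hlt
      refine (Set.infinite_of_injective_forall_mem (f := fun c : ℕ => a + c • u)
        (s := {x ∈ ⋃₀ (S : Set (Set _)) | x 0 ≤ (((a 0).toNat : ℕ) : ℤ)}) ?_ ?_) (hfin _)
      · intro c c' h
        have := add_left_cancel h
        obtain ⟨i, hi⟩ := Function.ne_iff.1 hne
        have := congrFun this i
        simp only [Pi.smul_apply, nsmul_eq_mul] at this
        exact_mod_cast mul_right_cancel₀ hi this
      · intro c
        refine ⟨hmul u hu c, ?_⟩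
        simp only [Pi.add_apply, Pi.smul_apply, Int.toNat_of_nonneg ha]
        rw [nsmul_eq_mul]
        nlinarith [Int.natCast_nonneg c]
    classical
    -- Only the zero vector can be a generator without positive weight, and dropping it does not
    -- change the submonoid.
    refine ⟨(a, (T.erase 0).toList), ⟨ha, ?_⟩, fun x => ?_⟩
    · intro u hu
      rw [Finset.mem_toList, Finset.mem_erase] at hu
      exact hpos u hu.2 hu.1
    · rw [hmem, inLinear_iff, Set.range_list_get]
      have : {u | u ∈ (T.erase 0).toList} = (T : Set (Fin (d + 1) → ℤ)) \ {0} := by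
        ext u
        simp [and_comm]
      rw [this, AddSubmonoid.closure_sdiff_singleton_zero]
  choose! f hf hf' using key
  refine ⟨S.toList.map f, ?_, fun x => ?_⟩
  · intro e he
    obtain ⟨t, ht, rfl⟩ := List.mem_map.1 he
    exact hf t (Finset.mem_toList.1 ht)
  · simp only [Set.mem_sUnion, Finset.mem_coe, List.mem_map, Finset.mem_toList]
    constructor
    · rintro ⟨t, ht, hx⟩
      exact ⟨_, ⟨t, ht, rfl⟩, (hf' t ht x).1 hx⟩
    · rintro ⟨_, ⟨t, ht, rfl⟩, hx⟩
      exact ⟨t, ht, (hf' t ht x).2 hx⟩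

end VirtAb

/-! ### Products and iterations of regular languages -/

namespace Language

variable {α : Type*} {L M : Language α}

/-- The union of a set of languages. -/
def unionOf (T : Set (Language α)) : Language α := {y | ∃ N ∈ T, y ∈ N}

theorem mem_unionOf {T : Set (Language α)} {y : List α} : y ∈ unionOf T ↔ ∃ N ∈ T, y ∈ N := Iff.rfl

/-- Myhill–Nerode: every left quotient consists of suffixes of the finitely many words, so there are
only finitely many quotients. -/
theorem IsRegular.of_finite (h : Set.Finite (L : Set (List α))) : L.IsRegular := by
  rw [isRegular_iff_finite_range_leftQuotient]
  have hfin : (⋃ w ∈ (L : Set (List α)), {y | y <:+ w}).Finite :=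
    h.biUnion fun w _ => by
      simpa only [List.mem_tails] using w.tails.finite_toSet
  refine hfin.finite_subsets.subset ?_
  rintro _ ⟨x, rfl⟩ y hy
  exact Set.mem_biUnion (x := x ++ y) hy (List.suffix_append _ _)

/-- Myhill–Nerode again: the quotient of LM by x is (x⁻¹L)M together with the quotients v⁻¹M over
all splittings x = uv with u in L. It is determined by one quotient of L and a set of quotients of
M. -/
theorem IsRegular.mul (hL : L.IsRegular) (hM : M.IsRegular) : (L * M).IsRegular := by
  rw [isRegular_iff_finite_range_leftQuotient] at *
  refine ((hL.prod hM.finite_subsets).image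
    fun p => p.1 * M + unionOf p.2).subset ?_
  rintro _ ⟨x, rfl⟩
  refine ⟨(L.leftQuotient x, {N | ∃ u v, x = u ++ v ∧ u ∈ L ∧ N = M.leftQuotient v}),
    ⟨⟨x, rfl⟩, ?_⟩, ?_⟩
  · rintro _ ⟨u, v, _, _, rfl⟩
    exact ⟨v, rfl⟩
  · ext y
    change y ∈ L.leftQuotient x * M + unionOf _ ↔ x ++ y ∈ L * M
    rw [mem_add, mem_mul, mem_mul, mem_unionOf]
    constructor
    · rintro (⟨a, ha, b, hb, rfl⟩ | ⟨_, ⟨u, v, rfl, hu, rfl⟩, hy⟩)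
      · exact ⟨x ++ a, ha, b, hb, by simp⟩
      · exact ⟨u, hu, v ++ y, hy, by simp⟩
    · rintro ⟨a, ha, b, hb, h⟩
      rcases List.append_eq_append_iff.1 h with ⟨c, rfl, rfl⟩ | ⟨c, rfl, rfl⟩
      · exact .inr ⟨_, ⟨a, c, rfl, ha, rfl⟩, hb⟩
      · exact .inl ⟨c, ha, b, hb, rfl⟩

/-- Look at the factor in which x ends: v is the part of this factor inside x, and u is the product
of the factors before it. -/
theorem append_mem_kstar_iff {x y : List α} : x ++ y ∈ KStar.kstar L ↔
    (x = [] ∧ y ∈ KStar.kstar L) ∨ ∃ u v, x = u ++ v ∧ u ∈ KStar.kstar L ∧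
      y ∈ L.leftQuotient v * KStar.kstar L := by
  constructor
  · rw [mem_kstar]
    rintro ⟨S, hS, hL⟩
    induction S generalizing x with
    | nil =>
      simp only [List.flatten_nil, List.append_eq_nil_iff] at hS
      exact .inl ⟨hS.1, hS.2 ▸ nil_mem_kstar L⟩
    | cons w S ih =>
      rw [List.flatten_cons] at hS
      have hS' : S.flatten ∈ KStar.kstar L :=
        mem_kstar.2 ⟨S, rfl, fun y hy => hL y (by simp [hy])⟩
      rcases List.append_eq_append_iff.1 hS with ⟨c, rfl, rfl⟩ | ⟨c, rfl, hc⟩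
      · exact .inr ⟨[], x, rfl, nil_mem_kstar L,
          mem_mul.2 ⟨c, hL _ (by simp), S.flatten, hS', rfl⟩⟩
      · have hw : w ∈ L := hL w (by simp)
        rcases ih hc.symm (fun y hy => hL y (by simp [hy])) with ⟨rfl, hy⟩ | ⟨u, v, rfl, hu, hy⟩
        · exact .inr ⟨[], w, by simp, nil_mem_kstar L,
            mem_mul.2 ⟨[], by simpa using hw, y, hy, rfl⟩⟩
        · refine .inr ⟨w ++ u, v, by simp, ?_, hy⟩
          rw [← one_add_self_mul_kstar_eq_kstar, mem_add]
          exact .inr (mem_mul.2 ⟨w, hw, u, hu, rfl⟩)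
  · rintro (⟨rfl, hy⟩ | ⟨u, v, rfl, hu, hy⟩)
    · exact hy
    · obtain ⟨a, ha, b, hb, rfl⟩ := mem_mul.1 hy
      obtain ⟨S, rfl, hS⟩ := mem_kstar.1 hu
      obtain ⟨T, rfl, hT⟩ := mem_kstar.1 hb
      refine mem_kstar.2 ⟨S ++ (v ++ a) :: T, by simp, fun y hy => ?_⟩
      simp only [List.mem_append, List.mem_cons] at hy
      rcases hy with hy | rfl | hy
      exacts [hS y hy, ha, hT y hy]

theorem IsRegular.kstar (hL : L.IsRegular) : (KStar.kstar L).IsRegular := by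
  rw [isRegular_iff_finite_range_leftQuotient] at *
  refine ((hL.finite_subsets.image fun T =>
    unionOf T * KStar.kstar L).insert (KStar.kstar L)).subset ?_
  rintro _ ⟨x, rfl⟩
  -- The empty word needs its own case: its quotient is L^*, whereas the general form would only
  -- give L L^*.
  by_cases hx : x = []
  · exact .inl (by rw [hx, leftQuotient_nil])
  · refine .inr ⟨{N | ∃ u v, x = u ++ v ∧ u ∈ KStar.kstar L ∧ N = L.leftQuotient v}, ?_, ?_⟩
    · rintro _ ⟨u, v, _, _, rfl⟩
      exact ⟨v, rfl⟩
    · ext y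
      change y ∈ unionOf _ * KStar.kstar L ↔ x ++ y ∈ KStar.kstar L
      rw [append_mem_kstar_iff, mem_mul]
      constructor
      · rintro ⟨a, ⟨_, ⟨u, v, h, hu, rfl⟩, ha⟩, hy⟩
        exact .inr ⟨u, v, h, hu, mem_mul.2 ⟨a, ha, hy⟩⟩
      · rintro (⟨h, _⟩ | ⟨u, v, h, hu, hy⟩)
        · exact (hx h).elim
        · obtain ⟨a, ha, hy⟩ := mem_mul.1 hy
          exact ⟨a, ⟨_, ⟨u, v, h, hu, rfl⟩, ha⟩, hy⟩

end Language

/-! ### Finite unions of linear sets are rational -/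

section Rational

variable {M κ : Type*} [Monoid M] {X : κ → M}

theorem IsRationalSubset.union {L L' : Set M} (h : IsRationalSubset X L)
    (h' : IsRationalSubset X L') : IsRationalSubset X (L ∪ L') := by
  obtain ⟨R, hR, rfl⟩ := h
  obtain ⟨R', hR', rfl⟩ := h'
  refine ⟨R + R', hR.add hR', ?_⟩
  ext x
  constructor
  · rintro (⟨u, hu, rfl⟩ | ⟨u, hu, rfl⟩)
    · exact ⟨u, .inl hu, rfl⟩
    · exact ⟨u, .inr hu, rfl⟩
  · rintro ⟨u, hu | hu, rfl⟩
    · exact .inl ⟨u, hu, rfl⟩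
    · exact .inr ⟨u, hu, rfl⟩

/-- Choose one word over X for a and one for each element of B. The chosen word for a, followed by
the star of the words for B, is a regular language with the required image. -/
theorem isRationalSubset_mul_closure (hX : Submonoid.closure (Set.range X) = ⊤) (a : M)
    {B : Set M} (hB : B.Finite) :
    IsRationalSubset X {g | ∃ h ∈ Submonoid.closure B, g = a * h} := by
  have hword : ∀ x : M, ∃ u : List κ, (u.map X).prod = x := by
    intro x
    have hx : x ∈ Submonoid.closure (Set.range X) := hX ▸ Submonoid.mem_top x
    obtain ⟨l, hl, rfl⟩ := Submonoid.exists_list_of_mem_closure hx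
    obtain ⟨u, rfl⟩ : l ∈ Set.range (List.map X) := by
      rw [Set.range_list_map]
      exact hl
    exact ⟨u, rfl⟩
  choose f hf using hword
  refine ⟨(show Language κ from ({f a} : Set (List κ))) * KStar.kstar (show Language κ from f '' B),
    (Language.IsRegular.of_finite (Set.finite_singleton _)).mul
      (Language.IsRegular.of_finite (hB.image f)).kstar, ?_⟩
  ext x
  constructor
  · rintro ⟨h, hh, rfl⟩
    obtain ⟨l, hl, rfl⟩ := Submonoid.exists_list_of_mem_closure hh
    refine ⟨f a ++ (l.map f).flatten, Language.mem_mul.2 ⟨f a, rfl, (l.map f).flatten,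
      Language.mem_kstar.2 ⟨l.map f, rfl, ?_⟩, rfl⟩, ?_⟩
    · intro y hy
      obtain ⟨b, hb, rfl⟩ := List.mem_map.1 hy
      exact ⟨b, hl b hb, rfl⟩
    · simp [List.map_flatten, List.prod_flatten, hf, Function.comp_def]
  · rintro ⟨u, hu, rfl⟩
    obtain ⟨_, rfl, v, hv, rfl⟩ := Language.mem_mul.1 hu
    obtain ⟨S, rfl, hS⟩ := Language.mem_kstar.1 hv
    refine ⟨(S.map fun v => (v.map X).prod).prod, ?_, ?_⟩
    · refine Submonoid.list_prod_mem _ fun y hy => ?_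
      obtain ⟨v, hv, rfl⟩ := List.mem_map.1 hy
      obtain ⟨b, hb, rfl⟩ := hS v hv
      rw [hf]
      exact Submonoid.subset_closure hb
    · simp [List.map_flatten, List.prod_flatten, hf, Function.comp_def]

theorem isRationalSubset_exists_mem {α : Type*} (hX : Submonoid.closure (Set.range X) = ⊤)
    (l : List α) (a : α → M) (B : α → Set M) (hB : ∀ p ∈ l, (B p).Finite) :
    IsRationalSubset X {g | ∃ p ∈ l, ∃ h ∈ Submonoid.closure (B p), g = a p * h} := by
  induction l with
  | nil =>
    refine ⟨0, Language.IsRegular.of_finite Set.finite_empty, ?_⟩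
    ext x
    simp only [List.not_mem_nil, false_and, exists_false, Language.notMem_zero]
  | cons p l ih =>
    have h := (isRationalSubset_mul_closure hX (a p) (hB p (by simp))).union
      (ih fun q hq => hB q (by simp [hq]))
    convert h using 1
    ext x
    simp

end Rational

/-! ### Computing in a described group -/

namespace VirtAb

/-- The vector with the first `d` entries of a list, padded with zeros. -/
def vec (d : ℕ) (l : List ℤ) : Fin d → ℤ := fun i => l.getD i 0

theorem vec_cons {d : ℕ} (a : ℤ) (l : List ℤ) : vec (d + 1) (a :: l) = Fin.cons a (vec d l) := by
  ext i
  refine Fin.cases ?_ (fun i => ?_) i <;> simp [vec]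

theorem vec_ofFn {d : ℕ} (x : Fin d → ℤ) : vec d (List.ofFn x) = x := by
  ext i
  simp [vec]

theorem vec_nil {d : ℕ} : vec d [] = 0 := by
  ext i
  simp [vec]

/-- The sum of the vectors with the first `d` entries of two lists. -/
def addVec (d : ℕ) (u v : List ℤ) : List ℤ :=
  (List.range d).map fun i => u.getD i 0 + v.getD i 0

theorem vec_addVec {d : ℕ} (u v : List ℤ) : vec d (addVec d u v) = vec d u + vec d v := by
  ext i
  simp [vec, addVec]

/-- The letters of the word `b₁^{e₁} ⋯ b_n^{e_n}`. -/
def basisWord (n : ℕ) (e : List ℤ) : List Letter :=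
  (List.range n).flatMap fun l =>
    List.replicate (e.getD l 0).natAbs (Sum.inl l, decide (0 ≤ e.getD l 0))

/-- The word `b₁^{e₁} ⋯ b_n^{e_n} t_j`. -/
def normalFormWord (n : ℕ) (u : NormalForm) : List Letter :=
  basisWord n u.1 ++ [(Sum.inr u.2, true)]

/-- The first entry of the collecting function for the product of two letters. -/
def Description.product (D : Description) (x y : Letter) : Option NormalForm :=
  @List.lookup (Letter × Letter) NormalForm instBEqOfDecidableEq (x, y) D.collect

/-- The product of a normal form with a letter, read off from the collecting function. -/
def mulLetter (D : Description) (u : NormalForm) (y : Letter) : NormalForm :=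
  ((D.product (Sum.inr u.2, true) y).map
    fun v => (addVec D.rank u.1 v.1, v.2)).getD u

/-- The normal form of the product of `t_j` with a normal form. -/
def transition (D : Description) (j : ℕ) (u : NormalForm) : NormalForm :=
  (normalFormWord D.rank u).foldl (mulLetter D) ([], j)

/-- The normal form of the identity. -/
def identityForm (D : Description) : NormalForm :=
  (D.product (Sum.inr 0, true) (Sum.inr 0, false)).getD ([], 0)

/-! ### Products of powers of commuting elements -/

section BasisProd

variable {G : Type*} [Group G]

theorem commute_basisProd {n : ℕ} {b : Fin n → G} {x : G} (h : ∀ i, Commute x (b i))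
    (e : Fin n → ℤ) : Commute x (basisProd b e) := by
  refine Commute.list_prod_right _ _ fun y hy => ?_
  obtain ⟨i, rfl⟩ := (List.mem_ofFn' _ _).1 hy
  exact (h i).zpow_right _

theorem basisProd_succ {n : ℕ} (b : Fin (n + 1) → G) (e : Fin (n + 1) → ℤ) :
    basisProd b e = b 0 ^ e 0 * basisProd (fun i => b i.succ) (fun i => e i.succ) := by
  simp [basisProd, List.ofFn_succ]

theorem basisProd_add {n : ℕ} {b : Fin n → G} (h : ∀ i j, b i * b j = b j * b i)
    (e e' : Fin n → ℤ) : basisProd b (e + e') = basisProd b e * basisProd b e' := by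
  induction n with
  | zero => simp [basisProd]
  | succ n ih =>
    have := ih (fun i j => h i.succ j.succ) (fun i => e i.succ) (fun i => e' i.succ)
    rw [basisProd_succ, basisProd_succ, basisProd_succ,
      show (fun i : Fin n => (e + e') i.succ) = (fun i => e i.succ) + (fun i => e' i.succ) from rfl,
      this, Pi.add_apply, zpow_add]
    have hc : Commute (b 0 ^ e' 0) (basisProd (fun i => b i.succ) (fun i => e i.succ)) :=
      commute_basisProd (fun i => Commute.zpow_left (h 0 i.succ) _) _
    simp only [mul_assoc]
    rw [← mul_assoc (b 0 ^ e' 0), hc.eq]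
    simp only [mul_assoc]

theorem basisProd_zero {n : ℕ} (b : Fin n → G) : basisProd b 0 = 1 := by
  simp [basisProd]

theorem basisProd_neg {n : ℕ} {b : Fin n → G} (h : ∀ i j, b i * b j = b j * b i)
    (e : Fin n → ℤ) : basisProd b (-e) = (basisProd b e)⁻¹ := by
  rw [eq_inv_iff_mul_eq_one, ← basisProd_add h, neg_add_cancel, basisProd_zero]

theorem basisProd_single {n : ℕ} {b : Fin n → G} (i : Fin n) :
    basisProd b (Pi.single i 1) = b i := by
  induction n with
  | zero => exact i.elim0
  | succ n ih =>
    rw [basisProd_succ]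
    refine Fin.cases ?_ (fun i => ?_) i
    · have : (fun i : Fin n => (Pi.single 0 1 : Fin (n + 1) → ℤ) i.succ) = 0 := by
        ext i
        simp
      rw [this, basisProd_zero]
      simp
    · have : (fun j : Fin n => (Pi.single i.succ 1 : Fin (n + 1) → ℤ) j.succ) = Pi.single i 1 := by
        ext j
        simp [Pi.single_apply, Fin.succ_inj]
      rw [this, ih (b := fun i => b i.succ)]
      simp

theorem mem_closure_range_iff {n : ℕ} {b : Fin n → G} (h : ∀ i j, b i * b j = b j * b i) (g : G) :
    g ∈ Subgroup.closure (Set.range b) ↔ ∃ e, basisProd b e = g := by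
  constructor
  · intro hg
    induction hg using Subgroup.closure_induction with
    | mem x hx =>
      obtain ⟨i, rfl⟩ := hx
      exact ⟨_, basisProd_single i⟩
    | one => exact ⟨0, basisProd_zero b⟩
    | mul x y _ _ hx hy =>
      obtain ⟨e, rfl⟩ := hx
      obtain ⟨e', rfl⟩ := hy
      exact ⟨e + e', basisProd_add h e e'⟩
    | inv x _ hx =>
      obtain ⟨e, rfl⟩ := hx
      exact ⟨-e, basisProd_neg h e⟩
  · rintro ⟨e, rfl⟩
    refine Subgroup.list_prod_mem _ fun y (hy : y ∈ List.ofFn _) => ?_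
    obtain ⟨i, rfl⟩ := (List.mem_ofFn' _ _).1 hy
    exact zpow_mem (Subgroup.subset_closure (Set.mem_range_self i)) _

theorem entry_val {n : ℕ} (b : Fin n → G) (i : Fin n) : entry b i = b i := by
  simp [entry]

theorem prod_basisWord {n m : ℕ} (b : Fin n → G) (t : Fin m → G) (e : List ℤ) :
    ((basisWord n e).map (letterValue b t)).prod = basisProd b (vec n e) := by
  have h : ∀ l, ((List.replicate (e.getD l 0).natAbs
      ((Sum.inl l, decide (0 ≤ e.getD l 0)) : Letter)).map (letterValue b t)).prod =
      entry b l ^ e.getD l 0 := by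
    intro l
    rw [List.map_replicate, List.prod_replicate]
    rcases le_or_gt 0 (e.getD l 0) with h | h
    · simp only [letterValue, h, decide_true, if_true, Sum.elim_inl]
      rw [← zpow_natCast, Int.natAbs_of_nonneg h]
    · have h' : ¬ 0 ≤ e.getD l 0 := by omega
      simp only [letterValue, h', decide_false, Bool.false_eq_true, if_false, Sum.elim_inl]
      rw [← zpow_natCast, Int.ofNat_natAbs_of_nonpos h.le, inv_zpow', neg_neg]
  rw [basisWord, List.map_flatMap, List.flatMap_def, List.prod_flatten, List.map_map,
    Function.comp_def, List.map_congr_left (g := fun l => entry b l ^ e.getD l 0) fun l _ => h l, basisProd]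
  congr 1
  refine List.ext_getElem (by simp) fun i h₁ h₂ => ?_
  simp only [List.length_ofFn] at h₂
  simp [vec, entry, h₂]

theorem prod_normalFormWord {n m : ℕ} (b : Fin n → G) (t : Fin m → G) (u : NormalForm) :
    ((normalFormWord n u).map (letterValue b t)).prod = normalFormValue b t u := by
  rw [normalFormWord, List.map_append, List.prod_append, prod_basisWord]
  simp only [List.map_cons, List.map_nil, List.prod_singleton, letterValue, if_true,
    Sum.elim_inr]
  rfl

end BasisProd

theorem inRange_basisWord {n m : ℕ} (e : List ℤ) : ∀ x ∈ basisWord n e, Letter.InRange n m x := by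
  intro x hx
  simp only [basisWord, List.mem_flatMap, List.mem_range, List.mem_replicate] at hx
  obtain ⟨l, hl, _, rfl⟩ := hx
  exact hl

theorem inRange_normalFormWord {n m : ℕ} (u : NormalForm) (hu : u.2 < m) :
    ∀ x ∈ normalFormWord n u, Letter.InRange n m x := by
  intro x hx
  rcases List.mem_append.1 hx with hx | hx
  · exact inRange_basisWord _ x hx
  · rw [List.mem_singleton.1 hx]
    exact hu

namespace Description.Describes

variable {D : Description} {G : Type*} [Group G] {b : Fin D.rank → G} {t : Fin D.index → G}

theorem normalForm_injective (h : D.Describes b t) {a a' : Fin D.rank → ℤ} {j j' : Fin D.index}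
    (heq : basisProd b a * t j = basisProd b a' * t j') : a = a' ∧ j = j' := by
  let x (a : Fin D.rank → ℤ) : (Subgroup.closure (Set.range b) : Set G) :=
    ⟨basisProd b a, (mem_closure_range_iff h.commute _).2 ⟨a, rfl⟩⟩
  let y (j : Fin D.index) : Set.range t := ⟨t j, j, rfl⟩
  have h1 : (x a, y j) = (x a', y j') := h.transversal.1 heq
  have h2 : basisProd b a = basisProd b a' := congrArg (fun p => (p.1 : G)) h1
  have h3 : t j = t j' := congrArg (fun p => (p.2 : G)) h1
  refine ⟨?_, h.injective h3⟩
  rw [← sub_eq_zero]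
  apply h.independent
  rw [sub_eq_add_neg, basisProd_add h.commute, basisProd_neg h.commute, h2, mul_inv_cancel]

theorem exists_normalForm (h : D.Describes b t) (g : G) :
    ∃ (a : Fin D.rank → ℤ) (j : Fin D.index), g = basisProd b a * t j := by
  obtain ⟨⟨⟨x, hx⟩, ⟨y, j, rfl⟩⟩, hg⟩ := h.transversal.2 g
  obtain ⟨a, rfl⟩ := (mem_closure_range_iff h.commute _).1 hx
  exact ⟨a, j, hg.symm⟩

theorem exists_product (h : D.Describes b t) {x y : Letter} (hx : x.InRange D.rank D.index)
    (hy : y.InRange D.rank D.index) : ∃ u, D.product x y = some u ∧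
      u.2 < D.index ∧ normalFormValue b t u = letterValue b t x * letterValue b t y := by
  obtain ⟨u, hu⟩ := h.collect_total x y hx hy
  let _ : BEq (Letter × Letter) := instBEqOfDecidableEq
  obtain ⟨v, hv⟩ := Option.isSome_iff_exists.1
    (List.lookup_isSome_iff.2 ⟨_, hu, beq_self_eq_true (x, y)⟩)
  have hmem : ((x, y), v) ∈ D.collect := by
    obtain ⟨l₁, l₂, h, _⟩ := List.lookup_eq_some_iff.1 hv
    rw [h]
    simp
  have := h.collect_sound _ _ _ hmem
  exact ⟨v, hv, this.2.2.1.2, this.2.2.2⟩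

/-- If t_i y = b^v t_j, then b^a t_i y = b^{a+v} t_j, so only products that start with a transversal
letter are looked up. For letters in range the lookup succeeds, and the default value in `mulLetter`
plays no role. -/
theorem mulLetter_spec (h : D.Describes b t) {u : NormalForm} {y : Letter} (hu : u.2 < D.index)
    (hy : y.InRange D.rank D.index) : (mulLetter D u y).2 < D.index ∧
      normalFormValue b t (mulLetter D u y) = normalFormValue b t u * letterValue b t y := by
  obtain ⟨v, hv, hv2, hval⟩ := h.exists_product (x := (Sum.inr u.2, true)) hu hy
  have h1 : mulLetter D u y = (addVec D.rank u.1 v.1, v.2) := by simp [mulLetter, hv]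
  rw [h1]
  refine ⟨hv2, ?_⟩
  have h2 : letterValue b t (Sum.inr u.2, true) = entry t u.2 := by simp [letterValue]
  rw [h2] at hval
  have h3 : ∀ w : NormalForm, normalFormValue b t w = basisProd b (vec _ w.1) * entry t w.2 :=
    fun _ => rfl
  rw [h3, vec_addVec, basisProd_add h.commute, h3 u, mul_assoc, mul_assoc, ← hval, h3]

theorem transition_spec (h : D.Describes b t) {j : ℕ} {u : NormalForm} (hj : j < D.index)
    (hu : u.2 < D.index) : (transition D j u).2 < D.index ∧
      normalFormValue b t (transition D j u) = entry t j * normalFormValue b t u := by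
  have key : ∀ (l : List Letter) (v : NormalForm), v.2 < D.index →
      (∀ x ∈ l, Letter.InRange D.rank D.index x) → (l.foldl (mulLetter D) v).2 < D.index ∧
      normalFormValue b t (l.foldl (mulLetter D) v) =
        normalFormValue b t v * (l.map (letterValue b t)).prod := by
    intro l
    induction l with
    | nil => intro v hv _; simpa using hv
    | cons x l ih =>
      intro v hv hl
      obtain ⟨h1, h2⟩ := h.mulLetter_spec hv (hl x (by simp))
      obtain ⟨h3, h4⟩ := ih _ h1 fun y hy => hl y (by simp [hy])
      exact ⟨h3, by rw [List.foldl_cons, h4, h2, List.map_cons, List.prod_cons, mul_assoc]⟩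
  -- The pair `([], j)` stands for t_j, because missing exponents count as 0.
  obtain ⟨h1, h2⟩ := key (normalFormWord D.rank u) ([], j) hj (inRange_normalFormWord u hu)
  refine ⟨h1, h2.trans ?_⟩
  rw [prod_normalFormWord]
  change basisProd b (vec _ []) * _ * _ = _
  rw [vec_nil, basisProd_zero, one_mul]

theorem index_pos (h : D.Describes b t) : 0 < D.index := by
  obtain ⟨_, j, _⟩ := h.exists_normalForm 1
  exact j.pos

/-- The form is read off from t₀ t₀⁻¹. The identity need not belong to the transversal, so its
exponents may be nonzero. -/
theorem identityForm_spec (h : D.Describes b t) : (identityForm D).2 < D.index ∧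
    normalFormValue b t (identityForm D) = 1 := by
  obtain ⟨u, hu, hu2, hval⟩ := h.exists_product (x := (Sum.inr 0, true)) (y := (Sum.inr 0, false))
    h.index_pos h.index_pos
  have h1 : identityForm D = u := by simp [identityForm, hu]
  rw [h1]
  exact ⟨hu2, by rw [hval]; simp [letterValue]⟩

end Description.Describes

end VirtAb

/-! ### The sublevel sets of the weighted length in coordinates -/

namespace VirtAb

theorem normalFormValue_eq {G : Type*} [Group G] {n m : ℕ} (b : Fin n → G) (t : Fin m → G)
    (u : NormalForm) (h : u.2 < m) :
    normalFormValue b t u = basisProd b (vec n u.1) * t ⟨u.2, h⟩ := by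
  simp only [normalFormValue, entry, h, dif_pos]
  rfl

/-- The weight and the exponents that are added when the generator `s` is applied at `t_j`. -/
def shift (D : Description) (j : ℕ) (s : NormalForm × ℕ) : List ℤ :=
  (s.2 : ℤ) :: (transition D j s.1).1

/-- The recursion satisfied by the sets `{(N, a) : |b^a t_j| ≤ N}`. -/
def IsLengthFamily (D : Description) (S : WeightedGens)
    (R : ℕ → (Fin (D.rank + 1) → ℤ) → Prop) : Prop :=
  ∀ j < D.index, ∀ x, R j x ↔
    (0 ≤ x 0 ∧ (identityForm D).2 = j ∧ Fin.tail x = vec D.rank (identityForm D).1) ∨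
    ∃ j' < D.index, ∃ s ∈ S, (transition D j' s.1).2 = j ∧ R j' (x - vec _ (shift D j' s))

section

variable {D : Description} {S : WeightedGens}

/-- By uniqueness of normal forms, a family indexed by j is the same as a relation between elements
g and numbers N. Since b^a t_{j'} s = b^{a+v} t_j when t_{j'} s = b^v t_j, the recursion in
coordinates becomes the last-letter recursion, which has only one solution. -/
theorem IsLengthFamily.iff {R : ℕ → (Fin (D.rank + 1) → ℤ) → Prop} (hR : IsLengthFamily D S R)
    (hpos : ∀ j x, R j x → 0 ≤ x 0) {G : Type*} [Group G] {b : Fin D.rank → G}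
    {t : Fin D.index → G} (hD : D.Describes b t) (hS : WeightedGens.Generates b t S)
    (j : Fin D.index) (x : Fin (D.rank + 1) → ℤ) :
    R j x ↔ 0 ≤ x 0 ∧ (weightedLength (WeightedGens.value b t S) (WeightedGens.weight S)
      (basisProd b (Fin.tail x) * t j) : ℤ) ≤ x 0 := by
  have hval : ∀ (j : Fin D.index) (i : Fin S.length) (a : Fin D.rank → ℤ)
      (hlt : (transition D j (S.get i).1).2 < D.index),
      basisProd b a * t j * WeightedGens.value b t S i =
        basisProd b (a + vec _ (transition D j (S.get i).1).1) *
          t ⟨(transition D j (S.get i).1).2, hlt⟩ := by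
    intro j i a hlt
    have h := (hD.transition_spec j.2 (hS.inRange _ (List.get_mem S i)).2).2
    rw [entry_val] at h
    rw [mul_assoc, WeightedGens.value, ← h, basisProd_add hD.commute, mul_assoc,
      normalFormValue_eq _ _ _ hlt]
  have huniq := iff_weightedLength_le hS.closure_eq_top (w := WeightedGens.weight S)
    (fun i => hS.weight_pos _ (List.get_mem S i))
    (R := fun g N => ∃ (a : Fin D.rank → ℤ) (j : Fin D.index), g = basisProd b a * t j ∧
      R j (Fin.cons N a)) ?_ ?_ (basisProd b (Fin.tail x) * t j) (x 0)
  · rw [← huniq]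
    constructor
    · intro h
      exact ⟨_, _, rfl, by rwa [Fin.cons_self_tail]⟩
    · rintro ⟨a, j', h, hx⟩
      obtain ⟨rfl, rfl⟩ := hD.normalForm_injective h
      rwa [Fin.cons_self_tail] at hx
  · rintro g N ⟨a, j, rfl, h⟩
    simpa using hpos _ _ h
  · intro g N
    obtain ⟨hid, hid1⟩ := hD.identityForm_spec
    have hid2 : basisProd b (vec _ (identityForm D).1) * t ⟨_, hid⟩ = 1 := by
      rw [← hid1, normalFormValue_eq _ _ _ hid]
    have hcons : ∀ (N : ℤ) (a : Fin D.rank → ℤ) (j : ℕ) (i : Fin S.length),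
        (Fin.cons N a : Fin (D.rank + 1) → ℤ) - vec _ (shift D j (S.get i)) =
        Fin.cons (N - WeightedGens.weight S i) (a - vec _ (transition D j (S.get i).1).1) := by
      intro N a j i
      rw [shift, vec_cons]
      ext l
      refine Fin.cases ?_ (fun l => ?_) l <;> simp [WeightedGens.weight]
    constructor
    · rintro ⟨a, j, rfl, h⟩
      rcases (hR j j.2 _).1 h with ⟨h0, hj, ha⟩ | ⟨j', hj', s, hs, hj, h⟩
      · refine .inl ⟨by simpa using h0, ?_⟩
        rw [Fin.tail_cons] at ha
        rw [ha, ← hid2]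
        congr 2
        exact Fin.ext hj.symm
      · obtain ⟨i, rfl⟩ := List.get_of_mem hs
        rw [hcons] at h
        refine .inr ⟨i, _, ⟨j', hj'⟩, ?_, h⟩
        rw [mul_inv_eq_iff_eq_mul, hval ⟨j', hj'⟩ i _ (hj ▸ j.2), sub_add_cancel]
        congr 2
        exact Fin.ext hj.symm
    · rintro (⟨h0, rfl⟩ | ⟨i, a, j', h, hx⟩)
      · exact ⟨_, _, hid2.symm, (hR _ hid _).2 (.inl ⟨by simpa using h0, rfl, by simp⟩)⟩
      · have hlt := (hD.transition_spec j'.2 (hS.inRange _ (List.get_mem S i)).2).1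
        rw [mul_inv_eq_iff_eq_mul, hval j' i a hlt] at h
        refine ⟨_, _, h, (hR _ hlt _).2 (.inr ⟨j', j'.2, _, List.get_mem S i, rfl, ?_⟩)⟩
        rwa [hcons, add_sub_cancel_right]

-- The family is Z + P j. Here P j consists of the label sums of paths, possibly empty, from the
-- transversal element of the identity to t_j. The set Z supplies the exponents of the identity and
-- an arbitrary nonnegative slack in the weight, which turns "equal to N" into "at most N".
open scoped Pointwise in
theorem exists_isLengthFamily (D : Description) (S : WeightedGens)
    (hlt : ∀ j < D.index, ∀ s ∈ S, (transition D j s.1).2 < D.index) :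
    ∃ R : ℕ → (Fin (D.rank + 1) → ℤ) → Prop, IsLengthFamily D S R ∧
      (∀ j x, R j x → 0 ≤ x 0) ∧ ∀ j < D.index, IsSemilinearSet {x | R j x} := by
  let E := Fin D.index × Fin S.length
  let src : E → Fin D.index := fun e => e.1
  let tgt : E → Fin D.index := fun e =>
    ⟨(transition D e.1 (S.get e.2).1).2, hlt _ e.1.2 _ (List.get_mem S _)⟩
  let lab : E → Fin (D.rank + 1) → ℤ := fun e => vec _ (shift D e.1 (S.get e.2))
  let Z : Set (Fin (D.rank + 1) → ℤ) := {x | 0 ≤ x 0 ∧ Fin.tail x = vec D.rank (identityForm D).1}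
  let P : ℕ → Set (Fin (D.rank + 1) → ℤ) := fun j => {y | ((identityForm D).2 = j ∧ y = 0) ∨
    ∃ i k : Fin D.index, (identityForm D).2 = i ∧ j = k ∧ PathSum src tgt lab Set.univ i k y}
  have hZ : IsSemilinearSet Z := by
    have : Z = (Fin.cons 0 (vec D.rank (identityForm D).1) : Fin (D.rank + 1) → ℤ) +ᵥ
        (AddSubmonoid.closure {(Pi.single 0 1 : Fin (D.rank + 1) → ℤ)} :
          Set (Fin (D.rank + 1) → ℤ)) := by
      ext x
      simp only [Set.mem_vadd_set, SetLike.mem_coe, AddSubmonoid.mem_closure_singleton,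
        vadd_eq_add, exists_exists_eq_and]
      constructor
      · rintro ⟨h0, ht⟩
        refine ⟨(x 0).toNat, ?_⟩
        ext i
        refine Fin.cases ?_ (fun i => ?_) i
        · simp [h0]
        · simp [← ht, Fin.tail]
      · rintro ⟨c, rfl⟩
        refine ⟨by simp, ?_⟩
        ext i
        simp [Fin.tail]
    rw [this]
    exact (IsSemilinearSet.closure_of_finite (Set.finite_singleton _)).vadd _
  have hP : ∀ j, IsSemilinearSet (P j) := by
    intro j
    have : P j = {y | (identityForm D).2 = j ∧ y = 0} ∪ ⋃ i : Fin D.index, ⋃ k : Fin D.index,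
        {y | (identityForm D).2 = i ∧ j = k ∧ PathSum src tgt lab Set.univ i k y} := by
      ext y
      simp [P]
    rw [this]
    refine (IsSemilinearSet.of_finite ((Set.finite_singleton 0).subset fun y hy => hy.2)).union
      (.iUnion fun i => .iUnion fun k => ?_)
    by_cases h : (identityForm D).2 = i ∧ j = k
    · simpa [h.1, h.2] using PathSum.isSemilinearSet src tgt lab Set.univ i k
    · convert IsSemilinearSet.empty
      ext y
      simp only [Set.mem_ofPred_eq, Set.mem_empty_iff_false, iff_false]
      exact fun hy => h ⟨hy.1, hy.2.1⟩
  have hlab : ∀ e, 0 ≤ lab e 0 := by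
    intro e
    simp [lab, shift, vec]
  have hP0 : ∀ j, ∀ y ∈ P j, 0 ≤ y 0 := by
    rintro j y (⟨_, rfl⟩ | ⟨i, k, _, _, h⟩)
    · simp
    · have key : ∀ i k y, PathSum src tgt lab Set.univ i k y → 0 ≤ y 0 := by
        intro i k y h
        induction h with
        | edge e => exact hlab e
        | snoc e _ _ ih => exact add_nonneg ih (hlab e)
      exact key _ _ _ h
  refine ⟨fun j x => x ∈ Z + P j, ?_, ?_, fun j _ => hZ.add (hP j)⟩
  · intro j hj x
    constructor
    · rintro ⟨z, hz, y, (⟨hid, rfl⟩ | ⟨i, k, hi, hk, h⟩), rfl⟩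
      · refine .inl ⟨?_, hid, ?_⟩
        · simpa using hz.1
        · simpa using hz.2
      · right
        cases h with
        | edge e =>
          refine ⟨e.1, e.1.2, _, List.get_mem S e.2, hk.symm, z, hz, 0, .inl ⟨hi, rfl⟩, ?_⟩
          simp [lab]
        | @snoc _ y e h =>
          refine ⟨e.1, e.1.2, _, List.get_mem S e.2, hk.symm, z, hz, y,
            .inr ⟨i, e.1, hi, rfl, h⟩, ?_⟩
          simp [lab, ← add_assoc]
    · rintro (⟨h0, hid, ht⟩ | ⟨j', hj', s, hs, hj, z, hz, y, hy, hx⟩)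
      · exact ⟨x, ⟨h0, ht⟩, 0, .inl ⟨hid, rfl⟩, by simp⟩
      · obtain ⟨l, rfl⟩ := List.get_of_mem hs
        let e : E := (⟨j', hj'⟩, l)
        have hx' : x = z + (y + lab e) := by
          rw [← add_assoc]
          exact (sub_eq_iff_eq_add.1 hx.symm)
        rw [hx']
        refine ⟨z, hz, _, .inr ?_, rfl⟩
        rcases hy with ⟨hid, rfl⟩ | ⟨i, k, hi, hk, h⟩
        · exact ⟨⟨j', hj'⟩, tgt e, hid, hj.symm, by rw [zero_add]; exact .edge e⟩
        · refine ⟨i, tgt e, hi, hj.symm, .snoc e ?_ (Set.mem_univ _)⟩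
          have : k = src e := Fin.ext hk.symm
          rwa [← this]
  · rintro j x ⟨z, hz, y, hy, rfl⟩
    exact add_nonneg hz.1 (hP0 j y hy)

end

end VirtAb

/-! ### Certificates -/

namespace VirtAb

/-- The linear set `p + ⟨U⟩` in the part with index `J` of a disjoint union, as `(J, p, U)`. -/
abbrev IndexedLinear : Type := List ℕ × List ℤ × List (List ℤ)

/-- The lists of length `d` with entries in `A`. -/
def listsOf {α : Type*} (A : List α) (d : ℕ) : List (List α) :=
  Nat.rec [[]] (fun _ L => A.flatMap fun a => L.map fun l => a :: l) d

theorem mem_listsOf {α : Type*} {A : List α} {d : ℕ} {l : List α} :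
    l ∈ listsOf A d ↔ l.length = d ∧ ∀ a ∈ l, a ∈ A := by
  induction d generalizing l with
  | zero =>
    change l ∈ [[]] ↔ _
    rw [List.mem_singleton, List.length_eq_zero_iff]
    constructor
    · rintro rfl
      simp
    · exact fun h => h.1
  | succ d ih =>
    have h : l ∈ listsOf A (d + 1) ↔ ∃ a ∈ A, ∃ l' ∈ listsOf A d, a :: l' = l := by
      simp [listsOf]
    rw [h]
    constructor
    · rintro ⟨a, ha, l', hl', rfl⟩
      rw [ih] at hl'
      exact ⟨by simp [hl'.1], by simpa [ha] using hl'.2⟩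
    · rintro ⟨h1, h2⟩
      match l, h1 with
      | a :: l, h1 =>
        exact ⟨a, h2 a (by simp), l, ih.2 ⟨by simpa using h1, fun b hb => h2 b (by simp [hb])⟩, rfl⟩

/-- The integer vectors of dimension `d` with entries bounded by `B`. -/
def box (B d : ℕ) : List (List ℤ) :=
  listsOf ((List.range (2 * B + 1)).map fun a : ℕ => (a : ℤ) - B) d

theorem ofFn_mem_box {B d : ℕ} {x : Fin d → ℤ} (hx : ∀ i, |x i| ≤ B) : List.ofFn x ∈ box B d := by
  refine mem_listsOf.2 ⟨by simp, fun a ha => ?_⟩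
  obtain ⟨i, rfl⟩ := (List.mem_ofFn' _ _).1 ha
  have := abs_le.1 (hx i)
  refine List.mem_map.2 ⟨(x i + B).toNat, ?_, ?_⟩
  · rw [List.mem_range]
    omega
  · omega

/-- The coordinate `i` of `∑ c_l U_l`. -/
def combination (c : List ℕ) (U : List (List ℤ)) (i : ℕ) : ℤ :=
  ((List.range U.length).map fun l => (c.getD l 0 : ℤ) * (U.getD l []).getD i 0).sum

theorem combination_ofFn {d : ℕ} (U : List (List ℤ)) (c : Fin U.length → ℕ) (i : Fin d) :
    combination (List.ofFn c) U i = (∑ l, c l • vec d (U.get l)) i := by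
  rw [combination, ← List.sum_toFinset _ List.nodup_range, List.toFinset_range,
    Finset.sum_range, Finset.sum_apply]
  refine Finset.sum_congr rfl fun l _ => ?_
  simp [vec]

/-- Membership of `x` in the part with index `J` of a union of linear sets whose generators have
positive weights. -/
def BoundedMem (d : ℕ) (E : List IndexedLinear) (J : List ℕ) (x : List ℤ) : Prop :=
  ∃ e ∈ E, e.1 = J ∧ ∃ c ∈ listsOf (List.range ((x.getD 0 0).toNat + 1)) e.2.2.length,
    ∀ i ∈ List.range d, x.getD i 0 = e.2.1.getD i 0 + combination c e.2.2 i

/-- Membership of `x` in the part with index `J` of a union of linear sets. -/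
def Mem (d : ℕ) (E : List IndexedLinear) (J : List ℕ) (x : Fin d → ℤ) : Prop :=
  ∃ e ∈ E, e.1 = J ∧ InLinear (vec d e.2.1) (fun l : Fin e.2.2.length => vec d (e.2.2.get l)) x

/-- The weights (coordinate `0`) of the generators are positive, those of the bases nonnegative. -/
def Positive (E : List IndexedLinear) : Prop :=
  ∀ e ∈ E, 0 ≤ e.2.1.getD 0 0 ∧ ∀ u ∈ e.2.2, 1 ≤ u.getD 0 0

theorem Positive.nonneg {d : ℕ} {E : List IndexedLinear} (hE : Positive E) {J : List ℕ}
    {x : Fin (d + 1) → ℤ} (hx : Mem (d + 1) E J x) : 0 ≤ x 0 := by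
  obtain ⟨e, he, _, c, rfl⟩ := hx
  rw [Pi.add_apply, Finset.sum_apply]
  refine add_nonneg (by simpa [vec] using (hE e he).1) (Finset.sum_nonneg fun l _ => ?_)
  have := (hE e he).2 _ (List.get_mem e.2.2 l)
  simp only [Pi.smul_apply, nsmul_eq_mul]
  exact mul_nonneg (by simp) (by simp only [vec, Fin.val_zero]; omega)

/-- In coordinate 0 every generator contributes at least 1 and the base at least 0. So no
coefficient exceeds the weight of x, and the bounded search misses nothing. -/
theorem Positive.boundedMem_iff {d : ℕ} {E : List IndexedLinear} (hE : Positive E) (J : List ℕ)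
    (x : List ℤ) : BoundedMem (d + 1) E J x ↔ Mem (d + 1) E J (vec (d + 1) x) := by
  refine exists_congr fun e => and_congr_right fun he => and_congr_right fun _ => ?_
  have hiff : ∀ c : Fin e.2.2.length → ℕ,
      (∀ i ∈ List.range (d + 1), x.getD i 0 = e.2.1.getD i 0 + combination (List.ofFn c) e.2.2 i) ↔
      vec (d + 1) x = vec (d + 1) e.2.1 + ∑ l, c l • vec (d + 1) (e.2.2.get l) := by
    intro c
    rw [funext_iff]
    constructor
    · intro h i
      rw [Pi.add_apply, ← combination_ofFn]
      exact h i (List.mem_range.2 i.2)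
    · intro h i hi
      have := h ⟨i, List.mem_range.1 hi⟩
      rwa [Pi.add_apply, ← combination_ofFn] at this
  constructor
  · rintro ⟨c, hc, h⟩
    obtain ⟨hlen, -⟩ := mem_listsOf.1 hc
    refine ⟨fun l => c.get (l.cast hlen.symm), (hiff _).1 ?_⟩
    have : List.ofFn (fun l => c.get (l.cast hlen.symm)) = c := by
      refine List.ext_getElem (by simp [hlen]) fun i h₁ h₂ => ?_
      simp
    rwa [this]
  · rintro ⟨c, hc⟩
    refine ⟨List.ofFn c, mem_listsOf.2 ⟨by simp, fun a ha => ?_⟩, (hiff c).2 hc⟩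
    obtain ⟨l, rfl⟩ := (List.mem_ofFn' _ _).1 ha
    have h0 : vec (d + 1) x 0 =
        vec (d + 1) e.2.1 0 + ∑ l, (c l • vec (d + 1) (e.2.2.get l)) 0 := by
      have := congrFun hc 0
      rwa [Pi.add_apply, Finset.sum_apply] at this
    have hpos : ∀ l : Fin e.2.2.length, 1 ≤ vec (d + 1) (e.2.2.get l) 0 := fun l =>
      (hE e he).2 _ (List.get_mem e.2.2 l)
    have hb : 0 ≤ vec (d + 1) e.2.1 0 := (hE e he).1
    have hx : vec (d + 1) x 0 = x.getD 0 0 := rfl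
    rw [hx] at h0
    have h1 : (c l : ℤ) ≤ ∑ l, (c l • vec (d + 1) (e.2.2.get l)) 0 := by
      have hnn : ∀ l, 0 ≤ (c l • vec (d + 1) (e.2.2.get l)) 0 := fun l => by
        simp only [Pi.smul_apply, nsmul_eq_mul]
        exact mul_nonneg (by simp) (zero_le_one.trans (hpos l))
      refine le_trans ?_ (Finset.single_le_sum (fun l _ => hnn l) (Finset.mem_univ l))
      simp only [Pi.smul_apply, nsmul_eq_mul]
      exact le_mul_of_one_le_right (by simp) (hpos l)
    rw [List.mem_range]
    omega

/-- The sum of the absolute values of the entries. -/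
def listNorm (l : List ℤ) : ℕ := (l.map Int.natAbs).sum

/-- The sum of the absolute values of all entries of bases and generators. -/
def exprNorm (E : List IndexedLinear) : ℕ :=
  (E.map fun e => listNorm e.2.1 + (e.2.2.map listNorm).sum).sum

theorem abs_vec_le {d : ℕ} (l : List ℤ) (i : Fin d) : |vec d l i| ≤ listNorm l := by
  rw [vec, Int.abs_eq_natAbs, Nat.cast_le]
  rcases lt_or_ge (i : ℕ) l.length with h | h
  · rw [List.getD_eq_getElem _ _ h]
    exact List.single_le_sum (by simp) _ (List.mem_map.2 ⟨_, List.getElem_mem h, rfl⟩)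
  · rw [List.getD_eq_default _ _ h]
    simp

theorem sum_abs_vec_le {d : ℕ} (U : List (List ℤ)) (i : Fin d) :
    ∑ l : Fin U.length, |vec d (U.get l) i| ≤ (U.map listNorm).sum := by
  refine (Finset.sum_le_sum fun l _ => abs_vec_le (U.get l) i).trans (le_of_eq ?_)
  rw [← Nat.cast_sum, ← List.sum_ofFn]
  congr 2
  refine List.ext_getElem (by simp) fun i h₁ h₂ => ?_
  simp

/-- The translation by v is absorbed into the base points, and each linear set of the union costs
one factor. The common dimension bound r lets all the state counts below be powers of a single
number. -/
theorem hasKernel_mem {d e C r : ℕ} (E : List IndexedLinear) (J : List ℕ)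
    (A : (Fin d → ℤ) →+ (Fin e → ℤ)) (v : Fin e → ℤ) (hA : ∀ ε, IsDigit ε → ∀ i, |A ε i| ≤ 1)
    (hv : ∀ i, |v i| + exprNorm E + 1 ≤ C) (he : e ≤ r) :
    HasKernel ((2 ^ (2 * C + 1) ^ r) ^ E.length) (fun x => Mem e E J (A x - v)) := by
  refine HasKernel.exists_mem E fun a ha => HasKernel.const_and _ Nat.one_le_two_pow ?_
  have hle : listNorm a.2.1 + (a.2.2.map listNorm).sum ≤ exprNorm E :=
    List.single_le_sum (by simp) _ (List.mem_map.2 ⟨a, ha, rfl⟩)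
  have h := HasKernel.inLinear (C := C) A (vec e a.2.1 + v)
    (fun l : Fin a.2.2.length => vec e (a.2.2.get l)) ?_ ?_
  · refine (h.mono ?_).congr fun x => ?_
    · exact Nat.pow_le_pow_right (by norm_num) (Nat.pow_le_pow_right (by omega) he)
    · refine exists_congr fun c => ?_
      rw [sub_eq_iff_eq_add, add_right_comm]
  · intro i
    have h1 := abs_vec_le a.2.1 i
    have h2 := hv i
    have h3 := abs_add_le (vec e a.2.1 i) (v i)
    rw [Pi.add_apply]
    omega
  · intro ε hε i
    have h1 := sum_abs_vec_le a.2.2 i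
    have h2 := hv i
    have h3 := hA ε hε i
    have h4 := abs_nonneg (v i)
    omega

/-- The coordinate `i` of a vector, as a homomorphism. -/
def coordHom (d i : ℕ) : (Fin d → ℤ) →+ ℤ :=
  if h : i < d then Pi.evalAddMonoidHom _ ⟨i, h⟩ else 0

theorem coordHom_apply {d i : ℕ} (x : Fin d → ℤ) : coordHom d i x = (List.ofFn x).getD i 0 := by
  unfold coordHom
  split_ifs with h <;> simp [h]

theorem abs_coordHom_le {d i : ℕ} {ε : Fin d → ℤ} (hε : IsDigit ε) : |coordHom d i ε| ≤ 1 := by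
  unfold coordHom
  split_ifs with h
  · rcases hε ⟨i, h⟩ with h' | h' <;> simp [h']
  · simp

/-- In dimension one the equation is a linear set without generators, and the inequality is the
linear set with base β and the single generator -1. -/
theorem hasKernel_eq_or_le {d C r : ℕ} (φ : (Fin d → ℤ) →+ ℤ) (β : ℤ)
    (hφ : ∀ ε, IsDigit ε → |φ ε| + 1 ≤ C) (hβ : |β| ≤ C) (hr : 1 ≤ r) :
    HasKernel (2 ^ (2 * C + 1) ^ r) (fun x => φ x = β) ∧
    HasKernel (2 ^ (2 * C + 1) ^ r) (fun x => φ x ≤ β) := by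
  have hle : 2 ^ (2 * C + 1) ^ 1 ≤ 2 ^ (2 * C + 1) ^ r :=
    Nat.pow_le_pow_right (by norm_num) (Nat.pow_le_pow_right (by omega) hr)
  let A : (Fin d → ℤ) →+ (Fin 1 → ℤ) := AddMonoidHom.pi fun _ => φ
  constructor
  · refine ((HasKernel.inLinear (C := C) A (fun _ => β) (Fin.elim0 : Fin 0 → Fin 1 → ℤ)
      (fun _ => hβ) fun ε hε i => ?_).mono hle).congr fun x => ?_
    · simpa [A] using (le_add_of_nonneg_right zero_le_one).trans (hφ ε hε)
    · simp [InLinear, A, funext_iff]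
  · refine ((HasKernel.inLinear (C := C) A (fun _ => β) (fun _ : Fin 1 => fun _ => (-1 : ℤ))
      (fun _ => hβ) fun ε hε i => ?_).mono hle).congr fun x => ?_
    · simpa [A] using hφ ε hε
    · simp only [InLinear, A, funext_iff]
      constructor
      · rintro ⟨c, hc⟩
        have := hc 0
        simp at this
        omega
      · intro h
        refine ⟨fun _ => (β - φ x).toNat, fun i => ?_⟩
        simp [h]

/-- Position of coordinate `l` of block `i`, in vectors that consist of a total weight followed by
blocks of length `n + 1`. -/
def position (n i l : ℕ) : ℕ := i * (n + 1) + l + 1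

/-- The block `i` of a list. -/
def block (n i : ℕ) (x : List ℤ) : List ℤ :=
  (List.range (n + 1)).map fun l => x.getD (position n i l) 0

/-- The block `i` of a vector, as a homomorphism. -/
def blockHom (d n i : ℕ) : (Fin d → ℤ) →+ (Fin (n + 1) → ℤ) :=
  AddMonoidHom.pi fun l => coordHom d (position n i l)

theorem vec_block {d : ℕ} (n i : ℕ) (x : Fin d → ℤ) :
    vec (n + 1) (block n i (List.ofFn x)) = blockHom d n i x := by
  ext l
  simp only [vec, block, blockHom, AddMonoidHom.pi_apply, coordHom_apply]
  rw [List.getD_eq_getElem _ _ (by simp; omega), List.getElem_map, List.getElem_range]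

/-- The difference of two vectors of dimension `d`. -/
def subVec (d : ℕ) (x y : List ℤ) : List ℤ :=
  (List.range d).map fun i => x.getD i 0 - y.getD i 0

theorem vec_subVec {d : ℕ} (x y : List ℤ) : vec d (subVec d x y) = vec d x - vec d y := by
  ext i
  simp [vec, subVec]

/-- The sum `∑ α_i |g_i|` of a length constraint satisfies it. -/
def LengthConstraint.Holds (c : LengthConstraint) (s : ℤ) : Prop :=
  (c.isEquation = true ∧ s = c.bound) ∨ (c.isEquation = false ∧ s ≤ c.bound)

/-- The weighted sum of the lengths stored in a vector. -/
def LengthConstraint.lengthSum (c : LengthConstraint) (n : ℕ) (x : List ℤ) : ℤ :=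
  ((List.range c.coeffs.length).map fun i => c.coeffs.getD i 0 * x.getD (position n i 0) 0).sum

/-- The sum of the lengths stored in a vector. -/
def totalLength (n k : ℕ) (x : List ℤ) : ℤ :=
  ((List.range k).map fun i => x.getD (position n i 0) 0).sum

/-- The dimension of the vectors that consist of a total weight and, for each coordinate of `G^k`,
a weight and an exponent vector. -/
def totalDim (D : Description) (c : LengthConstraint) : ℕ :=
  c.coeffs.length * (D.rank + 1) + 1

/-- The recursion for sublevel sets of the length, at the vector `x`. -/
def LengthCheck (D : Description) (S : WeightedGens) (R : List IndexedLinear) (j : ℕ)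
    (x : List ℤ) : Prop :=
  BoundedMem (D.rank + 1) R [j] x ↔
    (0 ≤ x.getD 0 0 ∧ (identityForm D).2 = j ∧
      ∀ i ∈ List.range D.rank, x.getD (i + 1) 0 = (identityForm D).1.getD i 0) ∨
    ∃ j' ∈ List.range D.index, ∃ s ∈ S, (transition D j' s.1).2 = j ∧
      BoundedMem (D.rank + 1) R [j'] (subVec (D.rank + 1) x (shift D j' s))

/-- The description of the solutions, at the vector `x`. -/
def SolutionCheck (D : Description) (c : LengthConstraint) (R E : List IndexedLinear) (J : List ℕ)
    (x : List ℤ) : Prop :=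
  BoundedMem (totalDim D c) E J x ↔
    x.getD 0 0 = totalLength D.rank c.coeffs.length x ∧
    (∀ i ∈ List.range c.coeffs.length,
      BoundedMem (D.rank + 1) R [J.getD i 0] (block D.rank i x) ∧
      ¬ BoundedMem (D.rank + 1) R [J.getD i 0] (subVec (D.rank + 1) (block D.rank i x) [1])) ∧
    c.Holds (c.lengthSum D.rank x)

/-- A bound for all numbers that occur in a certificate. -/
def normBound (D : Description) (S : WeightedGens) (c : LengthConstraint)
    (R E : List IndexedLinear) : ℕ :=
  c.coeffs.length + listNorm c.coeffs + c.bound.natAbs + listNorm (identityForm D).1 +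
    exprNorm R + exprNorm E +
    ((List.range D.index).map fun j => (S.map fun s => listNorm (shift D j s)).sum).sum + 2

/-- The certificate has to be checked for vectors with entries up to this bound. -/
def searchBound (D : Description) (S : WeightedGens) (c : LengthConstraint)
    (R E : List IndexedLinear) : ℕ :=
  2 ^ (2 ^ (2 * normBound D S c R E + 1) ^ (totalDim D c + D.rank + 1)) ^
    (R.length + 1 + R.length * S.length * D.index + E.length + 2 + 2 * R.length * c.coeffs.length)

/-- The certificate `(R, E)` passes all checks: `R` describes the sublevel sets of the length, and
`E` the solutions of the constraint, on all vectors up to the search bound. -/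
def Valid (D : Description) (S : WeightedGens) (c : LengthConstraint)
    (R E : List IndexedLinear) : Prop :=
  Positive R ∧ Positive E ∧
  (∀ e ∈ E, e.1 ∈ listsOf (List.range D.index) c.coeffs.length) ∧
  (∀ j ∈ List.range D.index, ∀ x ∈ box (searchBound D S c R E) (D.rank + 1),
    LengthCheck D S R j x) ∧
  (∀ J ∈ listsOf (List.range D.index) c.coeffs.length,
    ∀ x ∈ box (searchBound D S c R E) (totalDim D c), SolutionCheck D c R E J x)

theorem sum_range_eq_sum_map {k : ℕ} (f : ℕ → ℤ) :
    ((List.range k).map f).sum = ∑ i ∈ Finset.range k, f i := by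
  rw [← List.sum_toFinset _ List.nodup_range, List.toFinset_range]

/-! ### Kernel sizes of the checks, and the passage from the box to all vectors -/

section Kernel

variable {D : Description} {S : WeightedGens} {c : LengthConstraint} {R E : List IndexedLinear}

theorem lengthCheck_ofFn_iff (hR : Positive R) (j : ℕ) (x : Fin (D.rank + 1) → ℤ) :
    LengthCheck D S R j (List.ofFn x) ↔ (Mem (D.rank + 1) R [j] x ↔
      (0 ≤ x 0 ∧ (identityForm D).2 = j ∧ Fin.tail x = vec D.rank (identityForm D).1) ∨
      ∃ j' < D.index, ∃ s ∈ S, (transition D j' s.1).2 = j ∧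
        Mem (D.rank + 1) R [j'] (x - vec _ (shift D j' s))) := by
  simp only [LengthCheck, hR.boundedMem_iff, vec_subVec, vec_ofFn, List.mem_range]
  refine iff_congr Iff.rfl (or_congr (and_congr (by simp) (and_congr Iff.rfl ?_)) Iff.rfl)
  rw [funext_iff, Fin.forall_iff]
  refine forall₂_congr fun i hi => ?_
  simp [vec, Fin.tail, hi]

/-- The exponent counts linear sets: `R.length` for the left side, 1 for the empty word, and
`R.length` for each pair (j', s). -/
theorem hasKernel_lengthCheck (hR : Positive R) (j : ℕ) :
    HasKernel ((2 ^ (2 * normBound D S c R E + 1) ^ (totalDim D c + D.rank + 1)) ^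
      (R.length + 1 + R.length * S.length * D.index))
      (fun x : Fin (D.rank + 1) → ℤ => LengthCheck D S R j (List.ofFn x)) := by
  set C := normBound D S c R E with hC
  set r := totalDim D c + D.rank + 1 with hr
  have hid : ∀ ε : Fin (D.rank + 1) → ℤ, IsDigit ε →
      ∀ i, |AddMonoidHom.id (Fin (D.rank + 1) → ℤ) ε i| ≤ 1 := by
    intro ε hε i
    rcases hε i with h | h <;> simp [h]
  have h1 := hasKernel_mem (C := C) (r := r) R [j] (AddMonoidHom.id _) 0 hid
    (by intro i; simp only [hC, normBound, Pi.zero_apply, abs_zero]; omega) (by omega)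
  -- The empty word gives a linear set: the exponents of the identity, plus multiples of the unit
  -- vector of the weight.
  have h2 : HasKernel (2 ^ (2 * C + 1) ^ r) (fun x : Fin (D.rank + 1) → ℤ =>
      0 ≤ x 0 ∧ (identityForm D).2 = j ∧ Fin.tail x = vec D.rank (identityForm D).1) := by
    have h := HasKernel.inLinear (C := C) (AddMonoidHom.id (Fin (D.rank + 1) → ℤ))
      (vec _ (0 :: (identityForm D).1)) (fun _ : Fin 1 => Pi.single 0 1) (fun i => ?_)
      (fun ε hε i => ?_)
    · refine (HasKernel.const_and ((identityForm D).2 = j) Nat.one_le_two_pow (h.mono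
        (Nat.pow_le_pow_right (by norm_num) (Nat.pow_le_pow_right (by omega)
          (show D.rank + 1 ≤ r by omega))))).congr fun x => ?_
      rw [and_left_comm]
      refine and_congr_right fun _ => ?_
      rw [vec_cons]
      constructor
      · rintro ⟨c, hc⟩
        rw [AddMonoidHom.id_apply] at hc
        subst hc
        refine ⟨by simp, ?_⟩
        ext i
        simp [Fin.tail]
      · rintro ⟨h0, ht⟩
        refine ⟨fun _ => (x 0).toNat, ?_⟩
        ext i
        refine Fin.cases ?_ (fun i => ?_) i
        · simp [h0]
        · simp [← ht, Fin.tail]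
    · have := abs_vec_le (0 :: (identityForm D).1) i
      simp only [listNorm, List.map_cons, Int.natAbs_zero, List.sum_cons, zero_add] at this
      simp only [hC, normBound, listNorm]
      omega
    · have h1 := hid ε hε i
      have h2 : ∑ _j : Fin 1, |(Pi.single 0 1 : Fin (D.rank + 1) → ℤ) i| ≤ 1 := by
        rw [Fin.sum_univ_one, Pi.single_apply]
        split_ifs <;> simp
      simp only [hC, normBound]
      omega
  have h3 : ∀ j' ∈ List.range D.index, ∀ s ∈ S, HasKernel ((2 ^ (2 * C + 1) ^ r) ^ R.length)
      (fun x => (transition D j' s.1).2 = j ∧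
        Mem (D.rank + 1) R [j'] (AddMonoidHom.id _ x - vec _ (shift D j' s))) := by
    intro j' hj' s hs
    refine HasKernel.const_and _ (Nat.one_le_pow _ _ (by positivity)) ?_
    refine hasKernel_mem (C := C) (r := r) R [j'] (AddMonoidHom.id _) _ hid (fun i => ?_) (by omega)
    have h1 := abs_vec_le (shift D j' s) i
    have h2 : listNorm (shift D j' s) ≤ (S.map fun s => listNorm (shift D j' s)).sum :=
      List.single_le_sum (by simp) _ (List.mem_map.2 ⟨s, hs, rfl⟩)
    have h3 : (S.map fun s => listNorm (shift D j' s)).sum ≤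
      ((List.range D.index).map fun j => (S.map fun s => listNorm (shift D j s)).sum).sum :=
      List.single_le_sum (by simp) _ (List.mem_map.2 ⟨j', hj', rfl⟩)
    simp only [hC, normBound]
    omega
  have h4 := HasKernel.exists_mem _ fun j' hj' => HasKernel.exists_mem S (h3 j' hj')
  refine (h1.binary (fun a b => a ↔ b) (h2.binary Or h4)).congr (fun x => ?_) |>.mono ?_
  · rw [lengthCheck_ofFn_iff hR]
    simp
  · rw [List.length_range]
    have hK : 0 < 2 ^ (2 * C + 1) ^ r := by positivity
    generalize 2 ^ (2 * C + 1) ^ r = K at hK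
    rw [← pow_mul, ← pow_mul, ← pow_succ', ← pow_add]
    exact Nat.pow_le_pow_right hK (le_of_eq (by ring))

theorem solutionCheck_ofFn_iff (hR : Positive R) (hE : Positive E) (J : List ℕ)
    (x : Fin (totalDim D c) → ℤ) :
    SolutionCheck D c R E J (List.ofFn x) ↔ (Mem (totalDim D c) E J x ↔
      (List.ofFn x).getD 0 0 = totalLength D.rank c.coeffs.length (List.ofFn x) ∧
      (∀ i ∈ List.range c.coeffs.length,
        Mem (D.rank + 1) R [J.getD i 0] (blockHom _ D.rank i x) ∧
        ¬ Mem (D.rank + 1) R [J.getD i 0] (blockHom _ D.rank i x - vec _ [1])) ∧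
      c.Holds (c.lengthSum D.rank (List.ofFn x))) := by
  have h := hE.boundedMem_iff (d := c.coeffs.length * (D.rank + 1)) J (List.ofFn x)
  have hx : vec (c.coeffs.length * (D.rank + 1) + 1) (List.ofFn x) = x := vec_ofFn x
  rw [hx] at h
  simp only [SolutionCheck, hR.boundedMem_iff, vec_subVec, vec_block]
  exact iff_congr h Iff.rfl

/-- The exponent counts `E.length` for the left side, 2 for the total length and the constraint, and
`2 * R.length` for each coordinate of the power of G. -/
theorem hasKernel_solutionCheck (hR : Positive R) (hE : Positive E) (J : List ℕ) :
    HasKernel ((2 ^ (2 * normBound D S c R E + 1) ^ (totalDim D c + D.rank + 1)) ^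
      (E.length + 2 + 2 * R.length * c.coeffs.length))
      (fun x : Fin (totalDim D c) → ℤ => SolutionCheck D c R E J (List.ofFn x)) := by
  set C := normBound D S c R E with hC
  set r := totalDim D c + D.rank + 1 with hr
  have hid : ∀ ε : Fin (totalDim D c) → ℤ, IsDigit ε →
      ∀ i, |AddMonoidHom.id (Fin (totalDim D c) → ℤ) ε i| ≤ 1 := by
    intro ε hε i
    rcases hε i with h | h <;> simp [h]
  have h1 := hasKernel_mem (C := C) (r := r) E J (AddMonoidHom.id _) 0 hid
    (by intro i; simp only [hC, normBound, Pi.zero_apply, abs_zero]; omega) (by omega)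
  have h2 : HasKernel (2 ^ (2 * C + 1) ^ r) (fun x : Fin (totalDim D c) → ℤ =>
      (List.ofFn x).getD 0 0 = totalLength D.rank c.coeffs.length (List.ofFn x)) := by
    refine (hasKernel_eq_or_le (C := C) (coordHom _ 0 -
      ∑ i ∈ Finset.range c.coeffs.length, coordHom _ (position D.rank i 0)) 0 (fun ε hε => ?_)
      (by simp) (by omega)).1.congr fun x => ?_
    · have h1 : |coordHom (totalDim D c) 0 ε| ≤ 1 := abs_coordHom_le hε
      have h2 := Finset.abs_sum_le_sum_abs
        (fun i => coordHom (totalDim D c) (position D.rank i 0) ε) (Finset.range c.coeffs.length)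
      have h3 := Finset.sum_le_card_nsmul (Finset.range c.coeffs.length)
        (fun i => |coordHom (totalDim D c) (position D.rank i 0) ε|) 1
        fun i _ => abs_coordHom_le hε
      have h4 := abs_sub (coordHom (totalDim D c) 0 ε)
        (∑ i ∈ Finset.range c.coeffs.length, coordHom (totalDim D c) (position D.rank i 0) ε)
      simp only [Finset.card_range, nsmul_eq_mul, mul_one] at h3
      rw [AddMonoidHom.sub_apply, AddMonoidHom.finsetSum_apply]
      simp only [hC, normBound]
      omega
    · rw [AddMonoidHom.sub_apply, AddMonoidHom.finsetSum_apply, sub_eq_zero]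
      simp only [coordHom_apply, totalLength, sum_range_eq_sum_map]
  have hb : ∀ i, ∀ ε : Fin (totalDim D c) → ℤ, IsDigit ε →
      ∀ l, |blockHom (totalDim D c) D.rank i ε l| ≤ 1 := fun i ε hε l => abs_coordHom_le hε
  have h3 : ∀ i ∈ List.range c.coeffs.length,
      HasKernel ((2 ^ (2 * C + 1) ^ r) ^ R.length * (2 ^ (2 * C + 1) ^ r) ^ R.length)
      (fun x : Fin (totalDim D c) → ℤ =>
        Mem (D.rank + 1) R [J.getD i 0] (blockHom _ D.rank i x - 0) ∧
        ¬ Mem (D.rank + 1) R [J.getD i 0] (blockHom _ D.rank i x - vec _ [1])) := by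
    intro i _
    refine HasKernel.binary And (hasKernel_mem R _ _ _ (hb i) (fun l => ?_) (by omega))
      (HasKernel.not (hasKernel_mem R _ _ _ (hb i) (fun l => ?_) (by omega)))
    · simp only [hC, normBound, Pi.zero_apply, abs_zero]
      omega
    · have := abs_vec_le [1] l
      simp only [hC, normBound, listNorm, List.map_cons, List.map_nil, List.sum_cons,
        List.sum_nil] at this ⊢
      omega
  have h4 : HasKernel (2 ^ (2 * C + 1) ^ r) (fun x : Fin (totalDim D c) → ℤ =>
      c.Holds (c.lengthSum D.rank (List.ofFn x))) := by
    have hφ := hasKernel_eq_or_le (C := C) (r := r) (∑ i ∈ Finset.range c.coeffs.length,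
      c.coeffs.getD i 0 • coordHom (totalDim D c) (position D.rank i 0)) c.bound (fun ε hε => ?_)
      (by rw [Int.abs_eq_natAbs]; simp only [hC, normBound]; omega) (by omega)
    · have hsum : ∀ x : Fin (totalDim D c) → ℤ, c.lengthSum D.rank (List.ofFn x) =
          (∑ i ∈ Finset.range c.coeffs.length,
            c.coeffs.getD i 0 • coordHom (totalDim D c) (position D.rank i 0)) x := by
        intro x
        rw [AddMonoidHom.finsetSum_apply, LengthConstraint.lengthSum, sum_range_eq_sum_map]
        simp only [AddMonoidHom.smul_apply, coordHom_apply, smul_eq_mul]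
      cases hc : c.isEquation with
      | true => exact hφ.1.congr fun x => by simp [LengthConstraint.Holds, hc, hsum]
      | false => exact hφ.2.congr fun x => by simp [LengthConstraint.Holds, hc, hsum]
    · rw [AddMonoidHom.finsetSum_apply]
      have h1 := Finset.abs_sum_le_sum_abs (fun i => (c.coeffs.getD i 0 •
        coordHom (totalDim D c) (position D.rank i 0)) ε) (Finset.range c.coeffs.length)
      have h2 : ∑ i ∈ Finset.range c.coeffs.length, |(c.coeffs.getD i 0 •
          coordHom (totalDim D c) (position D.rank i 0)) ε| ≤
          ∑ i ∈ Finset.range c.coeffs.length, |c.coeffs.getD i 0| := by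
        refine Finset.sum_le_sum fun i _ => ?_
        rw [AddMonoidHom.smul_apply, smul_eq_mul, abs_mul]
        exact mul_le_of_le_one_right (abs_nonneg _) (abs_coordHom_le hε)
      have h3 : ∑ i ∈ Finset.range c.coeffs.length, |c.coeffs.getD i 0| = listNorm c.coeffs := by
        rw [listNorm, Finset.sum_range, ← Fin.sum_univ_fun_getElem, Nat.cast_sum]
        simp
      simp only [hC, normBound]
      omega
  refine (h1.binary (fun a b => a ↔ b) (h2.binary And
    ((HasKernel.forall_mem _ h3).binary And h4))).congr (fun x => ?_) |>.mono ?_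
  · rw [solutionCheck_ofFn_iff hR hE]
    simp
  · rw [List.length_range]
    have hK : 0 < 2 ^ (2 * C + 1) ^ r := by positivity
    generalize 2 ^ (2 * C + 1) ^ r = K at hK
    rw [← pow_add, ← pow_mul, ← pow_succ, ← pow_succ', ← pow_add]
    exact Nat.pow_le_pow_right hK (le_of_eq (by ring))

/-- The exponent in `searchBound` is the sum of those of both checks, so the box is large enough to
contain a failure of either if there is one. -/
theorem Valid.lengthCheck (h : Valid D S c R E) :
    IsLengthFamily D S (fun j x => Mem (D.rank + 1) R [j] x) := by
  intro j hj x
  rw [← lengthCheck_ofFn_iff h.1]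
  refine HasKernel.forall_of_bounded (hasKernel_lengthCheck (c := c) (E := E) h.1 j) ?_
    (fun y hy => h.2.2.2.1 j (List.mem_range.2 hj) _ (ofFn_mem_box hy)) x
  rw [searchBound]
  exact Nat.pow_le_pow_right (by norm_num) (Nat.pow_le_pow_right (by positivity) (by omega))

theorem Valid.solutionCheck (h : Valid D S c R E) {J : List ℕ}
    (hJ : J ∈ listsOf (List.range D.index) c.coeffs.length) (x : Fin (totalDim D c) → ℤ) :
    SolutionCheck D c R E J (List.ofFn x) := by
  refine HasKernel.forall_of_bounded (hasKernel_solutionCheck (S := S) h.1 h.2.1 J) ?_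
    (fun y hy => h.2.2.2.2 J hJ _ (ofFn_mem_box hy)) x
  rw [searchBound]
  exact Nat.pow_le_pow_right (by norm_num) (Nat.pow_le_pow_right (by positivity) (by omega))

end Kernel

end VirtAb

/-! ### Primitive recursive operations -/

section Primrec

variable {α β γ : Type*} [Primcodable α] [Primcodable β] [Primcodable γ]

namespace PrimrecPred

theorem exists_mem_comp {f : α → List β} {p : α → β → Prop} (hf : Primrec f)
    (hp : PrimrecPred fun q : α × β => p q.1 q.2) : PrimrecPred fun a => ∃ b ∈ f a, p a b :=
  (PrimrecRel.exists_mem_list (R := fun b a => p a b)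
    (hp.comp (Primrec.pair .snd .fst))).comp hf .id

theorem forall_mem_comp {f : α → List β} {p : α → β → Prop} (hf : Primrec f)
    (hp : PrimrecPred fun q : α × β => p q.1 q.2) : PrimrecPred fun a => ∀ b ∈ f a, p a b :=
  (PrimrecRel.forall_mem_list (R := fun b a => p a b)
    (hp.comp (Primrec.pair .snd .fst))).comp hf .id

theorem iff {p q : α → Prop} (hp : PrimrecPred p) (hq : PrimrecPred q) :
    PrimrecPred fun a => p a ↔ q a :=
  ((hp.and hq).or (hp.not.and hq.not)).of_eq fun _ => by tauto

theorem eq_comp {f g : α → β} (hf : Primrec f) (hg : Primrec g) :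
    PrimrecPred fun a => f a = g a :=
  Primrec.eq.comp hf hg

end PrimrecPred

namespace Primrec

theorem list_map_comp {f : α → List β} {g : α → β → γ} (hf : Primrec f)
    (hg : Primrec fun q : α × β => g q.1 q.2) : Primrec fun a => (f a).map (g a) :=
  Primrec.list_map hf (Primrec₂.mk hg)

theorem list_flatMap_comp {f : α → List β} {g : α → β → List γ} (hf : Primrec f)
    (hg : Primrec fun q : α × β => g q.1 q.2) : Primrec fun a => (f a).flatMap (g a) :=
  Primrec.list_flatMap hf (Primrec₂.mk hg)

theorem list_replicate {f : α → ℕ} {g : α → β} (hf : Primrec f) (hg : Primrec g) :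
    Primrec fun a => List.replicate (f a) (g a) :=
  (list_map_comp (g := fun a _ => g a) (Primrec.list_range.comp hf) (hg.comp .fst)).of_eq fun a => by
    simp [List.map_const']

theorem nat_pow_comp {f g : α → ℕ} (hf : Primrec f) (hg : Primrec g) :
    Primrec fun a => f a ^ g a :=
  Primrec₂.comp (Primrec₂.unpaired'.1 Nat.Primrec.pow) hf hg

theorem nat_add_comp {f g : α → ℕ} (hf : Primrec f) (hg : Primrec g) :
    Primrec fun a => f a + g a := nat_add.comp hf hg

theorem nat_mul_comp {f g : α → ℕ} (hf : Primrec f) (hg : Primrec g) :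
    Primrec fun a => f a * g a := nat_mul.comp hf hg

theorem list_append_comp {f g : α → List β} (hf : Primrec f) (hg : Primrec g) :
    Primrec fun a => f a ++ g a := list_append.comp hf hg

theorem list_cons_comp {f : α → β} {g : α → List β} (hf : Primrec f) (hg : Primrec g) :
    Primrec fun a => f a :: g a := list_cons.comp hf hg

theorem list_getD_comp {f : α → List β} {g : α → ℕ} (d : β) (hf : Primrec f) (hg : Primrec g) :
    Primrec fun a => (f a).getD (g a) d := (list_getD d).comp hf hg

theorem nat_list_sum : Primrec (List.sum : List ℕ → ℕ) :=
  list_foldr (h := fun _ p => p.1 + p.2) .id (const 0)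
    (Primrec₂.mk (nat_add_comp (fst.comp snd) (snd.comp snd)))

/-- The positive and the negative part of an integer, and the integer with given parts. -/
theorem int_natCast : Primrec (fun n : ℕ => (n : ℤ)) :=
  ((Primrec.ofNat ℤ).comp nat_double).of_eq fun n => by
    rw [← Denumerable.ofNat_encode (n : ℤ)]
    rfl

theorem int_negSucc : Primrec Int.negSucc :=
  ((Primrec.ofNat ℤ).comp nat_double_succ).of_eq fun n => by
    rw [← Denumerable.ofNat_encode (Int.negSucc n)]
    rfl

/-- Integers are coded by n ↦ 2n and -(n+1) ↦ 2n + 1. Positive and negative parts can thus be read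
off from the parity and the half of the code, and integer arithmetic reduces to natural numbers by
writing x as the difference of its parts. -/
theorem encode_natCast (n : ℕ) : Encodable.encode (n : ℤ) = 2 * n := rfl

theorem encode_negSucc (n : ℕ) : Encodable.encode (Int.negSucc n) = 2 * n + 1 := rfl

theorem int_toNat : Primrec Int.toNat :=
  (ite (Primrec.eq.comp (nat_mod.comp Primrec.encode (const 2)) (const 0))
    (nat_div.comp Primrec.encode (const 2)) (const 0)).of_eq fun x => by
      cases x with
      | ofNat n =>
        have := encode_natCast n
        simp only [Int.ofNat_eq_natCast, this]
        simp
      | negSucc n =>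
        rw [encode_negSucc]
        simp [Int.toNat]

theorem int_neg_toNat : Primrec fun x : ℤ => (-x).toNat :=
  (ite (Primrec.eq.comp (nat_mod.comp Primrec.encode (const 2)) (const 0))
    (const 0) (succ.comp (nat_div.comp Primrec.encode (const 2)))).of_eq fun x => by
      cases x with
      | ofNat n =>
        have := encode_natCast n
        simp only [Int.ofNat_eq_natCast, this]
        simp
      | negSucc n =>
        rw [encode_negSucc]
        have : (2 * n + 1) % 2 = 1 := by omega
        have h2 : (2 * n + 1) / 2 = n := by omega
        simp [this, h2, Int.neg_negSucc]

theorem int_sub_natCast {f g : α → ℕ} (hf : Primrec f) (hg : Primrec g) :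
    Primrec fun a => (f a : ℤ) - g a :=
  (ite (nat_le.comp hg hf) (int_natCast.comp (nat_sub.comp hf hg))
    (int_negSucc.comp (pred.comp (nat_sub.comp hg hf)))).of_eq fun a => by
      split_ifs with h
      · exact Nat.cast_sub h
      · simp only [Nat.pred_eq_sub_one, Int.negSucc_eq]
        omega

theorem int_add {f g : α → ℤ} (hf : Primrec f) (hg : Primrec g) : Primrec fun a => f a + g a :=
  (int_sub_natCast (nat_add_comp (int_toNat.comp hf) (int_toNat.comp hg))
    (nat_add_comp (int_neg_toNat.comp hf) (int_neg_toNat.comp hg))).of_eq fun a => by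
      push_cast
      omega

theorem int_sub {f g : α → ℤ} (hf : Primrec f) (hg : Primrec g) : Primrec fun a => f a - g a :=
  (int_sub_natCast (nat_add_comp (int_toNat.comp hf) (int_neg_toNat.comp hg))
    (nat_add_comp (int_neg_toNat.comp hf) (int_toNat.comp hg))).of_eq fun a => by
      push_cast
      omega

theorem int_mul {f g : α → ℤ} (hf : Primrec f) (hg : Primrec g) : Primrec fun a => f a * g a :=
  (int_sub_natCast
    (nat_add_comp (nat_mul_comp (int_toNat.comp hf) (int_toNat.comp hg))
      (nat_mul_comp (int_neg_toNat.comp hf) (int_neg_toNat.comp hg)))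
    (nat_add_comp (nat_mul_comp (int_toNat.comp hf) (int_neg_toNat.comp hg))
      (nat_mul_comp (int_neg_toNat.comp hf) (int_toNat.comp hg)))).of_eq fun a => by
      have h1 : f a = (f a).toNat - (-f a).toNat := by omega
      have h2 : g a = (g a).toNat - (-g a).toNat := by omega
      conv_rhs => rw [h1, h2]
      push_cast
      ring

theorem int_natAbs : Primrec Int.natAbs :=
  (nat_add_comp int_toNat int_neg_toNat).of_eq fun x => by omega

theorem int_list_sum : Primrec (List.sum : List ℤ → ℤ) :=
  list_foldr (h := fun _ p => p.1 + p.2) .id (const 0)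
    (Primrec₂.mk (int_add (fst.comp snd) (snd.comp snd)))

end Primrec

theorem PrimrecPred.int_le {f g : α → ℤ} (hf : Primrec f) (hg : Primrec g) :
    PrimrecPred fun a => f a ≤ g a :=
  (Primrec.nat_le.comp (Primrec.int_toNat.comp (Primrec.int_sub hf hg)) (.const 0)).of_eq
    fun a => by omega

end Primrec

/-! ### The check of certificates is primitive recursive -/

namespace VirtAb

open Primrec

variable {α : Type*} [Primcodable α]

theorem primrec_rank : Primrec Description.rank :=
  fst.comp (Primrec.of_equiv (e := descriptionEquiv))

theorem primrec_index : Primrec Description.index :=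
  fst.comp (snd.comp (Primrec.of_equiv (e := descriptionEquiv)))

theorem primrec_collect : Primrec Description.collect :=
  snd.comp (snd.comp (Primrec.of_equiv (e := descriptionEquiv)))

theorem primrec_coeffs : Primrec LengthConstraint.coeffs :=
  fst.comp (Primrec.of_equiv (e := lengthConstraintEquiv))

theorem primrec_bound : Primrec LengthConstraint.bound :=
  fst.comp (snd.comp (Primrec.of_equiv (e := lengthConstraintEquiv)))

theorem primrec_isEquation : Primrec LengthConstraint.isEquation :=
  snd.comp (snd.comp (Primrec.of_equiv (e := lengthConstraintEquiv)))

variable {d i j k n : α → ℕ} {u v x y : α → List ℤ} {D : α → Description} {S : α → WeightedGens}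
  {c : α → LengthConstraint} {R E : α → List IndexedLinear} {J : α → List ℕ}

theorem primrec_addVec (hd : Primrec d) (hu : Primrec u) (hv : Primrec v) :
    Primrec fun a => addVec (d a) (u a) (v a) :=
  list_map_comp (list_range.comp hd) (int_add (list_getD_comp 0 (hu.comp fst) snd)
    (list_getD_comp 0 (hv.comp fst) snd))

theorem primrec_subVec (hd : Primrec d) (hu : Primrec u) (hv : Primrec v) :
    Primrec fun a => subVec (d a) (u a) (v a) :=
  list_map_comp (list_range.comp hd) (int_sub (list_getD_comp 0 (hu.comp fst) snd)
    (list_getD_comp 0 (hv.comp fst) snd))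

theorem primrec_basisWord (hn : Primrec n) (hu : Primrec u) :
    Primrec fun a => basisWord (n a) (u a) := by
  have h : Primrec fun q : α × ℕ => (u q.1).getD q.2 0 := list_getD_comp 0 (hu.comp fst) snd
  exact list_flatMap_comp (list_range.comp hn) (list_replicate (int_natAbs.comp h)
    (pair (sumInl.comp snd) (PrimrecPred.int_le (const 0) h).decide))

theorem primrec_normalFormWord {w : α → NormalForm} (hn : Primrec n) (hw : Primrec w) :
    Primrec fun a => normalFormWord (n a) (w a) :=
  list_append_comp (primrec_basisWord hn (fst.comp hw))
    (list_cons_comp (pair (sumInr.comp (snd.comp hw)) (const true)) (const []))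

theorem primrec_product {x y : α → Letter} (hD : Primrec D) (hx : Primrec x) (hy : Primrec y) :
    Primrec fun a => (D a).product (x a) (y a) :=
  listLookup.comp (pair hx hy) (primrec_collect.comp hD)

theorem primrec_mulLetter {w : α → NormalForm} {y : α → Letter} (hD : Primrec D) (hw : Primrec w)
    (hy : Primrec y) : Primrec fun a => mulLetter (D a) (w a) (y a) :=
  option_getD.comp (option_map
    (primrec_product hD (pair (sumInr.comp (snd.comp hw)) (const true)) hy)
    (Primrec₂.mk (pair (primrec_addVec (primrec_rank.comp (hD.comp fst)) (fst.comp (hw.comp fst))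
      (fst.comp snd)) (snd.comp snd)))) hw

theorem primrec_transition {w : α → NormalForm} (hD : Primrec D) (hj : Primrec j)
    (hw : Primrec w) : Primrec fun a => transition (D a) (j a) (w a) :=
  list_foldl (h := fun a p => mulLetter (D a) p.1 p.2) (primrec_normalFormWord (primrec_rank.comp hD) hw) (pair (const []) hj)
    (Primrec₂.mk (primrec_mulLetter (hD.comp fst) (fst.comp snd) (snd.comp snd)))

theorem primrec_identityForm (hD : Primrec D) : Primrec fun a => identityForm (D a) :=
  option_getD.comp (primrec_product hD (const _) (const _)) (const _)

theorem primrec_shift {s : α → NormalForm × ℕ} (hD : Primrec D) (hj : Primrec j)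
    (hs : Primrec s) : Primrec fun a => shift (D a) (j a) (s a) :=
  list_cons_comp (int_natCast.comp (snd.comp hs))
    (fst.comp (primrec_transition hD hj (fst.comp hs)))

theorem primrec_listsOf {β : Type*} [Primcodable β] {A : α → List β} (hA : Primrec A)
    (hd : Primrec d) : Primrec fun a => listsOf (A a) (d a) :=
  nat_rec' (h := fun a p => (A a).flatMap fun b => p.2.map fun l => b :: l) hd (const [[]])
    (Primrec₂.mk (list_flatMap_comp (hA.comp fst)
      (list_map_comp (snd.comp (snd.comp fst)) (list_cons_comp (snd.comp fst) snd))))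

theorem primrec_box (hi : Primrec i) (hd : Primrec d) : Primrec fun a => box (i a) (d a) :=
  primrec_listsOf (list_map_comp
    (list_range.comp (nat_add_comp (nat_mul_comp (const 2) hi) (const 1)))
    (int_sub_natCast snd (hi.comp fst))) hd

theorem primrec_combination {w : α → List ℕ} {U : α → List (List ℤ)} (hw : Primrec w)
    (hU : Primrec U) (hi : Primrec i) : Primrec fun a => combination (w a) (U a) (i a) :=
  int_list_sum.comp (list_map_comp (list_range.comp (list_length.comp hU))
    (int_mul (int_natCast.comp (list_getD_comp 0 (hw.comp fst) snd))
      (list_getD_comp 0 (list_getD_comp [] (hU.comp fst) snd) (hi.comp fst))))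

theorem primrecPred_boundedMem (hd : Primrec d) (hE : Primrec E) (hJ : Primrec J)
    (hx : Primrec x) : PrimrecPred fun a => BoundedMem (d a) (E a) (J a) (x a) := by
  refine PrimrecPred.exists_mem_comp hE ((PrimrecPred.eq_comp (fst.comp snd) (hJ.comp fst)).and
    (PrimrecPred.exists_mem_comp (primrec_listsOf (list_range.comp (nat_add_comp (int_toNat.comp
      (list_getD_comp 0 (hx.comp fst) (const 0))) (const 1)))
      (list_length.comp (snd.comp (snd.comp snd))))
      (PrimrecPred.forall_mem_comp (list_range.comp (hd.comp (fst.comp fst)))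
        (PrimrecPred.eq_comp (list_getD_comp 0 (hx.comp (fst.comp (fst.comp fst))) snd)
          (int_add (list_getD_comp 0 (fst.comp (snd.comp (snd.comp (fst.comp fst)))) snd)
            (primrec_combination (snd.comp fst) (snd.comp (snd.comp (snd.comp (fst.comp fst))))
              snd))))))

theorem primrecPred_positive (hE : Primrec E) : PrimrecPred fun a => Positive (E a) :=
  PrimrecPred.forall_mem_comp hE ((PrimrecPred.int_le (const 0)
    (list_getD_comp 0 (fst.comp (snd.comp snd)) (const 0))).and
      (PrimrecPred.forall_mem_comp (snd.comp (snd.comp snd))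
        (PrimrecPred.int_le (const 1) (list_getD_comp 0 snd (const 0)))))

theorem primrec_listNorm (hu : Primrec u) : Primrec fun a => listNorm (u a) :=
  nat_list_sum.comp (list_map_comp hu (int_natAbs.comp snd))

theorem primrec_exprNorm (hE : Primrec E) : Primrec fun a => exprNorm (E a) :=
  nat_list_sum.comp (list_map_comp hE (nat_add_comp (primrec_listNorm (fst.comp (snd.comp snd)))
    (nat_list_sum.comp (list_map_comp (snd.comp (snd.comp snd)) (primrec_listNorm snd)))))

theorem primrec_position (hn : Primrec n) (hi : Primrec i) (hk : Primrec k) :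
    Primrec fun a => position (n a) (i a) (k a) :=
  nat_add_comp (nat_add_comp (nat_mul_comp hi (nat_add_comp hn (const 1))) hk) (const 1)

theorem primrec_block (hn : Primrec n) (hi : Primrec i) (hx : Primrec x) :
    Primrec fun a => block (n a) (i a) (x a) :=
  list_map_comp (list_range.comp (nat_add_comp hn (const 1)))
    (list_getD_comp 0 (hx.comp fst) (primrec_position (hn.comp fst) (hi.comp fst) snd))

theorem primrec_totalLength (hn : Primrec n) (hk : Primrec k) (hx : Primrec x) :
    Primrec fun a => totalLength (n a) (k a) (x a) :=
  int_list_sum.comp (list_map_comp (list_range.comp hk)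
    (list_getD_comp 0 (hx.comp fst) (primrec_position (hn.comp fst) snd (const 0))))

theorem primrec_numCoeffs (hc : Primrec c) : Primrec fun a => (c a).coeffs.length :=
  list_length.comp (primrec_coeffs.comp hc)

theorem primrec_lengthSum (hc : Primrec c) (hn : Primrec n) (hx : Primrec x) :
    Primrec fun a => (c a).lengthSum (n a) (x a) :=
  int_list_sum.comp (list_map_comp (list_range.comp (primrec_numCoeffs hc))
    (int_mul (list_getD_comp 0 (primrec_coeffs.comp (hc.comp fst)) snd)
      (list_getD_comp 0 (hx.comp fst) (primrec_position (hn.comp fst) snd (const 0)))))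

theorem primrecPred_holds {s : α → ℤ} (hc : Primrec c) (hs : Primrec s) :
    PrimrecPred fun a => (c a).Holds (s a) :=
  ((PrimrecPred.eq_comp (primrec_isEquation.comp hc) (const true)).and
    (PrimrecPred.eq_comp hs (primrec_bound.comp hc))).or
  ((PrimrecPred.eq_comp (primrec_isEquation.comp hc) (const false)).and
    (PrimrecPred.int_le hs (primrec_bound.comp hc)))

theorem primrec_totalDim (hD : Primrec D) (hc : Primrec c) :
    Primrec fun a => totalDim (D a) (c a) :=
  nat_add_comp (nat_mul_comp (primrec_numCoeffs hc)
    (nat_add_comp (primrec_rank.comp hD) (const 1))) (const 1)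

theorem primrecPred_lengthCheck (hD : Primrec D) (hS : Primrec S) (hR : Primrec R)
    (hj : Primrec j) (hx : Primrec x) :
    PrimrecPred fun a => LengthCheck (D a) (S a) (R a) (j a) (x a) := by
  have hn : Primrec fun a => (D a).rank + 1 := nat_add_comp (primrec_rank.comp hD) (const 1)
  have hid := primrec_identityForm hD
  refine (primrecPred_boundedMem hn hR (list_cons_comp hj (const [])) hx).iff
    (((PrimrecPred.int_le (const 0) (list_getD_comp 0 hx (const 0))).and
      ((PrimrecPred.eq_comp (snd.comp hid) hj).and
        (PrimrecPred.forall_mem_comp (list_range.comp (primrec_rank.comp hD))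
          (PrimrecPred.eq_comp (list_getD_comp 0 (hx.comp fst) (nat_add_comp snd (const 1)))
            (list_getD_comp 0 (fst.comp (hid.comp fst)) snd))))).or
      (PrimrecPred.exists_mem_comp (list_range.comp (primrec_index.comp hD))
        (PrimrecPred.exists_mem_comp (hS.comp fst) ?_)))
  have hD' := hD.comp (fst.comp (fst (α := α × ℕ) (β := NormalForm × ℕ)))
  have hj' := (snd (α := α) (β := ℕ)).comp (fst (α := α × ℕ) (β := NormalForm × ℕ))
  have hn' := hn.comp (fst.comp (fst (α := α × ℕ) (β := NormalForm × ℕ)))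
  exact (PrimrecPred.eq_comp (snd.comp (primrec_transition hD' hj' (fst.comp snd)))
    (hj.comp (fst.comp fst))).and (primrecPred_boundedMem hn' (hR.comp (fst.comp fst))
      (list_cons_comp hj' (const [])) (primrec_subVec hn' (hx.comp (fst.comp fst))
        (primrec_shift hD' hj' snd)))

theorem primrecPred_solutionCheck (hD : Primrec D) (hc : Primrec c) (hR : Primrec R)
    (hE : Primrec E) (hJ : Primrec J) (hx : Primrec x) :
    PrimrecPred fun a => SolutionCheck (D a) (c a) (R a) (E a) (J a) (x a) := by
  have hn := primrec_rank.comp hD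
  have hn1 : Primrec fun a => (D a).rank + 1 := nat_add_comp hn (const 1)
  have hk := primrec_numCoeffs hc
  have hJ' : Primrec fun q : α × ℕ => [(J q.1).getD q.2 0] :=
    list_cons_comp (list_getD_comp 0 (hJ.comp fst) snd) (const [])
  have hb : Primrec fun q : α × ℕ => block (D q.1).rank q.2 (x q.1) :=
    primrec_block (hn.comp fst) snd (hx.comp fst)
  exact (primrecPred_boundedMem (primrec_totalDim hD hc) hE hJ hx).iff
    ((PrimrecPred.eq_comp (list_getD_comp 0 hx (const 0)) (primrec_totalLength hn hk hx)).and
      ((PrimrecPred.forall_mem_comp (list_range.comp hk)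
        ((primrecPred_boundedMem (hn1.comp fst) (hR.comp fst) hJ' hb).and
          (primrecPred_boundedMem (hn1.comp fst) (hR.comp fst) hJ'
            (primrec_subVec (hn1.comp fst) hb (const [1]))).not)).and
        (primrecPred_holds hc (primrec_lengthSum hc hn hx))))

theorem primrec_normBound (hD : Primrec D) (hS : Primrec S) (hc : Primrec c) (hR : Primrec R)
    (hE : Primrec E) : Primrec fun a => normBound (D a) (S a) (c a) (R a) (E a) :=
  nat_add_comp (nat_add_comp (nat_add_comp (nat_add_comp (nat_add_comp (nat_add_comp (nat_add_comp
    (primrec_numCoeffs hc) (primrec_listNorm (primrec_coeffs.comp hc)))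
    (int_natAbs.comp (primrec_bound.comp hc)))
    (primrec_listNorm (fst.comp (primrec_identityForm hD))))
    (primrec_exprNorm hR)) (primrec_exprNorm hE))
    (nat_list_sum.comp (list_map_comp (list_range.comp (primrec_index.comp hD))
      (nat_list_sum.comp (list_map_comp (hS.comp fst)
        (primrec_listNorm (primrec_shift (hD.comp (fst.comp fst)) (snd.comp fst) snd)))))))
    (const 2)

theorem primrec_searchBound (hD : Primrec D) (hS : Primrec S) (hc : Primrec c) (hR : Primrec R)
    (hE : Primrec E) : Primrec fun a => searchBound (D a) (S a) (c a) (R a) (E a) :=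
  nat_pow_comp (const 2) (nat_pow_comp (nat_pow_comp (const 2) (nat_pow_comp
    (nat_add_comp (nat_mul_comp (const 2) (primrec_normBound hD hS hc hR hE)) (const 1))
    (nat_add_comp (nat_add_comp (primrec_totalDim hD hc) (primrec_rank.comp hD)) (const 1))))
    (nat_add_comp (nat_add_comp (nat_add_comp (nat_add_comp (nat_add_comp
      (list_length.comp hR) (const 1))
      (nat_mul_comp (nat_mul_comp (list_length.comp hR) (list_length.comp hS))
        (primrec_index.comp hD))) (list_length.comp hE)) (const 2))
      (nat_mul_comp (nat_mul_comp (const 2) (list_length.comp hR)) (primrec_numCoeffs hc))))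

/-- All quantifiers are bounded by computable lists: coefficients by the weight of the vector,
vectors by the explicit search bound. -/
theorem primrecPred_valid (hD : Primrec D) (hS : Primrec S) (hc : Primrec c) (hR : Primrec R)
    (hE : Primrec E) : PrimrecPred fun a => Valid (D a) (S a) (c a) (R a) (E a) := by
  have hJ : Primrec fun a => listsOf (List.range (D a).index) (c a).coeffs.length :=
    primrec_listsOf (list_range.comp (primrec_index.comp hD)) (primrec_numCoeffs hc)
  have hB := primrec_searchBound hD hS hc hR hE
  refine (primrecPred_positive hR).and ((primrecPred_positive hE).and
    ((PrimrecPred.forall_mem_comp hE ?_).and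
    ((PrimrecPred.forall_mem_comp (list_range.comp (primrec_index.comp hD))
      (PrimrecPred.forall_mem_comp (primrec_box (hB.comp fst)
        (nat_add_comp (primrec_rank.comp (hD.comp fst)) (const 1)))
        (primrecPred_lengthCheck (hD.comp (fst.comp fst)) (hS.comp (fst.comp fst))
          (hR.comp (fst.comp fst)) (snd.comp fst) snd))).and
    (PrimrecPred.forall_mem_comp hJ
      (PrimrecPred.forall_mem_comp (primrec_box (hB.comp fst)
        (primrec_totalDim (hD.comp fst) (hc.comp fst)))
        (primrecPred_solutionCheck (hD.comp (fst.comp fst)) (hc.comp (fst.comp fst))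
          (hR.comp (fst.comp fst)) (hE.comp (fst.comp fst)) (snd.comp fst) snd))))))
  exact (PrimrecPred.exists_mem_comp (p := fun q l => l = q.2.1) (hJ.comp fst)
    (PrimrecPred.eq_comp snd (fst.comp (snd.comp fst)))).of_eq fun q => by simp

end VirtAb

/-! ### Semilinear expressions from certificates -/

namespace VirtAb

/-- The word over the alphabet of `G^k` with the word `f i` in coordinate `i`. -/
def tupleWord (k : ℕ) (f : ℕ → List Letter) : List TupleLetter :=
  (List.range k).flatMap fun i => (f i).map fun x => (i, x)

/-- The word for `b^{a_i} t_{J_i}` in each coordinate `i`, where `a_i` are the exponents in `p`. -/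
def baseWord (n k : ℕ) (J : List ℕ) (p : List ℤ) : List TupleLetter :=
  tupleWord k fun i => normalFormWord n ((block n i p).tail, J.getD i 0)

/-- The word for the conjugate of `b^{a_i}` by `t_{J_i}` in each coordinate `i`, where `a_i` are the
exponents in `u`. -/
def periodWord (n k : ℕ) (J : List ℕ) (u : List ℤ) : List TupleLetter :=
  tupleWord k fun i =>
    (Sum.inr (J.getD i 0), false) :: normalFormWord n ((block n i u).tail, J.getD i 0)

/-- The semilinear expression in the group given by linear sets in coordinates. -/
def toSemilinearExpr (n k : ℕ) (E : List IndexedLinear) : SemilinearExpr :=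
  E.map fun e => (baseWord n k e.1 e.2.1, e.2.2.map fun u => periodWord n k e.1 u)

section Primrec

open Primrec

variable {α : Type*} [Primcodable α] {n k : α → ℕ}

theorem primrec_tupleWord {f : α → ℕ → List Letter} (hk : Primrec k)
    (hf : Primrec fun q : α × ℕ => f q.1 q.2) : Primrec fun a => tupleWord (k a) (f a) :=
  list_flatMap_comp (list_range.comp hk) (list_map_comp hf (pair (snd.comp fst) snd))

theorem primrec_coordWord {J : α → List ℕ} {p : α → List ℤ} (hn : Primrec n) (hJ : Primrec J)
    (hp : Primrec p) : Primrec fun q : α × ℕ =>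
      normalFormWord (n q.1) ((block (n q.1) q.2 (p q.1)).tail, (J q.1).getD q.2 0) := by
  have h1 : Primrec fun q : α × ℕ => block (n q.1) q.2 (p q.1) :=
    primrec_block (hn.comp fst) snd (hp.comp fst)
  have h2 : Primrec fun q : α × ℕ => (J q.1).getD q.2 0 :=
    list_getD_comp 0 (hJ.comp fst) snd
  exact primrec_normalFormWord (hn.comp fst) (pair (list_tail.comp h1) h2)

theorem primrec_baseWord {J : α → List ℕ} {p : α → List ℤ} (hn : Primrec n) (hk : Primrec k)
    (hJ : Primrec J) (hp : Primrec p) : Primrec fun a => baseWord (n a) (k a) (J a) (p a) :=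
  primrec_tupleWord hk (primrec_coordWord hn hJ hp)

theorem primrec_periodWord {J : α → List ℕ} {u : α → List ℤ} (hn : Primrec n) (hk : Primrec k)
    (hJ : Primrec J) (hu : Primrec u) : Primrec fun a => periodWord (n a) (k a) (J a) (u a) := by
  have h1 : Primrec fun q : α × ℕ => ((Sum.inr ((J q.1).getD q.2 0), false) : Letter) :=
    pair (sumInr.comp (list_getD_comp 0 (hJ.comp fst) snd)) (const false)
  exact primrec_tupleWord hk (list_cons_comp h1 (primrec_coordWord hn hJ hu))

theorem primrec_toSemilinearExpr {E : α → List IndexedLinear} (hn : Primrec n) (hk : Primrec k)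
    (hE : Primrec E) : Primrec fun a => toSemilinearExpr (n a) (k a) (E a) := by
  have h1 : Primrec fun q : α × IndexedLinear => baseWord (n q.1) (k q.1) q.2.1 q.2.2.1 :=
    primrec_baseWord (hn.comp fst) (hk.comp fst) (fst.comp snd) (fst.comp (snd.comp snd))
  have h2 : Primrec fun q : (α × IndexedLinear) × List ℤ =>
      periodWord (n q.1.1) (k q.1.1) q.1.2.1 q.2 :=
    primrec_periodWord (hn.comp (fst.comp fst)) (hk.comp (fst.comp fst))
      (fst.comp (snd.comp fst)) snd
  have h3 : Primrec fun q : α × IndexedLinear => q.2.2.2 := snd.comp (snd.comp snd)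
  exact list_map_comp hE (pair h1 (list_map_comp h3 h2))

end Primrec

theorem inRange_tupleWord {n m k : ℕ} {f : ℕ → List Letter}
    (hf : ∀ i < k, ∀ x ∈ f i, Letter.InRange n m x) :
    ∀ x ∈ tupleWord k f, x.1 < k ∧ Letter.InRange n m x.2 := by
  intro x hx
  simp only [tupleWord, List.mem_flatMap, List.mem_range, List.mem_map] at hx
  obtain ⟨i, hi, y, hy, rfl⟩ := hx
  exact ⟨hi, hf i hi y hy⟩

theorem inRange_toSemilinearExpr {n m k : ℕ} {E : List IndexedLinear}
    (hE : ∀ e ∈ E, e.1 ∈ listsOf (List.range m) k) :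
    SemilinearExpr.InRange n m k (toSemilinearExpr n k E) := by
  intro p hp w hw
  obtain ⟨e, he, rfl⟩ := List.mem_map.1 hp
  have hJ : ∀ i < k, e.1.getD i 0 < m := by
    intro i hi
    obtain ⟨h1, h2⟩ := mem_listsOf.1 (hE e he)
    rw [List.getD_eq_getElem _ _ (by omega)]
    exact List.mem_range.1 (h2 _ (List.getElem_mem _))
  rcases List.mem_cons.1 hw with rfl | hw
  · exact inRange_tupleWord fun i hi => inRange_normalFormWord _ (hJ i hi)
  · obtain ⟨u, _, rfl⟩ := List.mem_map.1 hw
    refine inRange_tupleWord fun i hi x hx => ?_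
    rcases List.mem_cons.1 hx with rfl | hx
    · exact hJ i hi
    · exact inRange_normalFormWord _ (hJ i hi) x hx

section Value

variable {G : Type*} [Group G] {n m : ℕ} {b : Fin n → G} {t : Fin m → G}

/-- Coordinate i sees only the segment of the word with index i, since all other letters are 1
there. -/
theorem tupleWordValue_tupleWord {k : ℕ} (f : ℕ → List Letter) :
    tupleWordValue b t k (tupleWord k f) =
      fun i : Fin k => ((f i).map (letterValue b t)).prod := by
  ext i
  have h1 : ∀ l : ℕ, (((f l).map fun x => (l, x)).map (tupleLetterValue b t k)).prod i =
      if (i : ℕ) = l then ((f l).map (letterValue b t)).prod else 1 := by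
    intro l
    have h : ∀ L : List (Fin k → G), L.prod i = (L.map fun g => g i).prod := fun L =>
      map_list_prod (Pi.evalMonoidHom (fun _ : Fin k => G) i) L
    rw [h, List.map_map, List.map_map]
    split_ifs with h
    · congr 1
      exact List.map_congr_left fun x _ => by simp [tupleLetterValue, h]
    · rw [List.map_congr_left (g := fun _ => 1) fun x _ => by simp [tupleLetterValue, h]]
      simp
  have h2 : ∀ N : ℕ, (((List.range N).flatMap fun l => (f l).map fun x => (l, x)).map
      (tupleLetterValue b t k)).prod i =
      if (i : ℕ) < N then ((f i).map (letterValue b t)).prod else 1 := by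
    intro N
    induction N with
    | zero => simp
    | succ N ih =>
      rw [List.range_succ, List.flatMap_append, List.map_append, List.prod_append, Pi.mul_apply, ih,
        List.flatMap_cons, List.flatMap_nil, List.append_nil, h1]
      rcases lt_trichotomy (i : ℕ) N with h | h | h
      · rw [if_pos h, if_neg h.ne, if_pos (by omega), mul_one]
      · rw [if_neg (by omega), if_pos h, if_pos (by omega), one_mul, h]
      · rw [if_neg (by omega), if_neg (by omega), if_neg (by omega), one_mul]
  exact (h2 k).trans (if_pos i.2)

theorem wordRegex_matches {κ : Type*} (u : List κ) :
    (wordRegex u).matches' = (show Language κ from ({u} : Set (List κ))) := by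
  induction u with
  | nil => rfl
  | cons a u ih =>
    have h : wordRegex (a :: u) = RegularExpression.char a * wordRegex u := rfl
    rw [h, RegularExpression.matches'_mul, ih]
    ext w
    rw [Language.mem_mul]
    constructor
    · rintro ⟨_, rfl, _, rfl, rfl⟩
      rfl
    · rintro rfl
      exact ⟨[a], rfl, u, rfl, rfl⟩

theorem mem_matches_sum {κ : Type*} (l : List (RegularExpression κ)) (w : List κ) :
    w ∈ l.sum.matches' ↔ ∃ r ∈ l, w ∈ r.matches' := by
  induction l with
  | nil => simp [RegularExpression.matches'_zero, Language.notMem_zero]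
  | cons r l ih =>
    rw [List.sum_cons, RegularExpression.matches'_add, Language.mem_add, ih]
    simp

theorem toRegex_value (k : ℕ) (E : SemilinearExpr) :
    {g | ∃ u ∈ (SemilinearExpr.toRegex E).matches', tupleWordValue b t k u = g} =
      SemilinearExpr.value b t k E := by
  ext g
  simp only [SemilinearExpr.toRegex, SemilinearExpr.value, mem_matches_sum, List.mem_map]
  constructor
  · rintro ⟨u, ⟨_, ⟨p, hp, rfl⟩, hu⟩, rfl⟩
    rw [RegularExpression.matches'_mul, Language.mem_mul, wordRegex_matches,
      RegularExpression.matches'_star] at hu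
    obtain ⟨_, rfl, v, hv, rfl⟩ := hu
    obtain ⟨L, rfl, hL⟩ := Language.mem_kstar.1 hv
    refine ⟨p, hp, (L.map (tupleWordValue b t k)).prod, ?_, ?_⟩
    · refine Submonoid.list_prod_mem _ fun y hy => ?_
      obtain ⟨v, hv, rfl⟩ := List.mem_map.1 hy
      obtain ⟨r, hr, hv⟩ := (mem_matches_sum _ _).1 (hL v hv)
      obtain ⟨w, hw, rfl⟩ := List.mem_map.1 hr
      rw [wordRegex_matches] at hv
      obtain rfl := hv
      exact Submonoid.subset_closure ⟨_, hw, rfl⟩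
    · simp [tupleWordValue, List.map_flatten, List.prod_flatten, Function.comp_def]
      rfl
  · rintro ⟨p, hp, h, hh, rfl⟩
    obtain ⟨l, hl, rfl⟩ := Submonoid.exists_list_of_mem_closure hh
    obtain ⟨L, rfl, hL⟩ : ∃ L : List (List TupleLetter), L.map (tupleWordValue b t k) = l ∧
        ∀ v ∈ L, v ∈ p.2 := by
      clear hh
      induction l with
      | nil => exact ⟨[], rfl, by simp⟩
      | cons x l ih =>
        obtain ⟨L, rfl, hL⟩ := ih fun y hy => hl y (by simp [hy])
        obtain ⟨v, hv, rfl⟩ := hl x (by simp)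
        exact ⟨v :: L, rfl, by
          intro w hw
          rcases List.mem_cons.1 hw with rfl | hw
          exacts [hv, hL w hw]⟩
    refine ⟨p.1 ++ L.flatten, ⟨_, ⟨p, hp, rfl⟩, ?_⟩, ?_⟩
    · rw [RegularExpression.matches'_mul, Language.mem_mul, wordRegex_matches,
        RegularExpression.matches'_star]
      refine ⟨p.1, rfl, L.flatten, Language.mem_kstar.2 ⟨L, rfl, fun v hv => ?_⟩, rfl⟩
      refine (mem_matches_sum _ _).2 ⟨_, List.mem_map.2 ⟨v, hL v hv, rfl⟩, ?_⟩
      rw [wordRegex_matches]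
      rfl
    · simp [tupleWordValue, List.map_flatten, List.prod_flatten, Function.comp_def]
      rfl

/-- The tuple with exponents given by the blocks of `x` and transversal elements given by `J`. -/
def tupleOf (b : Fin n → G) (t : Fin m → G) (k : ℕ) {d : ℕ} (J : List ℕ) (x : Fin d → ℤ) :
    Fin k → G :=
  fun i => basisProd b (Fin.tail (blockHom d n i x)) * entry t (J.getD i 0)

/-- With t the transversal element of a coordinate, b^{p+y} t = b^p t · (t⁻¹ b^y t). The map `ψ J`
sends y to the tuple of these conjugates. Being a homomorphism, it carries the submonoid generated
by the periods to the one generated by the period words. The hypothesis `hd` places all blocks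
inside the vector. -/
theorem value_toSemilinearExpr {k d : ℕ} (hb : ∀ i j, b i * b j = b j * b i)
    (hd : k * (n + 1) < d) (E : List IndexedLinear) (g : Fin k → G) :
    g ∈ SemilinearExpr.value b t k (toSemilinearExpr n k E) ↔
      ∃ J x, Mem d E J x ∧ g = tupleOf b t k J x := by
  have hblock : ∀ (l : List ℤ) (i : Fin k),
      vec n (block n i l).tail = Fin.tail (blockHom d n i (vec d l)) := by
    intro l i
    ext j
    have hlt : position n i (j + 1) < d := by
      have h1 : (i : ℕ) * (n + 1) + (n + 1) ≤ k * (n + 1) := by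
        rw [← Nat.succ_mul]
        exact Nat.mul_le_mul_right _ i.2
      have := j.2
      simp only [position]
      omega
    simp [vec, Fin.tail, blockHom, coordHom, hlt, block]
  let ψ (J : List ℕ) : Multiplicative (Fin d → ℤ) →* (Fin k → G) :=
    { toFun := fun x i => (entry t (J.getD i 0))⁻¹ *
        basisProd b (Fin.tail (blockHom d n i x.toAdd)) * entry t (J.getD i 0)
      map_one' := by
        ext i
        have : Fin.tail (blockHom d n i (Multiplicative.toAdd 1)) = 0 := by
          rw [toAdd_one, map_zero]
          rfl
        rw [this, basisProd_zero]
        simp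
      map_mul' := by
        intro x y
        ext i
        have : Fin.tail (blockHom d n i (x * y).toAdd) =
            Fin.tail (blockHom d n i x.toAdd) + Fin.tail (blockHom d n i y.toAdd) := by
          rw [toAdd_mul, map_add]
          rfl
        rw [this, basisProd_add hb]
        simp [mul_assoc] }
  have hbase : ∀ (J : List ℕ) (p : List ℤ),
      tupleWordValue b t k (baseWord n k J p) = tupleOf b t k J (vec d p) := by
    intro J p
    rw [baseWord, tupleWordValue_tupleWord]
    ext i
    rw [prod_normalFormWord]
    change basisProd b (vec n _) * _ = _
    rw [hblock]
    rfl
  have hperiod : ∀ (J : List ℕ) (u : List ℤ),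
      tupleWordValue b t k (periodWord n k J u) = ψ J (.ofAdd (vec d u)) := by
    intro J u
    rw [periodWord, tupleWordValue_tupleWord]
    ext i
    rw [List.map_cons, List.prod_cons, prod_normalFormWord]
    change _ * (basisProd b (vec n _) * _) = _
    rw [hblock, ← mul_assoc]
    rfl
  have hmul : ∀ (J : List ℕ) (p y : Fin d → ℤ),
      tupleOf b t k J (p + y) = tupleOf b t k J p * ψ J (.ofAdd y) := by
    intro J p y
    ext i
    have : Fin.tail (blockHom d n i (p + y)) =
        Fin.tail (blockHom d n i p) + Fin.tail (blockHom d n i y) := by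
      rw [map_add]
      rfl
    change basisProd b (Fin.tail (blockHom d n i (p + y))) * entry t (J.getD i 0) =
      basisProd b (Fin.tail (blockHom d n i p)) * entry t (J.getD i 0) *
        ((entry t (J.getD i 0))⁻¹ * basisProd b (Fin.tail (blockHom d n i y)) *
          entry t (J.getD i 0))
    rw [this, basisProd_add hb]
    group
  have hcl : ∀ e : IndexedLinear, Submonoid.closure (tupleWordValue b t k ''
      {v | v ∈ e.2.2.map fun u => periodWord n k e.1 u}) =
      (AddSubmonoid.toSubmonoid (AddSubmonoid.closure
        (Set.range fun l : Fin e.2.2.length => vec d (e.2.2.get l)))).map (ψ e.1) := by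
    intro e
    rw [AddSubmonoid.toSubmonoid_closure, MonoidHom.map_mclosure]
    congr 1
    ext h
    simp only [Set.mem_image, List.mem_map]
    constructor
    · rintro ⟨_, ⟨u, hu, rfl⟩, rfl⟩
      obtain ⟨l, rfl⟩ := List.get_of_mem hu
      exact ⟨.ofAdd (vec d (e.2.2.get l)), ⟨l, rfl⟩, (hperiod _ _).symm⟩
    · rintro ⟨_, ⟨l, hl⟩, rfl⟩
      refine ⟨_, ⟨_, List.get_mem _ l, rfl⟩, ?_⟩
      rw [hperiod]
      congr 1
  constructor
  · rintro ⟨_, hp, h, hh, rfl⟩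
    obtain ⟨e, he, rfl⟩ := List.mem_map.1 hp
    rw [hcl] at hh
    obtain ⟨y, hy, rfl⟩ := hh
    refine ⟨e.1, vec d e.2.1 + y.toAdd, ⟨e, he, rfl, (inLinear_iff _ _ _).2 ⟨_, hy, rfl⟩⟩, ?_⟩
    rw [hmul, hbase]
    rfl
  · rintro ⟨J, x, ⟨e, he, rfl, hx⟩, rfl⟩
    obtain ⟨y, hy, rfl⟩ := (inLinear_iff _ _ _).1 hx
    refine ⟨_, List.mem_map.2 ⟨e, he, rfl⟩, ψ e.1 (.ofAdd y), ?_, ?_⟩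
    · rw [hcl]
      exact ⟨_, hy, rfl⟩
    · rw [hmul, hbase]

end Value

end VirtAb

/-! ### Valid certificates: correctness and existence -/

namespace VirtAb

/-! ### Vectors assembled from a total weight and blocks -/

section Blocks

variable {n k : ℕ}

theorem position_lt {i l : ℕ} (hi : i < k) (hl : l < n + 1) :
    position n i l < k * (n + 1) + 1 := by
  have h1 : (i + 1) * (n + 1) ≤ k * (n + 1) := Nat.mul_le_mul_right _ hi
  rw [Nat.succ_mul] at h1
  simp only [position]
  omega

theorem blockHom_apply (i : Fin k) (l : Fin (n + 1)) (x : Fin (k * (n + 1) + 1) → ℤ) :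
    blockHom _ n i x l = x ⟨position n i l, position_lt i.2 l.2⟩ := by
  rw [blockHom, AddMonoidHom.pi_apply, coordHom, dif_pos (position_lt i.2 l.2)]
  rfl

/-- After the leading weight, division with remainder of a - 1 by n + 1 gives the block and the
place in it. -/
theorem exists_blockHom_eq (T : ℤ) (y : Fin k → Fin (n + 1) → ℤ) :
    ∃ x : Fin (k * (n + 1) + 1) → ℤ, x 0 = T ∧ ∀ i : Fin k, blockHom _ n i x = y i := by
  refine ⟨fun a => if (a : ℕ) = 0 then T else
    if h : ((a : ℕ) - 1) / (n + 1) < k then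
      y ⟨_, h⟩ ⟨((a : ℕ) - 1) % (n + 1), Nat.mod_lt _ n.succ_pos⟩ else 0, by simp, ?_⟩
  intro i
  ext l
  rw [blockHom_apply]
  have h0 : position n i l ≠ 0 := by simp [position]
  have h1 : (position n i l - 1) / (n + 1) = i := by
    rw [position, Nat.add_sub_cancel, mul_comm, Nat.mul_add_div n.succ_pos,
      Nat.div_eq_of_lt l.2, add_zero]
  have h2 : (position n i l - 1) % (n + 1) = l := by
    rw [position, Nat.add_sub_cancel, mul_comm, Nat.mul_add_mod, Nat.mod_eq_of_lt l.2]
  simp only [h0, if_false, h1, h2, i.2, dif_pos]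

theorem ext_blockHom {x x' : Fin (k * (n + 1) + 1) → ℤ} (h0 : x 0 = x' 0)
    (h : ∀ i : Fin k, blockHom _ n i x = blockHom _ n i x') : x = x' := by
  ext a
  rcases Nat.eq_zero_or_pos (a : ℕ) with ha | ha
  · have : a = 0 := Fin.ext ha
    rw [this, h0]
  · have h1 : ((a : ℕ) - 1) / (n + 1) < k := by
      rw [Nat.div_lt_iff_lt_mul (show 0 < n + 1 from n.succ_pos)]
      have := a.2
      omega
    have h2 := congrFun (h ⟨_, h1⟩) ⟨((a : ℕ) - 1) % (n + 1), Nat.mod_lt _ n.succ_pos⟩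
    rw [blockHom_apply, blockHom_apply] at h2
    have h3 : position n (((a : ℕ) - 1) / (n + 1)) (((a : ℕ) - 1) % (n + 1)) = a := by
      rw [position, mul_comm, Nat.div_add_mod]
      omega
    have h4 : ∀ h, (⟨position n (((a : ℕ) - 1) / (n + 1)) (((a : ℕ) - 1) % (n + 1)), h⟩ :
        Fin (k * (n + 1) + 1)) = a := fun _ => Fin.ext h3
    simpa only [h4] using h2

end Blocks

/-! ### Solutions of a constraint in coordinates, and soundness of certificates -/

section Solutions

variable {D : Description} {S : WeightedGens} {c : LengthConstraint} {G : Type*} [Group G]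
  {b : Fin D.rank → G} {t : Fin D.index → G}

theorem tupleOf_apply {k : ℕ} {J : List ℕ} (hJ : J ∈ listsOf (List.range D.index) k) {d : ℕ}
    (x : Fin d → ℤ) (i : Fin k) : ∃ h : J.getD i 0 < D.index,
      tupleOf b t k J x i = basisProd b (Fin.tail (blockHom d D.rank i x)) * t ⟨J.getD i 0, h⟩ := by
  obtain ⟨h1, h2⟩ := mem_listsOf.1 hJ
  have h : J.getD i 0 < D.index := by
    rw [List.getD_eq_getElem _ _ (by omega)]
    exact List.mem_range.1 (h2 _ (List.getElem_mem _))
  exact ⟨h, by simp only [tupleOf, entry, h, dif_pos]⟩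

/-- The vectors that encode solutions of `c` in the cosets given by `J`: exponents of the
coordinates of the solution, their lengths, and the sum of the lengths. -/
def solutionVectors (c : LengthConstraint) (len : G → ℕ) (b : Fin D.rank → G)
    (t : Fin D.index → G) (J : List ℕ) : Set (Fin (totalDim D c) → ℤ) :=
  {x | tupleOf b t c.coeffs.length J x ∈ c.solutions len ∧
    (∀ i : Fin c.coeffs.length, blockHom (totalDim D c) D.rank i x 0 =
      len (tupleOf b t c.coeffs.length J x i)) ∧
    coordHom (totalDim D c) 0 x =
      ∑ i : Fin c.coeffs.length, blockHom (totalDim D c) D.rank i x 0}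

theorem mem_solutions_iff {H : Type*} (c : LengthConstraint) (len : H → ℕ)
    (g : Fin c.coeffs.length → H) :
    g ∈ c.solutions len ↔ c.Holds (∑ i, c.coeffs.get i * (len (g i) : ℤ)) := by
  cases h : c.isEquation <;>
    simp [LengthConstraint.solutions, LengthConstraint.Holds, lengthEqSet, lengthLeSet, h]

/-- The length is exactly N when the sublevel condition holds at N and fails at N - 1. For N = 0 it
fails at -1 because of the clause `0 ≤ x 0`. -/
theorem mem_solutionVectors_iff {len : G → ℕ} {R : ℕ → (Fin (D.rank + 1) → ℤ) → Prop}
    (hR : ∀ (j : Fin D.index) (x : Fin (D.rank + 1) → ℤ), R j x ↔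
      0 ≤ x 0 ∧ (len (basisProd b (Fin.tail x) * t j) : ℤ) ≤ x 0)
    {J : List ℕ} (hJ : J ∈ listsOf (List.range D.index) c.coeffs.length)
    (x : Fin (totalDim D c) → ℤ) :
    x ∈ solutionVectors c len b t J ↔
      (List.ofFn x).getD 0 0 = totalLength D.rank c.coeffs.length (List.ofFn x) ∧
      (∀ i ∈ List.range c.coeffs.length,
        R (J.getD i 0) (blockHom _ D.rank i x) ∧
        ¬ R (J.getD i 0) (blockHom _ D.rank i x - vec _ [1])) ∧
      c.Holds (c.lengthSum D.rank (List.ofFn x)) := by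
  have h1 : (∀ i ∈ List.range c.coeffs.length,
        R (J.getD i 0) (blockHom _ D.rank i x) ∧
        ¬ R (J.getD i 0) (blockHom _ D.rank i x - vec _ [1])) ↔
      ∀ i : Fin c.coeffs.length, blockHom _ D.rank i x 0 =
        len (tupleOf b t c.coeffs.length J x i) := by
    rw [Fin.forall_iff]
    simp only [List.mem_range]
    refine forall₂_congr fun i hi => ?_
    obtain ⟨hj, heq⟩ := tupleOf_apply (b := b) (t := t) hJ x ⟨i, hi⟩
    rw [heq]
    have hs : Fin.tail (blockHom (totalDim D c) D.rank i x - vec _ [1]) =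
        Fin.tail (blockHom (totalDim D c) D.rank i x) := by
      ext l
      simp [Fin.tail, vec_cons, vec_nil]
    have hs0 : (blockHom (totalDim D c) D.rank i x - vec (D.rank + 1) [1]) 0 =
        blockHom (totalDim D c) D.rank i x 0 - 1 := by
      simp [vec]
    rw [hR ⟨_, hj⟩ (blockHom (totalDim D c) D.rank i x),
      hR ⟨_, hj⟩ (blockHom (totalDim D c) D.rank i x - vec _ [1]), hs, hs0]
    simp only
    omega
  have h2 : totalLength D.rank c.coeffs.length (List.ofFn x) =
      ∑ i : Fin c.coeffs.length, blockHom (totalDim D c) D.rank i x 0 := by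
    rw [totalLength, sum_range_eq_sum_map, Finset.sum_range]
    refine Finset.sum_congr rfl fun i _ => ?_
    rw [blockHom, AddMonoidHom.pi_apply, coordHom_apply]
    rfl
  have h3 : c.lengthSum D.rank (List.ofFn x) = ∑ i : Fin c.coeffs.length,
      c.coeffs.get i * blockHom (totalDim D c) D.rank i x 0 := by
    rw [LengthConstraint.lengthSum, sum_range_eq_sum_map, Finset.sum_range]
    refine Finset.sum_congr rfl fun i _ => ?_
    rw [blockHom, AddMonoidHom.pi_apply, coordHom_apply]
    simp
  rw [h1, h2, h3, ← coordHom_apply, solutionVectors, Set.mem_ofPred_eq, mem_solutions_iff]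
  constructor
  · rintro ⟨ha, hb, hc⟩
    simp only [hb] at ha ⊢
    exact ⟨by simpa only [hb] using hc, fun _ => trivial, ha⟩
  · rintro ⟨ha, hb, hc⟩
    refine ⟨?_, hb, ha⟩
    simpa only [hb] using hc

theorem exists_mem_solutionVectors (hD : D.Describes b t) (len : G → ℕ)
    {g : Fin c.coeffs.length → G} (hg : g ∈ c.solutions len) :
    ∃ J ∈ listsOf (List.range D.index) c.coeffs.length, ∃ x ∈ solutionVectors c len b t J,
      g = tupleOf b t c.coeffs.length J x := by
  choose a j haj using fun i => hD.exists_normalForm (g i)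
  obtain ⟨x, hx0, hx⟩ : ∃ x : Fin (totalDim D c) → ℤ,
      coordHom (totalDim D c) 0 x = ∑ i, (len (g i) : ℤ) ∧ ∀ i : Fin c.coeffs.length,
        blockHom (totalDim D c) D.rank i x = Fin.cons (len (g i) : ℤ) (a i) :=
    exists_blockHom_eq _ _
  have hJ : List.ofFn (fun i => (j i : ℕ)) ∈ listsOf (List.range D.index) c.coeffs.length := by
    refine mem_listsOf.2 ⟨by simp, fun l hl => ?_⟩
    obtain ⟨i, rfl⟩ := (List.mem_ofFn' _ _).1 hl
    exact List.mem_range.2 (j i).2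
  have hgx : g = tupleOf b t c.coeffs.length (List.ofFn fun i => (j i : ℕ)) x := by
    ext i
    simp only [tupleOf, hx, Fin.tail_cons, haj i]
    rw [← entry_val t (j i)]
    simp
  refine ⟨_, hJ, x, ⟨hgx ▸ hg, fun i => ?_, ?_⟩, hgx⟩
  · rw [← hgx]
    exact (congrFun (hx i) 0).trans (Fin.cons_zero _ _)
  · rw [hx0]
    refine Finset.sum_congr rfl fun i _ => ?_
    exact ((congrFun (hx i) 0).trans (Fin.cons_zero _ _)).symm

/-- The first check makes R a solution of the length recursion, hence the true sublevel family. The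
right side of the second check then describes the solution vectors, so E does too. Every solution
has such a vector, and the tags of E only name existing transversal elements. -/
theorem Valid.solutions_eq {R E : List IndexedLinear} (h : Valid D S c R E)
    (hD : D.Describes b t) (hS : WeightedGens.Generates b t S) :
    c.solutions (weightedLength (WeightedGens.value b t S) (WeightedGens.weight S)) =
      SemilinearExpr.value b t c.coeffs.length
        (toSemilinearExpr D.rank c.coeffs.length E) := by
  have hR := fun j x => h.lengthCheck.iff (fun j x hx => h.1.nonneg hx) hD hS j x
  have key : ∀ J ∈ listsOf (List.range D.index) c.coeffs.length, ∀ x,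
      Mem (totalDim D c) E J x ↔ x ∈ solutionVectors c (weightedLength
        (WeightedGens.value b t S) (WeightedGens.weight S)) b t J := by
    intro J hJ x
    rw [mem_solutionVectors_iff (R := fun j x => Mem (D.rank + 1) R [j] x) hR hJ]
    exact (solutionCheck_ofFn_iff h.1 h.2.1 J x).1 (h.solutionCheck hJ x)
  ext g
  rw [value_toSemilinearExpr hD.commute (d := totalDim D c) (Nat.lt_succ_self _)]
  constructor
  · intro hg
    obtain ⟨J, hJ, x, hx, hgx⟩ := exists_mem_solutionVectors hD _ hg
    exact ⟨J, x, (key J hJ x).2 hx, hgx⟩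
  · rintro ⟨J, x, hx, rfl⟩
    have hJ : J ∈ listsOf (List.range D.index) c.coeffs.length := by
      obtain ⟨e, he, rfl, _⟩ := hx
      exact h.2.2.1 e he
    exact ((key J hJ x).1 hx).1

end Solutions

/-- Finitely many semilinear sets are packed into one list, each linear set being tagged with the
index of its part. -/
theorem exists_indexedLinear {d : ℕ} (K : List (List ℕ)) (s : List ℕ → Set (Fin (d + 1) → ℤ))
    (hs : ∀ J ∈ K, IsSemilinearSet (s J)) (h0 : ∀ J ∈ K, ∀ x ∈ s J, 0 ≤ x 0)
    (hfin : ∀ J ∈ K, ∀ N : ℕ, {x ∈ s J | x 0 ≤ N}.Finite) :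
    ∃ E : List IndexedLinear, Positive E ∧ (∀ e ∈ E, e.1 ∈ K) ∧
      ∀ J ∈ K, ∀ x, Mem (d + 1) E J x ↔ x ∈ s J := by
  have h : ∀ J, ∃ L : List ((Fin (d + 1) → ℤ) × List (Fin (d + 1) → ℤ)), J ∈ K →
      (∀ e ∈ L, 0 ≤ e.1 0 ∧ ∀ u ∈ e.2, 1 ≤ u 0) ∧
      ∀ x, x ∈ s J ↔ ∃ e ∈ L, InLinear e.1 e.2.get x := by
    intro J
    by_cases hJ : J ∈ K
    · obtain ⟨L, hL⟩ := exists_list_of_isSemilinearSet (hs J hJ) (h0 J hJ) (hfin J hJ)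
      exact ⟨L, fun _ => hL⟩
    · exact ⟨[], fun h => absurd h hJ⟩
  choose L hL using h
  let enc (J : List ℕ) (e : (Fin (d + 1) → ℤ) × List (Fin (d + 1) → ℤ)) : IndexedLinear :=
    (J, List.ofFn e.1, e.2.map List.ofFn)
  have hE : ∀ e, e ∈ (K.flatMap fun J => (L J).map (enc J)) ↔ ∃ J ∈ K, ∃ f ∈ L J, enc J f = e := by
    simp
  have hlin : ∀ J e x, InLinear (vec (d + 1) (enc J e).2.1)
      (fun l : Fin (enc J e).2.2.length => vec (d + 1) ((enc J e).2.2.get l)) x ↔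
      InLinear e.1 e.2.get x := by
    intro J e x
    have : Set.range (fun l : Fin (enc J e).2.2.length => vec (d + 1) ((enc J e).2.2.get l)) =
        Set.range e.2.get := by
      ext y
      constructor
      · rintro ⟨l, rfl⟩
        obtain ⟨u, hu, hl⟩ := List.mem_map.1 (List.get_mem (enc J e).2.2 l)
        obtain ⟨l', rfl⟩ := List.get_of_mem hu
        exact ⟨l', by simp only [← hl, vec_ofFn]⟩
      · rintro ⟨l, rfl⟩
        obtain ⟨l', hl'⟩ := List.get_of_mem (List.mem_map_of_mem (f := List.ofFn)
          (List.get_mem e.2 l))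
        exact ⟨l', (congrArg (vec (d + 1)) hl').trans (vec_ofFn _)⟩
    rw [inLinear_iff, inLinear_iff, this]
    simp only [enc, vec_ofFn]
  refine ⟨K.flatMap fun J => (L J).map (enc J), ?_, ?_, ?_⟩
  · intro e he
    obtain ⟨J, hJ, f, hf, rfl⟩ := (hE e).1 he
    obtain ⟨h1, h2⟩ := (hL J hJ).1 f hf
    refine ⟨by simpa [enc] using h1, fun u hu => ?_⟩
    obtain ⟨v, hv, rfl⟩ := List.mem_map.1 hu
    simpa using h2 v hv
  · intro e he
    obtain ⟨J, hJ, f, hf, rfl⟩ := (hE e).1 he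
    exact hJ
  · intro J hJ x
    rw [(hL J hJ).2]
    constructor
    · rintro ⟨e, he, rfl, hx⟩
      obtain ⟨J, hJ, f, hf, rfl⟩ := (hE e).1 he
      exact ⟨f, hf, (hlin _ _ _).1 hx⟩
    · rintro ⟨f, hf, hx⟩
      exact ⟨_, (hE _).2 ⟨J, hJ, f, hf, rfl⟩, rfl, (hlin _ _ _).2 hx⟩

end VirtAb

namespace VirtAb

/-! ### Existence of valid certificates -/

section Existence

variable {D : Description} {S : WeightedGens} {G : Type*} [Group G]
  {b : Fin D.rank → G} {t : Fin D.index → G}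

open scoped Pointwise in
theorem isSemilinearSet_eq_or_le {d : ℕ} (φ : (Fin d → ℤ) →+ ℤ) (β : ℤ) :
    IsSemilinearSet {x | φ x = β} ∧ IsSemilinearSet {x | φ x ≤ β} := by
  have hle : IsSemilinearSet {y : ℤ | y ≤ β} := by
    have : {y : ℤ | y ≤ β} = β +ᵥ (AddSubmonoid.closure {(-1 : ℤ)} : Set ℤ) := by
      ext y
      simp only [Set.mem_vadd_set, SetLike.mem_coe, AddSubmonoid.mem_closure_singleton,
        vadd_eq_add, exists_exists_eq_and, Set.mem_ofPred_eq]
      constructor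
      · intro h
        exact ⟨(β - y).toNat, by simp; omega⟩
      · rintro ⟨c, rfl⟩
        simp
    rw [this]
    exact (IsSemilinearSet.closure_of_finite (Set.finite_singleton _)).vadd _
  exact ⟨(IsSemilinearSet.of_finite (Set.finite_singleton β)).preimage φ, hle.preimage φ⟩

theorem coordHom_zero {d : ℕ} (x : Fin (d + 1) → ℤ) : coordHom (d + 1) 0 x = x 0 := by
  rw [coordHom, dif_pos d.succ_pos]
  rfl

/-- The total length in coordinate 0 serves this purpose: it bounds every single length, which the
constraint itself cannot do as its coefficients may be zero or negative. The tuple then determines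
the whole vector. -/
theorem finite_solutionVectors (hD : D.Describes b t) (c : LengthConstraint) {len : G → ℕ}
    (hlen : ∀ N, {g | len g ≤ N}.Finite) {J : List ℕ}
    (hJ : J ∈ listsOf (List.range D.index) c.coeffs.length) (N : ℕ) :
    {x ∈ solutionVectors c len b t J | coordHom (totalDim D c) 0 x ≤ N}.Finite := by
  refine Set.Finite.of_finite_image (f := tupleOf b t c.coeffs.length J)
    ((Set.Finite.pi' fun _ => hlen N).subset ?_) ?_
  · rintro _ ⟨x, ⟨⟨_, h1, h2⟩, hN⟩, rfl⟩ i
    have h3 : blockHom (totalDim D c) D.rank i x 0 ≤ coordHom (totalDim D c) 0 x := by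
      rw [h2]
      refine Finset.single_le_sum (f := fun i : Fin c.coeffs.length =>
        blockHom (totalDim D c) D.rank i x 0) (fun l _ => ?_) (Finset.mem_univ i)
      simp [h1]
    rw [h1] at h3
    exact_mod_cast h3.trans hN
  · rintro x ⟨⟨_, hx1, hx2⟩, _⟩ y ⟨⟨_, hy1, hy2⟩, _⟩ hxy
    have hblock : ∀ i : Fin c.coeffs.length, blockHom (totalDim D c) D.rank i x =
        blockHom (totalDim D c) D.rank i y := by
      intro i
      obtain ⟨hj, hx⟩ := tupleOf_apply (b := b) (t := t) hJ x i
      obtain ⟨_, hy⟩ := tupleOf_apply (b := b) (t := t) hJ y i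
      have htail := (hD.normalForm_injective (hx.symm.trans ((congrFun hxy i).trans hy))).1
      have hzero := (hx1 i).trans ((congrArg (fun g => (len (g i) : ℤ)) hxy).trans (hy1 i).symm)
      rw [← Fin.cons_self_tail (blockHom (totalDim D c) D.rank i x), htail, hzero,
        Fin.cons_self_tail]
    refine ext_blockHom ?_ hblock
    rw [← coordHom_zero x, ← coordHom_zero y]
    refine hx2.trans (Eq.trans ?_ hy2.symm)
    simp only [hblock]

-- All conditions are preimages of semilinear sets under homomorphisms, except failure at N - 1,
-- which is the preimage of the complement of a translate.
open scoped Pointwise in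
theorem isSemilinearSet_solutionVectors {c : LengthConstraint} {len : G → ℕ}
    {R : ℕ → (Fin (D.rank + 1) → ℤ) → Prop}
    (hR : ∀ (j : Fin D.index) (x : Fin (D.rank + 1) → ℤ), R j x ↔
      0 ≤ x 0 ∧ (len (basisProd b (Fin.tail x) * t j) : ℤ) ≤ x 0)
    {J : List ℕ} (hJ : J ∈ listsOf (List.range D.index) c.coeffs.length)
    (hRsl : ∀ i < c.coeffs.length, IsSemilinearSet {x | R (J.getD i 0) x}) :
    IsSemilinearSet (solutionVectors c len b t J) := by
  have h1 : IsSemilinearSet {x : Fin (totalDim D c) → ℤ |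
      (List.ofFn x).getD 0 0 = totalLength D.rank c.coeffs.length (List.ofFn x)} := by
    convert (isSemilinearSet_eq_or_le (coordHom (totalDim D c) 0 -
      ∑ i ∈ Finset.range c.coeffs.length, coordHom _ (position D.rank i 0)) 0).1 using 3 with x
    rw [AddMonoidHom.sub_apply, AddMonoidHom.finsetSum_apply, sub_eq_zero]
    simp only [coordHom_apply, totalLength, sum_range_eq_sum_map]
  have h2 : IsSemilinearSet {x : Fin (totalDim D c) → ℤ | c.Holds (c.lengthSum D.rank
      (List.ofFn x))} := by
    have hφ := isSemilinearSet_eq_or_le (∑ i ∈ Finset.range c.coeffs.length,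
      c.coeffs.getD i 0 • coordHom (totalDim D c) (position D.rank i 0)) c.bound
    have hsum : ∀ x : Fin (totalDim D c) → ℤ, c.lengthSum D.rank (List.ofFn x) =
        (∑ i ∈ Finset.range c.coeffs.length,
          c.coeffs.getD i 0 • coordHom (totalDim D c) (position D.rank i 0)) x := by
      intro x
      rw [AddMonoidHom.finsetSum_apply, LengthConstraint.lengthSum, sum_range_eq_sum_map]
      simp only [AddMonoidHom.smul_apply, coordHom_apply, smul_eq_mul]
    simp only [LengthConstraint.Holds, hsum]
    cases c.isEquation with
    | true => simpa using hφ.1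
    | false => simpa using hφ.2
  have h3 : IsSemilinearSet (⋂ i : Fin c.coeffs.length, {x : Fin (totalDim D c) → ℤ |
      R (J.getD i 0) (blockHom _ D.rank i x) ∧
      ¬ R (J.getD i 0) (blockHom _ D.rank i x - vec _ [1])}) := by
    refine IsSemilinearSet.iInter fun i => ?_
    have hA := hRsl i i.2
    have hB := hA.vadd (vec (D.rank + 1) [1])
    convert (hA.preimage (blockHom (totalDim D c) D.rank i)).inter
      ((hB.preimage (blockHom (totalDim D c) D.rank i)).compl) using 1
    ext x
    simp [Set.mem_vadd_set_iff_neg_vadd_mem, sub_eq_neg_add]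
  convert (h1.inter h3).inter h2 using 1
  ext x
  rw [mem_solutionVectors_iff hR hJ, ← and_assoc]
  simp [Fin.forall_iff]

/-- Completeness of the search: the sublevel sets and the solution vectors are semilinear with
finitely many elements below each weight, so they have presentations with positive generators. The
checks then hold at all vectors, in particular on the box. -/
theorem exists_valid (hD : D.Describes b t) (hS : WeightedGens.Generates b t S)
    (c : LengthConstraint) : ∃ R E, Valid D S c R E := by
  obtain ⟨R₀, hfam, hnn, hsl⟩ := exists_isLengthFamily D S fun j hj s hs =>
    (hD.transition_spec hj (hS.inRange s hs).2).1
  have hR₀ := fun j x => hfam.iff hnn hD hS j x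
  set len := weightedLength (WeightedGens.value b t S) (WeightedGens.weight S) with hlen
  have hfin : ∀ N, {g | len g ≤ N}.Finite := fun N =>
    finite_weightedLength_le hS.closure_eq_top (fun i => hS.weight_pos _ (List.get_mem S i)) N
  obtain ⟨R, hR, -, hR'⟩ := exists_indexedLinear ((List.range D.index).map fun j => [j])
    (fun J => {x | R₀ (J.getD 0 0) x}) (by
      intro J hJ
      obtain ⟨j, hj, rfl⟩ := List.mem_map.1 hJ
      exact hsl j (List.mem_range.1 hj)) (fun J _ x hx => hnn _ x hx) (by
      intro J hJ N
      obtain ⟨j, hj, rfl⟩ := List.mem_map.1 hJ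
      rw [List.mem_range] at hj
      -- A vector of weight at most N is determined by its weight in [0, N] and by an element of
      -- length at most N.
      refine Set.Finite.of_finite_image
        (f := fun x : Fin (D.rank + 1) → ℤ => (x 0, basisProd b (Fin.tail x) * t ⟨j, hj⟩))
        (((Set.finite_Icc (0 : ℤ) N).prod (hfin N)).subset ?_) ?_
      · rintro _ ⟨x, ⟨hx, hN⟩, rfl⟩
        obtain ⟨h1, h2⟩ := (hR₀ ⟨j, hj⟩ x).1 hx
        exact ⟨⟨h1, hN⟩, by exact_mod_cast h2.trans hN⟩
      · intro x _ y _ hxy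
        rw [Prod.mk.injEq] at hxy
        rw [← Fin.cons_self_tail x, hxy.1, (hD.normalForm_injective hxy.2).1, Fin.cons_self_tail])
  have hmem : ∀ j < D.index, ∀ x, Mem (D.rank + 1) R [j] x ↔ R₀ j x := fun j hj x =>
    hR' [j] (List.mem_map.2 ⟨j, List.mem_range.2 hj, rfl⟩) x
  have hfam' : IsLengthFamily D S fun j x => Mem (D.rank + 1) R [j] x := by
    intro j hj x
    refine (hmem j hj x).trans ((hfam j hj x).trans ?_)
    refine or_congr Iff.rfl (exists_congr fun j' => and_congr_right fun hj' => ?_)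
    simp only [hmem j' hj']
  have hRiff := fun j x => hfam'.iff (fun j x hx => hR.nonneg hx) hD hS j x
  have hRsl : ∀ j < D.index, IsSemilinearSet {x | Mem (D.rank + 1) R [j] x} := by
    intro j hj
    simpa only [hmem j hj] using hsl j hj
  have hsolsl : ∀ J ∈ listsOf (List.range D.index) c.coeffs.length,
      IsSemilinearSet (solutionVectors c len b t J) := by
    intro J hJ
    refine isSemilinearSet_solutionVectors
      (R := fun j x => Mem (D.rank + 1) R [j] x) hRiff hJ fun i hi => hRsl _ ?_
    obtain ⟨h1, h2⟩ := mem_listsOf.1 hJ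
    rw [List.getD_eq_getElem _ _ (by omega)]
    exact List.mem_range.1 (h2 _ (List.getElem_mem _))
  obtain ⟨E, hE, hEJ, hE'⟩ := exists_indexedLinear (d := c.coeffs.length * (D.rank + 1))
    (listsOf (List.range D.index) c.coeffs.length) (fun J => solutionVectors c len b t J)
    hsolsl (by
      rintro J hJ x ⟨_, h1, h2⟩
      rw [← coordHom_zero x]
      exact (Finset.sum_nonneg fun i _ => by simp [h1]).trans_eq h2.symm)
    (fun J hJ N => (finite_solutionVectors hD c hfin hJ N).subset fun x hx =>
      ⟨hx.1, (coordHom_zero x).trans_le hx.2⟩)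
  have hofFn : ∀ {B d : ℕ} {x : List ℤ}, x ∈ box B d → x = List.ofFn (vec d x) := by
    intro B d x hx
    obtain ⟨h, -⟩ := mem_listsOf.1 hx
    refine List.ext_getElem (by simp [h]) fun i h₁ h₂ => ?_
    simp [vec, h₁]
  refine ⟨R, E, hR, hE, hEJ, ?_, ?_⟩
  · intro j hj x hx
    rw [hofFn hx, lengthCheck_ofFn_iff hR]
    exact hfam' j (List.mem_range.1 hj) _
  · intro J hJ x hx
    rw [hofFn hx, solutionCheck_ofFn_iff hR hE,
      ← mem_solutionVectors_iff (R := fun j x => Mem (D.rank + 1) R [j] x) hRiff hJ]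
    exact hE' J hJ _

end Existence

end VirtAb

/-! ### The algorithm -/

namespace VirtAb

/-- Search for a certificate that satisfies a primitive recursive predicate. -/
theorem exists_partrec_search {α β σ : Type*} [Primcodable α] [Primcodable β] [Primcodable σ]
    {p : α × β → Prop} (hp : PrimrecPred p) {g : α × β → σ} (hg : Primrec g) :
    ∃ F : α →. σ, Partrec F ∧ ∀ a, (∀ e ∈ F a, ∃ b, p (a, b) ∧ g (a, b) = e) ∧
      ((∃ b, p (a, b)) → (F a).Dom) := by
  obtain ⟨_, hp⟩ := hp
  let f (a : α) (N : ℕ) : Option σ :=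
    (Encodable.decode (α := β) N).bind fun b => bif decide (p (a, b)) then some (g (a, b)) else none
  have hf : Primrec₂ f := by
    refine Primrec.option_bind (Primrec.decode.comp .snd) ?_
    have hq : Primrec fun q : (α × ℕ) × β => (q.1.1, q.2) :=
      Primrec.pair (Primrec.fst.comp .fst) .snd
    exact Primrec.cond (hp.comp hq) (Primrec.option_some.comp (hg.comp hq)) (.const none)
  have hmem : ∀ a N e, e ∈ f a N ↔ ∃ b, Encodable.decode N = some b ∧ p (a, b) ∧ g (a, b) = e := by
    intro a N e
    simp only [f, Option.mem_def, Option.bind_eq_some_iff]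
    refine exists_congr fun b => and_congr_right fun _ => ?_
    by_cases h : p (a, b) <;> simp [h]
  refine ⟨fun a => Nat.rfindOpt (f a), Partrec.rfindOpt hf.to_comp, fun a => ⟨?_, ?_⟩⟩
  · intro e he
    obtain ⟨N, hN⟩ := Nat.rfindOpt_spec he
    obtain ⟨b, -, hb⟩ := (hmem _ _ _).1 hN
    exact ⟨b, hb⟩
  · rintro ⟨b, hb⟩
    exact Nat.rfindOpt_dom.2 ⟨Encodable.encode b, _,
      (hmem _ _ _).2 ⟨b, Encodable.encodek _, hb, rfl⟩⟩

theorem exists_partrec_certificate :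
    ∃ F : Description × WeightedGens × LengthConstraint →. SemilinearExpr, Partrec F ∧
      ∀ a, (∀ e ∈ F a, ∃ p : List IndexedLinear × List IndexedLinear,
        Valid a.1 a.2.1 a.2.2 p.1 p.2 ∧ toSemilinearExpr a.1.rank a.2.2.coeffs.length p.2 = e) ∧
      ((∃ p : List IndexedLinear × List IndexedLinear, Valid a.1 a.2.1 a.2.2 p.1 p.2) →
        (F a).Dom) := by
  have hin : Primrec fun q : (Description × WeightedGens × LengthConstraint) ×
      List IndexedLinear × List IndexedLinear => q.1 := .fst
  have hD := Primrec.fst.comp hin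
  have hS := Primrec.fst.comp (Primrec.snd.comp hin)
  have hc := Primrec.snd.comp (Primrec.snd.comp hin)
  have hcert : Primrec fun q : (Description × WeightedGens × LengthConstraint) ×
      List IndexedLinear × List IndexedLinear => q.2 := .snd
  have hR := Primrec.fst.comp hcert
  have hE := Primrec.snd.comp hcert
  exact exists_partrec_search (primrecPred_valid hD hS hc hR hE)
    (primrec_toSemilinearExpr (primrec_rank.comp hD) (primrec_numCoeffs hc) hE)

/-- The search uses only the finite data. The group enters in the proof that some certificate
exists, and whichever one is found first describes the solutions in every group with this
description. -/
theorem exists_partrec_solutions_eq :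
    ∃ F : Description × WeightedGens × LengthConstraint →. SemilinearExpr, Partrec F ∧
      ∀ (D : Description) (S : WeightedGens) (c : LengthConstraint) (G : Type*) [Group G]
        (b : Fin D.rank → G) (t : Fin D.index → G), D.Describes b t →
        WeightedGens.Generates b t S → ∃ E ∈ F (D, S, c),
          SemilinearExpr.InRange D.rank D.index c.coeffs.length E ∧
          c.solutions (weightedLength (WeightedGens.value b t S) (WeightedGens.weight S)) =
            SemilinearExpr.value b t c.coeffs.length E := by
  obtain ⟨F, hF, hspec⟩ := exists_partrec_certificate
  refine ⟨F, hF, fun D S c G _ b t hD hS => ?_⟩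
  obtain ⟨h1, h2⟩ := hspec (D, S, c)
  obtain ⟨R₀, E₀, hV₀⟩ := exists_valid hD hS c
  obtain ⟨e, he⟩ := Part.dom_iff_mem.1 (h2 ⟨(R₀, E₀), hV₀⟩)
  obtain ⟨⟨R, E⟩, hV, rfl⟩ := h1 e he
  exact ⟨_, he, inRange_toSemilinearExpr hV.2.2.1, hV.solutions_eq hD hS⟩

end VirtAb

/-! ### Descriptions of finitely generated virtually abelian groups -/

/-- Split K as a free part times a finite group, and let e be the order of the latter. Taking e-th
powers kills the torsion, and the e-th powers of a basis of the free part generate all e-th powers.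
Describing the subgroup as a set of powers makes it invariant under automorphisms. -/
theorem CommGroup.exists_independent_closure_eq_range_pow (K : Type*) [CommGroup K] [Group.FG K] :
    ∃ (n : ℕ) (c : Fin n → K) (e : ℕ), 0 < e ∧
      (∀ a : Fin n → ℤ, ∏ i, c i ^ a i = 1 → a = 0) ∧
      Subgroup.closure (Set.range c) = (powMonoidHom e : K →* K).range := by
  obtain ⟨ι, j, _, _, p, hp, r, ⟨φ⟩⟩ := CommGroup.equiv_free_prod_prod_multiplicative_zmod K
  have : ∀ i, NeZero (p i ^ r i) := fun i => ⟨pow_ne_zero _ (hp i).ne_zero⟩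
  have : ∀ i, Fintype (Multiplicative (ZMod (p i ^ r i))) := fun i =>
    inferInstanceAs (Fintype (ZMod (p i ^ r i)))
  classical
  set e := Fintype.card ((i : ι) → Multiplicative (ZMod (p i ^ r i))) with he
  have hpow : ∀ y : (i : ι) → Multiplicative (ZMod (p i ^ r i)), y ^ e = 1 := fun y =>
    pow_card_eq_one
  have hepos : 0 < e := Fintype.card_pos
  let c (l : j) : K := φ.symm (Pi.mulSingle l (Multiplicative.ofAdd 1), 1) ^ e
  have hprod : ∀ a : j → ℤ, φ (∏ l, c l ^ a l) = (fun l => Multiplicative.ofAdd (e * a l), 1) := by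
    intro a
    rw [map_prod]
    simp only [c, map_zpow, map_pow, MulEquiv.apply_symm_apply]
    refine Prod.ext ?_ ?_
    · rw [Prod.fst_prod]
      ext l
      rw [Finset.prod_apply, Finset.prod_eq_single l]
      · change ((Pi.mulSingle l (Multiplicative.ofAdd 1) : j → Multiplicative ℤ) l ^ e) ^ a l = _
        rw [Pi.mulSingle_eq_same, ← ofAdd_nsmul, ← ofAdd_zsmul]
        refine congrArg Multiplicative.ofAdd (?_ : a l • e • (1 : ℤ) = e * a l)
        rw [nsmul_one, smul_eq_mul, mul_comm]
      · intro l' _ hl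
        simp [Pi.mulSingle_eq_of_ne hl.symm]
      · simp
    · rw [Prod.snd_prod]
      simp
  let ψ := Fintype.equivFin j
  refine ⟨Fintype.card j, fun i => c (ψ.symm i), e, hepos, ?_, ?_⟩
  · intro a ha
    have h1 : ∏ l, c l ^ a (ψ l) = 1 := by
      rw [← ha, ← ψ.prod_comp]
      simp
    have h2 := (hprod fun l => a (ψ l)).symm.trans (by rw [h1, map_one])
    ext i
    have h3 := congrFun (congrArg Prod.fst h2) (ψ.symm i)
    have h4 : (e : ℤ) * a i = 0 := by
      simpa [or_comm] using congrArg Multiplicative.toAdd h3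
    rcases mul_eq_zero.1 h4 with h | h
    · exact absurd h (by exact_mod_cast hepos.ne')
    · exact h
  · refine le_antisymm ((Subgroup.closure_le _).2 ?_) ?_
    · rintro _ ⟨i, rfl⟩
      exact ⟨_, rfl⟩
    · rintro _ ⟨x, rfl⟩
      have hx : powMonoidHom e x = ∏ l, c l ^ Multiplicative.toAdd ((φ x).1 l) := by
        apply φ.injective
        rw [hprod, powMonoidHom_apply, map_pow]
        refine Prod.ext ?_ (hpow _)
        ext l
        simp [mul_comm]
      rw [hx]
      refine Subgroup.prod_mem _ fun l _ => Subgroup.zpow_mem _ (Subgroup.subset_closure ?_) _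
      exact ⟨ψ l, by simp⟩

namespace VirtAb

/-- The normal core of the abelian subgroup is abelian, normal and of finite index. Its subgroup of
e-th powers is stable under conjugation by G, hence normal in G, and still has finite index. -/
theorem exists_basis_of_isVirtuallyAbelian {G : Type*} [Group G] [Group.FG G]
    (hG : IsVirtuallyAbelian G) : ∃ (n : ℕ) (b : Fin n → G), (∀ i j, b i * b j = b j * b i) ∧
      (∀ a : Fin n → ℤ, basisProd b a = 1 → a = 0) ∧
      (Subgroup.closure (Set.range b)).Normal ∧ (Subgroup.closure (Set.range b)).FiniteIndex := by
  obtain ⟨A, hA, hcomm⟩ := hG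
  let K := A.normalCore
  have hK : K.FiniteIndex := inferInstance
  let _ : CommGroup K := { (inferInstance : Group K) with
    mul_comm := fun x y => Subtype.ext
      (hcomm x (A.normalCore_le x.2) y (A.normalCore_le y.2)) }
  have : Group.FG K := Subgroup.fg_of_index_ne_zero K
  obtain ⟨n, c, e, he, hind, hcl⟩ := CommGroup.exists_independent_closure_eq_range_pow K
  have hclosure : Subgroup.closure (Set.range fun i => (c i : G)) =
      (powMonoidHom e : K →* K).range.map K.subtype := by
    rw [← hcl, MonoidHom.map_closure, ← Set.range_comp]
    rfl
  refine ⟨n, fun i => (c i : G), fun i j => congrArg Subtype.val (mul_comm (c i) (c j)), ?_, ?_, ?_⟩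
  · intro a ha
    refine hind a (Subtype.ext ?_)
    refine Eq.trans ?_ ha
    rw [basisProd, ← List.prod_ofFn, ← K.coe_subtype, map_list_prod, List.map_ofFn]
    rfl
  · rw [hclosure]
    refine ⟨?_⟩
    rintro _ ⟨_, ⟨x, rfl⟩, rfl⟩ g
    refine ⟨_, ⟨⟨g * x * g⁻¹, A.normalCore_normal.conj_mem _ x.2 g⟩, rfl⟩, ?_⟩
    simp [conj_pow]
  · rw [hclosure]
    refine ⟨?_⟩
    rw [Subgroup.index_map_subtype]
    exact mul_ne_zero (Subgroup.finiteIndex_range_powMonoidHom_of_fg K he.ne').index_ne_zero hK.index_ne_zero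

theorem exists_describes {G : Type*} [Group G] [Group.FG G] (hG : IsVirtuallyAbelian G) :
    ∃ (D : Description) (b : Fin D.rank → G) (t : Fin D.index → G), D.Describes b t := by
  obtain ⟨n, b, hb, hind, hnormal, hfin⟩ := exists_basis_of_isVirtuallyAbelian hG
  obtain ⟨T, hT, -⟩ := (Subgroup.closure (Set.range b)).exists_isComplement_right 1
  have : Finite T := hT.finite_right
  obtain ⟨m, ⟨ψ⟩⟩ := Finite.exists_equiv_fin T
  let t (j : Fin m) : G := ψ.symm j
  have ht : Set.range t = T := by
    change Set.range (Subtype.val ∘ ψ.symm) = T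
    rw [Set.range_comp, ψ.symm.surjective.range_eq, Set.image_univ, Subtype.range_coe]
  have hnf : ∀ g : G, ∃ u : NormalForm, u.InRange n m ∧ normalFormValue b t u = g := by
    intro g
    obtain ⟨⟨⟨x, hx⟩, y⟩, hg⟩ := hT.2 g
    obtain ⟨a, rfl⟩ := (mem_closure_range_iff hb _).1 hx
    refine ⟨(List.ofFn a, ψ y), ⟨by simp, (ψ y).2⟩, ?_⟩
    rw [normalFormValue_eq _ _ _ (ψ y).2, vec_ofFn, ← hg]
    simp [t]
  choose nf hnf1 hnf2 using hnf
  let letters : List Letter := ((List.range n).map Sum.inl ++ (List.range m).map Sum.inr).flatMap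
    fun x => [(x, true), (x, false)]
  have hletters : ∀ x, x ∈ letters ↔ Letter.InRange n m x := by
    rintro ⟨x | x, s⟩ <;> cases s <;> simp [letters, Letter.InRange]
  refine ⟨⟨n, m, letters.flatMap fun x => letters.map fun y =>
    ((x, y), nf (letterValue b t x * letterValue b t y))⟩, b, t, hb, hind, hnormal,
    Subtype.val_injective.comp ψ.symm.injective, ht ▸ hT, ?_, ?_⟩
  · intro x y u hu
    simp only [List.mem_flatMap, List.mem_map] at hu
    obtain ⟨x, hx, y, hy, h⟩ := hu
    cases h
    exact ⟨(hletters _).1 hx, (hletters _).1 hy, hnf1 _, hnf2 _⟩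
  · intro x y hx hy
    exact ⟨_, List.mem_flatMap.2 ⟨x, (hletters x).2 hx,
      List.mem_map.2 ⟨y, (hletters y).2 hy, rfl⟩⟩⟩

theorem exists_weightedGens {G ι : Type*} [Group G] [Fintype ι] {D : Description}
    {b : Fin D.rank → G} {t : Fin D.index → G} (hD : D.Describes b t) {σ : ι → G} {w : ι → ℕ}
    (hw : ∀ i, 0 < w i) (hσ : Submonoid.closure (Set.range σ) = ⊤) :
    ∃ S : WeightedGens, WeightedGens.Generates b t S ∧
      weightedLength (WeightedGens.value b t S) (WeightedGens.weight S) = weightedLength σ w := by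
  have hnf : ∀ g : G, ∃ u : NormalForm, u.InRange D.rank D.index ∧ normalFormValue b t u = g := by
    intro g
    obtain ⟨a, j, rfl⟩ := hD.exists_normalForm g
    refine ⟨(List.ofFn a, j), ⟨by simp, j.2⟩, ?_⟩
    rw [normalFormValue_eq _ _ _ j.2, vec_ofFn]
  choose nf hnf1 hnf2 using hnf
  let ψ := Fintype.equivFin ι
  let S : WeightedGens := List.ofFn fun i => (nf (σ (ψ.symm i)), w (ψ.symm i))
  let χ : Fin S.length ≃ ι := (finCongr (List.length_ofFn)).trans ψ.symm
  have hget : ∀ i, S.get i = (nf (σ (χ i)), w (χ i)) := by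
    intro i
    simp only [S, χ, List.get_ofFn]
    rfl
  have hval : WeightedGens.value b t S = σ ∘ χ := by
    ext i
    rw [WeightedGens.value, hget, hnf2]
    rfl
  have hwt : WeightedGens.weight S = w ∘ χ := by
    ext i
    rw [WeightedGens.weight, hget]
    rfl
  refine ⟨S, ⟨?_, ?_, ?_⟩, ?_⟩
  · intro s hs
    obtain ⟨i, rfl⟩ := List.get_of_mem hs
    rw [hget]
    exact hnf1 _
  · intro s hs
    obtain ⟨i, rfl⟩ := List.get_of_mem hs
    rw [hget]
    exact hw _
  · rw [hval, χ.surjective.range_comp, hσ]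
  · rw [hval, hwt]
    exact funext fun g => weightedLength_eq_of_equiv χ g

/-- Any description and any valid certificate will do: the solutions are a finite union of sets a
B^*, and these are rational over every generating family, not only over the letters of the
description. -/
theorem isRationalSubset_solutions {G : Type*} [Group G] (hG : IsVirtuallyAbelian G) {ι κ : Type*}
    [Fintype ι] [Finite κ] {σ : ι → G} {w : ι → ℕ} (hw : ∀ i, 0 < w i)
    (hσ : Submonoid.closure (Set.range σ) = ⊤) (c : LengthConstraint)
    {X : κ → Fin c.coeffs.length → G} (hX : Submonoid.closure (Set.range X) = ⊤) :
    IsRationalSubset X (c.solutions (weightedLength σ w)) := by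
  have : Group.FG G := Group.fg_iff_monoid_fg.2
    ⟨(Submonoid.fg_iff _).2 ⟨_, hσ, Set.finite_range σ⟩⟩
  obtain ⟨D, b, t, hD⟩ := exists_describes hG
  obtain ⟨S, hS, hlen⟩ := exists_weightedGens hD hw hσ
  obtain ⟨R, E, hV⟩ := exists_valid hD hS c
  rw [← hlen, hV.solutions_eq hD hS]
  exact isRationalSubset_exists_mem hX _ _ _ fun p _ => p.2.finite_toSet.image _

end VirtAb

/-! ### The two statements together -/

theorem mainTheorem4 :
    -- every length constraint is rational, over every finite generating set of the power
    (∀ (G : Type*) [Group G], IsVirtuallyAbelian G →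
      ∀ (ι : Type) [Fintype ι] (σ : ι → G) (w : ι → ℕ), (∀ i, 0 < w i) →
        Submonoid.closure (Set.range σ) = ⊤ →
      ∀ (k : ℕ), 0 < k → ∀ (α : Fin k → ℤ) (β : ℤ)
        (κ : Type) [Fintype κ] (X : κ → Fin k → G), Submonoid.closure (Set.range X) = ⊤ →
        IsRationalSubset X (lengthEqSet (weightedLength σ w) α β) ∧
        IsRationalSubset X (lengthLeSet (weightedLength σ w) α β)) ∧
    -- one algorithm computes an expression from a description, weighted generators, a constraint
    (∃ F : VirtAb.Description × VirtAb.WeightedGens × VirtAb.LengthConstraint →.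
        VirtAb.SemilinearExpr,
      Partrec F ∧
      ∀ (D : VirtAb.Description) (S : VirtAb.WeightedGens) (c : VirtAb.LengthConstraint)
        (G : Type*) [Group G] (b : Fin D.rank → G) (t : Fin D.index → G),
        D.Describes b t → VirtAb.WeightedGens.Generates b t S → 0 < c.coeffs.length →
        ∃ E ∈ F (D, S, c),
          VirtAb.SemilinearExpr.InRange D.rank D.index c.coeffs.length E ∧
          c.solutions (weightedLength (VirtAb.WeightedGens.value b t S)
              (VirtAb.WeightedGens.weight S)) =
            {g | ∃ u ∈ (VirtAb.SemilinearExpr.toRegex E).matches',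
              VirtAb.tupleWordValue b t c.coeffs.length u = g} ∧
          c.solutions (weightedLength (VirtAb.WeightedGens.value b t S)
              (VirtAb.WeightedGens.weight S)) =
            VirtAb.SemilinearExpr.value b t c.coeffs.length E) := by
  refine ⟨fun G _ hG ι _ σ w hw hσ k _ α β κ _ X hX => ?_, ?_⟩
  -- The coefficients are stored as a list, so that k becomes its length and both kinds of
  -- constraint are instances of `LengthConstraint`.
  · obtain ⟨l, rfl, hl⟩ : ∃ (l : List ℤ) (h : l.length = k), α = fun i => l.get (i.cast h.symm) :=
      ⟨List.ofFn α, List.length_ofFn, by ext i; simp⟩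
    subst hl
    exact ⟨VirtAb.isRationalSubset_solutions hG hw hσ ⟨l, β, true⟩ hX,
      VirtAb.isRationalSubset_solutions hG hw hσ ⟨l, β, false⟩ hX⟩
  · obtain ⟨F, hF, hspec⟩ := VirtAb.exists_partrec_solutions_eq
    refine ⟨F, hF, fun D S c G _ b t hD hS _ => ?_⟩
    obtain ⟨E, hE, hrange, heq⟩ := hspec D S c G b t hD hS
    exact ⟨E, hE, hrange, heq.trans (VirtAb.toRegex_value _ E).symm, heq⟩
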